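/- **Conventions.** The visibility graph of a finite point set $P\subset\mathbb R^2$ has vertex set $P$; distinct $u,v\in P$ are adjacent iff the open segment $uv$ contains no point of $P$. A realization of a graph $G$ is an injective map $\varphi$ from its vertices to $\mathbb R^2$ such that distinct $u,v$ are adjacent in $G$ iff no point of the image of $\varphi$ lies on the open segment $\varphi(u)\varphi(v)$. **Generalized fans.** Let $H>0$, let $\ell=\{y=0\}$ and $\ell'=\{y=H\}$ be parallel lines, and let $p$ be their common point at infinity, approached to the left. Let $S$ be a set of $n$ distinct segments, each with one endpoint on $\ell$ and one on $\ell'$ (shared endpoints are allowed). A crossing is an intersection of two segments of $S$ strictly between $\ell$ and $\ell'$. Take: * three parallel, equidistant segments $s_1,s_2,s_3$ (from left to right) from $\ell$ to $\ell'$, to the left of all segments of $S$; * at least two bundles. A bundle consists of $5n$ horizontal rays from $p$, with constant distance $\varepsilon$ between consecutive rays ($\varepsilon$ may depend on the bundle). Every bundle except the highest is extended upwards, and every bundle except the lowest is extended downwards, by $(5n)^4$ horizontal segments from $p$ to $s_3$ (extension segments), continuing the bundle with the same spacing $\varepsilon$. The extended bundles lie strictly between $\ell$ and $\ell'$ and strictly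 one above the other. The height of each crossing lies strictly between two consecutive bundles (so the lowest bundle lies between $\ell$ and all crossings, and the highest between all crossings and $\ell'$); * optionally, finitely many single horizontal rays from $p$, each through a crossing and strictly between two consecutive extended bundles; if a single ray is used between two consecutive bundles, then every crossing between these two bundles lies on a single ray; * a segment $s_0$ from $\ell$ to $\ell'$, between $p$ and $s_1$. The rays are those of the bundles, the single rays, and the ones on $\ell$ and $\ell'$. Outside of $p$, the points of the fan are all intersections of $s_0,s_1,s_2,s_3$ with rays and extension segments, and all intersections of segments of $S$ with rays. (A crossing that lies on no ray is not a point.) The segment $s_0$ is chosen such that each of its points sees every point that lies neither on $s_0$ nor on the same horizontal line. If the total number of rays and extension segments is odd (which does not happen for two bundles without single rays), we assume that none of them is at height exactly $H/2$. Finally apply a projective transformation which sends $p$ to a point of the plane and for which the line sent to infinity does not meet the picture (the convex hull of the points, with $p$ as the limit point on the left), and add the image of $p$ to the point set. The visibility graph of the resulting point set is called a generalized fan; its segments are the images of the segments of $S$, of $s_0,\dots,s_3$ and of the extension segments, and its rays are the images of the rays, with origin $p$. **Lemma.** Let $G$ be a generalized fan and let $\varphi$ be any realization of $G$. For each segment of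 the fan, the images under $\varphi$ of all points of the fan on this segment are collinear; and for each ray of the fan, the images under $\varphi$ of all points of the fan on this ray ($p$ included) are collinear. -/

import Mathlib

/-- The plane. -/
abbrev Plane : Type := ℝ × ℝ

/-- The point visibility graph of a point set `P` in the plane: two distinct points are adjacent
iff the open segment between them contains no point of `P`. -/
def visibilityGraph (P : Set Plane) : SimpleGraph P where
  Adj u v := u ≠ v ∧ IsVisible ℝ P (u : Plane) (v : Plane)
  symm := ⟨fun _ _ h => ⟨h.1.symm, h.2.symm⟩⟩
  loopless := ⟨fun _ h => h.1 rfl⟩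

/-- A realization of a graph `G`: a placement of the vertices at pairwise distinct points of the
plane such that adjacency is mutual visibility among the placed points. -/
def IsRealization {V : Type*} (G : SimpleGraph V) (φ : V → Plane) : Prop :=
  Function.Injective φ ∧
    ∀ u v : V, u ≠ v → (G.Adj u v ↔ IsVisible ℝ (Set.range φ) (φ u) (φ v))

/-- The parameters of a generalized fan.  The construction is first drawn in a horizontal strip
`0 ≤ y ≤ H`, where the lines `ℓ : y = 0` and `ℓ' : y = H` meet in a point `p` at infinity on the
left, and is then moved by a projective transformation. -/
structure FanData where
  /-- the number of given segments -/
  n : ℕ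
  /-- the number of bundles, besides the one close to `ℓ` and the one close to `ℓ'` -/
  k : ℕ
  /-- the height of the strip -/
  H : ℝ
  /-- segment number `t` of `S` joins `(a t, 0)` and `(b t, H)` -/
  a : Fin n → ℝ
  b : Fin n → ℝ
  /-- for `j = 1, 2, 3` the segment `s_j` joins `(c + j * δ, 0)` and `(d + j * δ, H)` -/
  c : ℝ
  d : ℝ
  δ : ℝ
  /-- the segment `s_0` joins `(c₀, 0)` and `(d₀, H)` -/
  c₀ : ℝ
  d₀ : ℝ
  /-- bundle number `β`, counted from `ℓ` to `ℓ'`, has its rays at the heights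
  `base β + i * ε β`, `1 ≤ i ≤ 5 n` -/
  base : Fin (k + 2) → ℝ
  ε : Fin (k + 2) → ℝ
  /-- the heights of the single rays that pass through crossings of segments of `S` -/
  singles : Finset ℝ
  /-- the matrix of the projective transformation -/
  A : Matrix (Fin 3) (Fin 3) ℝ

namespace FanData

variable (F : FanData)

/-- The point at height `y` of the segment from `(x, 0)` to `(x', H)`. -/
noncomputable def stripPoint (x x' y : ℝ) : Plane := (x + y / F.H * (x' - x), y)

/-- The point at height `y` of segment number `t` of `S`. -/
noncomputable def segPoint (t : Fin F.n) (y : ℝ) : Plane := F.stripPoint (F.a t) (F.b t) y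

/-- The lower end, on `ℓ`, of the segment `s_j`, `j = 0, 1, 2, 3`. -/
noncomputable def colLow (j : Fin 4) : ℝ := if j = 0 then F.c₀ else F.c + (j : ℕ) * F.δ

/-- The upper end, on `ℓ'`, of the segment `s_j`, `j = 0, 1, 2, 3`. -/
noncomputable def colHigh (j : Fin 4) : ℝ := if j = 0 then F.d₀ else F.d + (j : ℕ) * F.δ

/-- The point at height `y` of the segment `s_j`, `j = 0, 1, 2, 3`. -/
noncomputable def colPoint (j : Fin 4) (y : ℝ) : Plane :=
  F.stripPoint (F.colLow j) (F.colHigh j) y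

/-- The heights of the `5 n` rays of bundle `β`. -/
def bundle (β : Fin (F.k + 2)) : Set ℝ :=
  {y | ∃ i : ℤ, 1 ≤ i ∧ i ≤ 5 * F.n ∧ y = F.base β + i * F.ε β}

/-- The heights of the extension segments of bundle `β`: `(5 n) ^ 4` of them above the bundle,
unless it is the bundle close to `ℓ'`, and `(5 n) ^ 4` below it, unless it is the bundle close to
`ℓ`; they continue the bundle with the same spacing. -/
def extension (β : Fin (F.k + 2)) : Set ℝ :=
  {y | ∃ i : ℤ, ((β ≠ Fin.last (F.k + 1) ∧ 5 * F.n < i ∧ i ≤ 5 * F.n + (5 * F.n) ^ 4) ∨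
    (β ≠ 0 ∧ -(5 * F.n) ^ 4 < i ∧ i ≤ 0)) ∧ y = F.base β + i * F.ε β}

/-- The heights of the extended bundle. -/
def extended (β : Fin (F.k + 2)) : Set ℝ := F.bundle β ∪ F.extension β

/-- The heights of the rays that cross the whole picture: `ℓ`, `ℓ'`, the rays of the bundles, and
the single rays. -/
def longRows : Set ℝ := {0, F.H} ∪ (⋃ β, F.bundle β) ∪ ↑F.singles

/-- The heights of the extension segments, which run from `p` to `s_3` and do not meet `S`. -/
def shortRows : Set ℝ := ⋃ β, F.extension β

/-- All heights. -/
def rows : Set ℝ := F.longRows ∪ F.shortRows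

/-- The heights at which two segments of `S` cross strictly between `ℓ` and `ℓ'`. -/
def crossings : Set ℝ :=
  {y | 0 < y ∧ y < F.H ∧ ∃ t t' : Fin F.n, t ≠ t' ∧ F.segPoint t y = F.segPoint t' y}

/-- The heights strictly between two consecutive bundles. -/
def zone (β : Fin (F.k + 1)) : Set ℝ :=
  {y | (∀ z ∈ F.bundle β.castSucc, z < y) ∧ ∀ z ∈ F.bundle β.succ, y < z}

/-- The heights strictly between two consecutive extended bundles. -/
def innerZone (β : Fin (F.k + 1)) : Set ℝ :=
  {y | (∀ z ∈ F.extended β.castSucc, z < y) ∧ ∀ z ∈ F.extended β.succ, y < z}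

/-- The points of the fan other than `p`, in the strip: the intersections of `s_0, …, s_3` with
all rays and extension segments, and of the segments of `S` with the rays. -/
def stripPoints : Set Plane :=
  {q | ∃ j : Fin 4, ∃ y ∈ F.rows, q = F.colPoint j y} ∪
    {q | ∃ t : Fin F.n, ∃ y ∈ F.longRows, q = F.segPoint t y}

/-- The projective transformation, from homogeneous coordinates to the plane. -/
noncomputable def proj (v : Fin 3 → ℝ) : Plane :=
  (F.A.mulVec v 0 / F.A.mulVec v 2, F.A.mulVec v 1 / F.A.mulVec v 2)

/-- The image of a point of the strip. -/
noncomputable def place (q : Plane) : Plane := F.proj ![q.1, q.2, 1]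

/-- The point `p`, image of the point at infinity on the left of the strip. -/
noncomputable def apex : Plane := F.proj ![-1, 0, 0]

/-- The point set of the fan. -/
noncomputable def points : Set Plane := insert F.apex (F.place '' F.stripPoints)

/-- The segments: those of `S`, the four segments `s_0, …, s_3`, and the extension segments. -/
noncomputable def segments : Set (Set Plane) :=
  {s | ∃ t : Fin F.n, s = segment ℝ (F.place (F.segPoint t 0)) (F.place (F.segPoint t F.H))} ∪
  {s | ∃ j : Fin 4, s = segment ℝ (F.place (F.colPoint j 0)) (F.place (F.colPoint j F.H))} ∪
  {s | ∃ y ∈ F.shortRows, s = segment ℝ F.apex (F.place (F.colPoint 3 y))}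

/-- The rays with origin `p` (those on `ℓ` and `ℓ'` included). -/
noncomputable def rays : Set (Set Plane) :=
  {r | ∃ y ∈ F.longRows,
    r = AffineMap.lineMap (k := ℝ) F.apex (F.place (F.colPoint 0 y)) '' Set.Ici (0 : ℝ)}

/-- The conditions under which the parameters describe a generalized fan. -/
structure IsGeneralizedFan : Prop where
  H_pos : 0 < F.H
  /-- the `n` segments of `S` are different (they may share endpoints) -/
  distinct : Function.Injective fun t => (F.a t, F.b t)
  δ_pos : 0 < F.δ
  /-- `s_1, s_2, s_3` lie to the left of all segments of `S` -/
  left : ∀ t, F.c + 3 * F.δ < F.a t ∧ F.d + 3 * F.δ < F.b t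
  /-- `s_0` lies between `p` and `s_1` -/
  left₀ : F.c₀ < F.c + F.δ ∧ F.d₀ < F.d + F.δ
  ε_pos : ∀ β, 0 < F.ε β
  /-- the extended bundles lie between `ℓ` and `ℓ'`, one above the other -/
  inside : ∀ β, ∀ y ∈ F.extended β, 0 < y ∧ y < F.H
  ordered : ∀ β β', β < β' → ∀ y ∈ F.extended β, ∀ y' ∈ F.extended β', y < y'
  /-- every crossing of `S` lies between two consecutive bundles; in particular the first bundle
  is between `ℓ` and all crossings, and the last one between all crossings and `ℓ'` -/
  crossings_zone : ∀ y ∈ F.crossings, ∃ β, y ∈ F.zone β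
  /-- single rays pass through crossings, and lie outside the extended bundles -/
  singles_crossings : ↑F.singles ⊆ F.crossings
  singles_zone : ∀ y ∈ F.singles, ∃ β, y ∈ F.innerZone β
  /-- where single rays are used between two consecutive bundles, each crossing there is on one -/
  singles_all : ∀ β, (∃ y ∈ F.singles, y ∈ F.zone β) →
    ∀ y ∈ F.crossings, y ∈ F.zone β → y ∈ F.singles
  /-- an odd number of rays (impossible for two bundles without single rays) has none of them
  exactly halfway between `ℓ` and `ℓ'` -/
  half : Even F.rows.ncard ∨ F.H / 2 ∉ F.rows
  /-- each point on `s_0` sees all points that lie neither on its ray nor on `s_0` -/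
  sees₀ : ∀ y ∈ F.rows, ∀ q ∈ F.stripPoints, q.2 ≠ y → (∀ z ∈ F.rows, q ≠ F.colPoint 0 z) →
    IsVisible ℝ F.stripPoints (F.colPoint 0 y) q
  /-- the transformation is projective, and the line that it sends to infinity
  does not meet the picture -/
  det_ne : F.A.det ≠ 0
  apex_pos : 0 < F.A.mulVec ![-1, 0, 0] 2
  points_pos : ∀ q ∈ F.stripPoints, 0 < F.A.mulVec ![q.1, q.2, 1] 2

end FanData

/-! A realization only remembers which pairs of points are blocked. From this the proof recovers the
rays, their order, and the lines that cross them.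

Let `o` be the image of `p`. On the segment from `o` to any image, the image nearest to `o` is
visible from `o`, hence comes from `s_0`. So all images lie on the rays from `o` through the images
of `s_0` (`Picture.exists_polar`). A point with another point off `s_0` before it on its ray is
hidden from the `s_0` point of that ray; since `s_0` sees everything in other rows, such a point is
in its own row. Counting the remaining points, one per ray, against `s_1` shows that only points of
`s_1` could change rows (`Polar.rows_preserved`). Points on neighbouring rays see each other, so the
angular order of the rays is the order of the rows (`Polar.inCone_iff`), and `s_1` is placed in the
rows either identically or reversed. A displaced point of `s_1` requires a row halfway to its new
ray, which excludes the reversal (`Polar.ρ_eq_snd`). Visibility also fixes the order on each ray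
(`Polar.τ_lt`). The rays span less than a half-plane, so a projective map sends `o` to infinity and
makes the rows horizontal (`Picture.exists_drawing`).

Across the rows the basic tool is `Drawing.aligned_of_blockers`: on three consecutive rows, if a
family of strands contains its own blockers and keeps its weak order, then the assignment of
blockers is a strictly monotone self-map of a finite chain, hence the identity, and the family is
straight. For the columns `s_0, …, s_3` the danger is that segments of `S` serve as blockers. Next
to a run of more than `n + 4` extension segments a pigeonhole argument prevents this
(`Drawing.col_three_le_of_run`); elsewhere there are no crossings and all strands form one family.

Once the columns are straight, `s_1` and `s_3` can be made vertical, and `s_2` then forces each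
extended bundle to be equidistant (`Drawing.Y_midpoint`). A segment of `S` could only bend at an end
of a bundle that faces crossings. There the extension pushes the next ray about `(5 n) ^ 4` steps
away. A bend would give three blocked pairs served by one segment, hence a relation between integers
up to `5 n` and a number above `(5 n) ^ 4 - 1`, which is impossible (`no_three_pairs`). -/

/-! ### Betweenness under projective maps -/

theorem sbtw_plane_iff {u r v : Plane} :
    Sbtw ℝ u r v ↔ u ≠ v ∧ ∃ a b : ℝ, 0 < a ∧ 0 < b ∧ a + b = 1 ∧
      r.1 = a * u.1 + b * v.1 ∧ r.2 = a * u.2 + b * v.2 := by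
  rw [sbtw_iff_mem_image_Ioo_and_ne, and_comm]
  refine and_congr_right fun _ => ?_
  constructor
  · rintro ⟨t, ⟨h0, h1⟩, rfl⟩
    refine ⟨1 - t, t, by linarith, h0, by ring, ?_, ?_⟩ <;>
      simp [AffineMap.lineMap_apply_module]
  · rintro ⟨a, b, ha, hb, hab, h1, h2⟩
    refine ⟨b, ⟨hb, by linarith⟩, ?_⟩
    obtain rfl : a = 1 - b := by linarith
    ext
    · simp [AffineMap.lineMap_apply_module, h1]
    · simp [AffineMap.lineMap_apply_module, h2]

/-- The perspective image of homogeneous coordinates under a matrix. -/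
noncomputable def projMap (A : Matrix (Fin 3) (Fin 3) ℝ) (v : Fin 3 → ℝ) : Plane :=
  (A.mulVec v 0 / A.mulVec v 2, A.mulVec v 1 / A.mulVec v 2)

/-- Undoing the division by the third coordinate turns an affine relation between images into a
linear relation between vectors: each coefficient is rescaled by a quotient of third coordinates,
and injectivity of `A.mulVec` removes the matrix. -/
theorem eq_smul_of_projMap {A : Matrix (Fin 3) (Fin 3) ℝ} (hA : A.det ≠ 0)
    {U V W : Fin 3 → ℝ} (hU : 0 < A.mulVec U 2) (hV : 0 < A.mulVec V 2) (hW : 0 < A.mulVec W 2)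
    {a b : ℝ} (hab : a + b = 1)
    (h1 : (projMap A W).1 = a * (projMap A U).1 + b * (projMap A V).1)
    (h2 : (projMap A W).2 = a * (projMap A U).2 + b * (projMap A V).2) :
    W = (A.mulVec W 2 * a / A.mulVec U 2) • U + (A.mulVec W 2 * b / A.mulVec V 2) • V := by
  have hinj : Function.Injective A.mulVec :=
    Matrix.mulVec_injective_iff_isUnit.2 ((Matrix.isUnit_iff_isUnit_det A).2 hA.isUnit)
  apply hinj
  rw [Matrix.mulVec_add, Matrix.mulVec_smul, Matrix.mulVec_smul]
  simp only [projMap] at h1 h2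
  have e1 := hU.ne'
  have e2 := hV.ne'
  have e3 := hW.ne'
  funext i
  fin_cases i
  · simp only [Fin.zero_eta, Pi.add_apply, Pi.smul_apply, smul_eq_mul]
    field_simp at h1 ⊢
    linear_combination h1
  · simp only [Fin.mk_one, Pi.add_apply, Pi.smul_apply, smul_eq_mul]
    field_simp at h2 ⊢
    linear_combination h2
  · simp only [Fin.reduceFinMk, Pi.add_apply, Pi.smul_apply, smul_eq_mul]
    field_simp
    linear_combination -hab

theorem projMap_comb {A : Matrix (Fin 3) (Fin 3) ℝ} {U V W : Fin 3 → ℝ}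
    (hU : A.mulVec U 2 ≠ 0) (hV : A.mulVec V 2 ≠ 0) (hW : A.mulVec W 2 ≠ 0)
    {a b : ℝ} (h : W = a • U + b • V) :
    a * A.mulVec U 2 / A.mulVec W 2 + b * A.mulVec V 2 / A.mulVec W 2 = 1 ∧
    (projMap A W).1 = a * A.mulVec U 2 / A.mulVec W 2 * (projMap A U).1 +
      b * A.mulVec V 2 / A.mulVec W 2 * (projMap A V).1 ∧
    (projMap A W).2 = a * A.mulVec U 2 / A.mulVec W 2 * (projMap A U).2 +
      b * A.mulVec V 2 / A.mulVec W 2 * (projMap A V).2 := by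
  have hi : ∀ i, A.mulVec W i = a * A.mulVec U i + b * A.mulVec V i := fun i => by
    rw [h, Matrix.mulVec_add, Matrix.mulVec_smul, Matrix.mulVec_smul]; simp
  have h0 := hi 0
  have h1 := hi 1
  have h2 := hi 2
  refine ⟨?_, ?_, ?_⟩
  · field_simp
    linarith
  · simp only [projMap]
    field_simp
    linarith
  · simp only [projMap]
    field_simp
    linarith

/-- A perspective map with positive denominators preserves and reflects strict betweenness,
expressed through positive combinations of homogeneous coordinates. -/
theorem sbtw_projMap_iff {A : Matrix (Fin 3) (Fin 3) ℝ} (hA : A.det ≠ 0)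
    {U V W : Fin 3 → ℝ} (hU : 0 < A.mulVec U 2) (hV : 0 < A.mulVec V 2)
    (hW : 0 < A.mulVec W 2) (hne : projMap A U ≠ projMap A V) :
    Sbtw ℝ (projMap A U) (projMap A W) (projMap A V) ↔
      ∃ a b : ℝ, 0 < a ∧ 0 < b ∧ W = a • U + b • V := by
  rw [sbtw_plane_iff]
  constructor
  · rintro ⟨-, a, b, ha, hb, hab, h1, h2⟩
    exact ⟨_, _, by positivity, by positivity, eq_smul_of_projMap hA hU hV hW hab h1 h2⟩
  · rintro ⟨a, b, ha, hb, h⟩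
    exact ⟨hne, _, _, by positivity, by positivity, projMap_comb hU.ne' hV.ne' hW.ne' h⟩

/-! ### Strands and rows in the strip -/

namespace FanData

variable (F : FanData)

/-- The segments that run from `ℓ` to `ℓ'`: `s_0, …, s_3` and the segments of `S`. -/
abbrev Strand : Type := Fin 4 ⊕ Fin F.n

/-- The lower end of a strand. -/
noncomputable def strandLow : F.Strand → ℝ := Sum.elim F.colLow F.a

/-- The upper end of a strand. -/
noncomputable def strandHigh : F.Strand → ℝ := Sum.elim F.colHigh F.b

/-- The point of a strand at height `y`. -/
noncomputable def pt (s : F.Strand) (y : ℝ) : Plane :=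
  F.stripPoint (F.strandLow s) (F.strandHigh s) y

/-- The heights of the points on a strand. -/
def dom : F.Strand → Set ℝ := Sum.elim (fun _ => F.rows) (fun _ => F.longRows)

variable {F}

@[simp] theorem pt_inl (j : Fin 4) (y : ℝ) : F.pt (.inl j) y = F.colPoint j y := rfl

@[simp] theorem pt_inr (t : Fin F.n) (y : ℝ) : F.pt (.inr t) y = F.segPoint t y := rfl

@[simp] theorem pt_snd (s : F.Strand) (y : ℝ) : (F.pt s y).2 = y := rfl

@[simp] theorem colPoint_snd (j : Fin 4) (y : ℝ) : (F.colPoint j y).2 = y := rfl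

@[simp] theorem segPoint_snd (t : Fin F.n) (y : ℝ) : (F.segPoint t y).2 = y := rfl

theorem pt_fst (s : F.Strand) (y : ℝ) :
    (F.pt s y).1 = F.strandLow s + y / F.H * (F.strandHigh s - F.strandLow s) := rfl

theorem mem_stripPoints {q : Plane} :
    q ∈ F.stripPoints ↔ ∃ s, ∃ y ∈ F.dom s, q = F.pt s y := by
  constructor
  · rintro (⟨j, y, hy, rfl⟩ | ⟨t, y, hy, rfl⟩)
    · exact ⟨.inl j, y, hy, rfl⟩
    · exact ⟨.inr t, y, hy, rfl⟩
  · rintro ⟨j | t, y, hy, rfl⟩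
    · exact .inl ⟨j, y, hy, rfl⟩
    · exact .inr ⟨t, y, hy, rfl⟩

theorem pt_mem {s : F.Strand} {y : ℝ} (hy : y ∈ F.dom s) : F.pt s y ∈ F.stripPoints :=
  mem_stripPoints.2 ⟨s, y, hy, rfl⟩

theorem colPoint_mem (j : Fin 4) {y : ℝ} (hy : y ∈ F.rows) : F.colPoint j y ∈ F.stripPoints :=
  pt_mem (s := .inl j) hy

theorem longRows_subset_rows : F.longRows ⊆ F.rows := Set.subset_union_left

theorem shortRows_subset_rows : F.shortRows ⊆ F.rows := Set.subset_union_right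

theorem dom_subset_rows (s : F.Strand) : F.dom s ⊆ F.rows := by
  rcases s with j | t
  · exact subset_rfl
  · exact longRows_subset_rows

theorem snd_mem_rows {q : Plane} (hq : q ∈ F.stripPoints) : q.2 ∈ F.rows := by
  obtain ⟨s, y, hy, rfl⟩ := mem_stripPoints.1 hq
  exact dom_subset_rows s hy

theorem zero_mem_longRows : (0 : ℝ) ∈ F.longRows := by simp [longRows]

theorem top_mem_longRows : F.H ∈ F.longRows := by simp [longRows]

theorem zero_mem_rows : (0 : ℝ) ∈ F.rows := longRows_subset_rows zero_mem_longRows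

theorem top_mem_rows : F.H ∈ F.rows := longRows_subset_rows top_mem_longRows

theorem bundle_subset_longRows (β : Fin (F.k + 2)) : F.bundle β ⊆ F.longRows := fun y hy => by
  simp only [longRows, Set.mem_union, Set.mem_iUnion]
  exact .inl (.inr ⟨β, hy⟩)

theorem extension_subset_shortRows (β : Fin (F.k + 2)) : F.extension β ⊆ F.shortRows :=
  fun y hy => by
    simp only [shortRows, Set.mem_iUnion]
    exact ⟨β, hy⟩

theorem bundle_finite (β : Fin (F.k + 2)) : (F.bundle β).Finite := by
  refine ((Set.finite_Icc (1 : ℤ) (5 * F.n)).image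
    fun i : ℤ => F.base β + i * F.ε β).subset ?_
  rintro y ⟨i, h1, h2, rfl⟩
  exact ⟨i, ⟨h1, h2⟩, rfl⟩

theorem extension_finite (β : Fin (F.k + 2)) : (F.extension β).Finite := by
  refine ((Set.finite_Icc (-(5 * F.n) ^ 4 : ℤ) (5 * F.n + (5 * F.n) ^ 4)).image
    fun i : ℤ => F.base β + i * F.ε β).subset ?_
  rintro y ⟨i, h, rfl⟩
  have : (0 : ℤ) ≤ (5 * F.n) ^ 4 := by positivity
  rcases h with h | h
  · exact ⟨i, ⟨by omega, by omega⟩, rfl⟩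
  · exact ⟨i, ⟨by omega, by omega⟩, rfl⟩

theorem rows_finite : F.rows.Finite := by
  refine Set.Finite.union (((Set.toFinite _).union (Set.finite_iUnion bundle_finite)).union
    F.singles.finite_toSet) (Set.finite_iUnion extension_finite)

theorem stripPoints_finite : F.stripPoints.Finite := by
  refine (Set.finite_iUnion fun s => (rows_finite.subset (dom_subset_rows s)).image
    (F.pt s)).subset ?_
  intro q hq
  obtain ⟨s, y, hy, rfl⟩ := mem_stripPoints.1 hq
  exact Set.mem_iUnion.2 ⟨s, y, hy, rfl⟩

namespace IsGeneralizedFan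

variable (hF : F.IsGeneralizedFan)
include hF

theorem rows_mem_Icc {y : ℝ} (hy : y ∈ F.rows) : 0 ≤ y ∧ y ≤ F.H := by
  have hH := hF.H_pos
  rcases hy with ((hy | hy) | hy) | hy
  · rcases hy with rfl | rfl
    · exact ⟨le_rfl, hH.le⟩
    · exact ⟨hH.le, le_rfl⟩
  · obtain ⟨β, hβ⟩ := Set.mem_iUnion.1 hy
    have := hF.inside β y (.inl hβ)
    exact ⟨this.1.le, this.2.le⟩
  · have := hF.singles_crossings hy
    exact ⟨this.1.le, this.2.1.le⟩
  · obtain ⟨β, hβ⟩ := Set.mem_iUnion.1 hy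
    have := hF.inside β y (.inr hβ)
    exact ⟨this.1.le, this.2.le⟩

theorem n_pos_of_crossing {y : ℝ} (hy : y ∈ F.crossings) : 0 < F.n := by
  obtain ⟨-, -, t, -⟩ := hy
  exact t.pos

/-- The horizontal position of a strand is a convex combination of its ends. -/
theorem pt_fst_comb (s : F.Strand) (y : ℝ) :
    (F.pt s y).1 = (F.H - y) / F.H * F.strandLow s + y / F.H * F.strandHigh s := by
  have := hF.H_pos.ne'
  rw [pt_fst]
  field_simp
  ring

theorem pt_lt_of_ends_lt {s s' : F.Strand} (h0 : F.strandLow s < F.strandLow s')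
    (h1 : F.strandHigh s < F.strandHigh s') {y : ℝ} (hy : 0 ≤ y ∧ y ≤ F.H) :
    (F.pt s y).1 < (F.pt s' y).1 := by
  have hH := hF.H_pos
  rw [hF.pt_fst_comb, hF.pt_fst_comb]
  rcases hy.1.eq_or_lt with rfl | h
  · simp [hH.ne', h0]
  · have a1 : 0 ≤ (F.H - y) / F.H := div_nonneg (by linarith) hH.le
    have a2 : 0 < y / F.H := div_pos h hH
    nlinarith [mul_le_mul_of_nonneg_left h0.le a1, mul_lt_mul_of_pos_left h1 a2]

theorem colLow_lt {j j' : Fin 4} (h : j < j') : F.colLow j < F.colLow j' := by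
  have h1 := hF.δ_pos
  have h2 := hF.left₀.1
  revert h
  fin_cases j <;> fin_cases j' <;> simp [colLow] <;> linarith

theorem colHigh_lt {j j' : Fin 4} (h : j < j') : F.colHigh j < F.colHigh j' := by
  have h1 := hF.δ_pos
  have h2 := hF.left₀.2
  revert h
  fin_cases j <;> fin_cases j' <;> simp [colHigh] <;> linarith

theorem colPoint_lt {j j' : Fin 4} (h : j < j') {y : ℝ} (hy : y ∈ F.rows) :
    (F.colPoint j y).1 < (F.colPoint j' y).1 :=
  hF.pt_lt_of_ends_lt (s := .inl j) (s' := .inl j') (hF.colLow_lt h) (hF.colHigh_lt h)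
    (hF.rows_mem_Icc hy)

theorem colPoint_lt_segPoint (j : Fin 4) (t : Fin F.n) {y : ℝ} (hy : y ∈ F.rows) :
    (F.colPoint j y).1 < (F.segPoint t y).1 := by
  have h3 : (F.colPoint 3 y).1 < (F.segPoint t y).1 := by
    refine hF.pt_lt_of_ends_lt (s := .inl 3) (s' := .inr t) ?_ ?_ (hF.rows_mem_Icc hy)
    · simpa [strandLow, colLow] using (hF.left t).1
    · simpa [strandHigh, colHigh] using (hF.left t).2
  rcases (show j ≤ 3 from Fin.le_last j).eq_or_lt with rfl | h
  · exact h3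
  · exact (hF.colPoint_lt h hy).trans h3

theorem n_pos_of_mem {β : Fin (F.k + 2)} {y : ℝ} (hy : y ∈ F.extended β) : 0 < F.n := by
  rcases Nat.eq_zero_or_pos F.n with h | h
  · rcases hy with ⟨i, h1, h2, -⟩ | ⟨i, h', -⟩
    · simp [h] at h2; omega
    · simp [h] at h'; omega
  · exact h

theorem bundle_nonempty (hn : 0 < F.n) (β : Fin (F.k + 2)) : (F.bundle β).Nonempty :=
  ⟨_, 1, le_rfl, by omega, rfl⟩

/-- A ray outside bundle `β` lies above or below the extended bundle. -/
theorem longRows_trichotomy {z : ℝ} (hz : z ∈ F.longRows) (β : Fin (F.k + 2)) :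
    z ∈ F.bundle β ∨ (∀ w ∈ F.extended β, w < z) ∨ ∀ w ∈ F.extended β, z < w := by
  rcases hz with (hz | hz) | hz
  · rcases hz with rfl | rfl
    · exact .inr (.inr fun w hw => (hF.inside β w hw).1)
    · exact .inr (.inl fun w hw => (hF.inside β w hw).2)
  · obtain ⟨γ, hγ⟩ := Set.mem_iUnion.1 hz
    rcases lt_trichotomy β γ with h | rfl | h
    · exact .inr (.inl fun w hw => hF.ordered _ _ h w hw z (.inl hγ))
    · exact .inl hγ
    · exact .inr (.inr fun w hw => hF.ordered _ _ h z (.inl hγ) w hw)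
  · have hn := hF.n_pos_of_crossing (hF.singles_crossings hz)
    obtain ⟨γ, h1, h2⟩ := hF.singles_zone z hz
    obtain ⟨w1, hw1⟩ := hF.bundle_nonempty hn γ.castSucc
    obtain ⟨w2, hw2⟩ := hF.bundle_nonempty hn γ.succ
    rcases le_or_gt β γ.castSucc with h | h
    · refine .inr (.inl fun w hw => ?_)
      rcases h.eq_or_lt with rfl | h
      · exact h1 w hw
      · exact (hF.ordered _ _ h w hw w1 (.inl hw1)).trans (h1 w1 (.inl hw1))
    · refine .inr (.inr fun w hw => ?_)
      have h' : γ.succ ≤ β := by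
        rw [Fin.lt_def] at h; rw [Fin.le_def]; simpa using h
      rcases h'.eq_or_lt with rfl | h
      · exact h2 w hw
      · exact (h2 w2 (.inl hw2)).trans (hF.ordered _ _ h w2 (.inl hw2) w hw)

theorem disjoint_bundle_extension {β : Fin (F.k + 2)} {z : ℝ} (h1 : z ∈ F.bundle β)
    (h2 : z ∈ F.extension β) : False := by
  obtain ⟨i, hi1, hi2, rfl⟩ := h1
  obtain ⟨j, hj, h⟩ := h2
  have hε := (hF.ε_pos β).ne'
  have : (i : ℝ) = j := by
    have := add_left_cancel h
    exact mul_right_cancel₀ hε this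
  have : i = j := by exact_mod_cast this
  omega

theorem disjoint_long_short {z : ℝ} (h1 : z ∈ F.longRows) (h2 : z ∈ F.shortRows) : False := by
  obtain ⟨β, hβ⟩ := Set.mem_iUnion.1 h2
  rcases hF.longRows_trichotomy h1 β with h | h | h
  · exact hF.disjoint_bundle_extension h hβ
  · exact lt_irrefl _ (h z (.inr hβ))
  · exact lt_irrefl _ (h z (.inr hβ))

/-- Each point of the strip lies on a strand. -/
theorem exists_strand {q : Plane} (hq : q ∈ F.stripPoints) :
    ∃ s : F.Strand, q.2 ∈ F.dom s ∧ q = F.pt s q.2 := by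
  obtain ⟨s, y, hy, rfl⟩ := mem_stripPoints.1 hq
  exact ⟨s, hy, rfl⟩

theorem sbtw_pt (s : F.Strand) {A B C : ℝ} (h1 : A < B) (h2 : B < C) :
    Sbtw ℝ (F.pt s A) (F.pt s B) (F.pt s C) := by
  have hH := hF.H_pos.ne'
  have h3 : 0 < C - A := by linarith
  rw [sbtw_plane_iff]
  refine ⟨fun h => ?_, (C - B) / (C - A), (B - A) / (C - A), div_pos (by linarith) h3,
    div_pos (by linarith) h3, by field_simp; ring, ?_, ?_⟩
  · have := congrArg Prod.snd h
    simp at this; linarith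
  · rw [pt_fst, pt_fst, pt_fst]
    field_simp
    ring
  · simp only [pt_snd]
    field_simp
    ring

end IsGeneralizedFan

/-! ### Visibility through the projective transformation -/

theorem place_eq (q : Plane) : F.place q = projMap F.A ![q.1, q.2, 1] := rfl

theorem apex_eq : F.apex = projMap F.A ![-1, 0, 0] := rfl

namespace IsGeneralizedFan

variable (hF : F.IsGeneralizedFan)
include hF

theorem place_injOn : Set.InjOn F.place F.stripPoints := by
  intro u hu v hv h
  rw [place_eq, place_eq] at h
  have := eq_smul_of_projMap hF.det_ne (hF.points_pos u hu) (hF.points_pos u hu)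
    (hF.points_pos v hv) (a := 1) (b := 0) (by norm_num) (by simp [h]) (by simp [h])
  have h0 := congrFun this 0
  have h1 := congrFun this 1
  have h2 := congrFun this 2
  simp only [Pi.add_apply, Pi.smul_apply, smul_eq_mul, Matrix.cons_val] at h0 h1 h2
  ext
  · linear_combination -h0 + u.1 * h2
  · linear_combination -h1 + u.2 * h2

theorem apex_ne_place {v : Plane} (hv : v ∈ F.stripPoints) : F.apex ≠ F.place v := by
  intro h
  rw [place_eq, apex_eq] at h
  have := eq_smul_of_projMap hF.det_ne hF.apex_pos hF.apex_pos
    (hF.points_pos v hv) (a := 1) (b := 0) (by norm_num) (by simp [h]) (by simp [h])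
  have h2 := congrFun this 2
  simp only [Pi.add_apply, Pi.smul_apply, smul_eq_mul, Matrix.cons_val] at h2
  linarith

theorem sbtw_place_iff {u r v : Plane} (hu : u ∈ F.stripPoints) (hr : r ∈ F.stripPoints)
    (hv : v ∈ F.stripPoints) (hne : u ≠ v) :
    Sbtw ℝ (F.place u) (F.place r) (F.place v) ↔ Sbtw ℝ u r v := by
  rw [place_eq, place_eq, place_eq, sbtw_projMap_iff hF.det_ne (hF.points_pos u hu)
    (hF.points_pos v hv) (hF.points_pos r hr) fun h => hne (hF.place_injOn hu hv h),
    sbtw_plane_iff]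
  constructor
  · rintro ⟨a, b, ha, hb, h⟩
    have h0 := congrFun h 0
    have h1 := congrFun h 1
    have h2 := congrFun h 2
    simp only [Pi.add_apply, Pi.smul_apply, smul_eq_mul, Matrix.cons_val] at h0 h1 h2
    exact ⟨hne, a, b, ha, hb, by linarith, h0, h1⟩
  · rintro ⟨-, a, b, ha, hb, hab, h1, h2⟩
    refine ⟨a, b, ha, hb, ?_⟩
    funext i
    fin_cases i <;> simp [h1, h2, hab]

/-- The representative `![-1, 0, 0]` makes `p` the direction to the left: adding a positive multiple
of it to a point moves that point to the left in its row. -/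
theorem sbtw_apex_iff {r v : Plane} (hr : r ∈ F.stripPoints) (hv : v ∈ F.stripPoints) :
    Sbtw ℝ F.apex (F.place r) (F.place v) ↔ r.2 = v.2 ∧ r.1 < v.1 := by
  rw [place_eq, place_eq, apex_eq, sbtw_projMap_iff hF.det_ne hF.apex_pos
    (hF.points_pos v hv) (hF.points_pos r hr) (hF.apex_ne_place hv)]
  constructor
  · rintro ⟨a, b, ha, hb, h⟩
    have h0 := congrFun h 0
    have h1 := congrFun h 1
    have h2 := congrFun h 2
    simp only [Pi.add_apply, Pi.smul_apply, smul_eq_mul, Matrix.cons_val] at h0 h1 h2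
    obtain rfl : b = 1 := by linarith
    exact ⟨by linarith, by linarith⟩
  · rintro ⟨h1, h2⟩
    refine ⟨v.1 - r.1, 1, by linarith, one_pos, ?_⟩
    funext i
    fin_cases i <;> simp [h1]

/-- Positive combinations of points of the strip have positive third coordinate, whereas that of `p`
is zero. -/
theorem not_sbtw_place_apex {u v : Plane} (hu : u ∈ F.stripPoints)
    (hv : v ∈ F.stripPoints) (hne : u ≠ v) : ¬ Sbtw ℝ (F.place u) F.apex (F.place v) := by
  rw [place_eq, place_eq, apex_eq, sbtw_projMap_iff hF.det_ne (hF.points_pos u hu)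
    (hF.points_pos v hv) hF.apex_pos fun h => hne (hF.place_injOn hu hv h)]
  rintro ⟨a, b, ha, hb, h⟩
  have h2 := congrFun h 2
  simp only [Pi.add_apply, Pi.smul_apply, smul_eq_mul, Matrix.cons_val] at h2
  linarith

/-- A point on the line through `p` and a point of the strip has the same height. -/
theorem snd_eq_of_lineMap {r c : Plane} (hr : r ∈ F.stripPoints) (hc : c ∈ F.stripPoints) {τ : ℝ}
    (h : F.place r = AffineMap.lineMap F.apex (F.place c) τ) : r.2 = c.2 := by
  have e1 := congrArg Prod.fst h
  have e2 := congrArg Prod.snd h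
  simp only [AffineMap.lineMap_apply_module, Prod.fst_add, Prod.smul_fst, Prod.snd_add,
    Prod.smul_snd, smul_eq_mul] at e1 e2
  have := eq_smul_of_projMap hF.det_ne hF.apex_pos (hF.points_pos c hc) (hF.points_pos r hr)
    (a := 1 - τ) (b := τ) (by ring) e1 e2
  have h1 := congrFun this 1
  have h2 := congrFun this 2
  simp only [Pi.add_apply, Pi.smul_apply, smul_eq_mul, Matrix.cons_val] at h1 h2
  linear_combination h1 - c.2 * h2

end IsGeneralizedFan

/-! ### Realizations in strip coordinates -/

/-- A realization of a generalized fan, in terms of the points in the strip: `o` is the image of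
`p`, and `ψ` places the other points. -/
structure Picture (F : FanData) (o : Plane) (ψ : Plane → Plane) : Prop where
  injOn : Set.InjOn ψ F.stripPoints
  ne_apex : ∀ q ∈ F.stripPoints, ψ q ≠ o
  sees_iff : ∀ u ∈ F.stripPoints, ∀ v ∈ F.stripPoints, u ≠ v →
    ((∀ r ∈ F.stripPoints, ¬ Sbtw ℝ u r v) ↔
      (∀ r ∈ F.stripPoints, ¬ Sbtw ℝ (ψ u) (ψ r) (ψ v)) ∧ ¬ Sbtw ℝ (ψ u) o (ψ v))
  apex_sees_iff : ∀ v ∈ F.stripPoints,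
    ((∀ r ∈ F.stripPoints, r.2 = v.2 → v.1 ≤ r.1) ↔
      ∀ r ∈ F.stripPoints, ¬ Sbtw ℝ o (ψ r) (ψ v))

theorem place_mem_points {q : Plane} (hq : q ∈ F.stripPoints) : F.place q ∈ F.points :=
  Set.mem_insert_of_mem _ ⟨q, hq, rfl⟩

theorem apex_mem_points : F.apex ∈ F.points := Set.mem_insert _ _

open Classical in
/-- The position of a point of the strip in a drawing of the fan. -/
noncomputable def pull (φ : F.points → Plane) (q : Plane) : Plane :=
  if h : F.place q ∈ F.points then φ ⟨F.place q, h⟩ else 0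

theorem pull_eq (φ : F.points → Plane) {q : Plane} (hq : q ∈ F.stripPoints) :
    pull φ q = φ ⟨F.place q, place_mem_points hq⟩ :=
  dif_pos _

/-- All visibility in the fan is rewritten in the strip. On the fan side of `sees_iff` there is no
clause for `p`, because `p` never lies between two other points; on the side of the realization this
is not yet known. -/
theorem IsGeneralizedFan.picture (hF : F.IsGeneralizedFan) {φ : F.points → Plane}
    (hφ : IsRealization (visibilityGraph F.points) φ) :
    F.Picture (φ ⟨F.apex, apex_mem_points⟩) (pull φ) where
  injOn u hu v hv h := by
    rw [pull_eq φ hu, pull_eq φ hv] at h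
    exact hF.place_injOn hu hv (congrArg Subtype.val (hφ.1 h))
  ne_apex q hq h := by
    rw [pull_eq φ hq] at h
    exact hF.apex_ne_place hq (congrArg Subtype.val (hφ.1 h)).symm
  sees_iff u hu v hv hne := by
    have hne' : F.place u ≠ F.place v := fun h => hne (hF.place_injOn hu hv h)
    have key := hφ.2 ⟨F.place u, place_mem_points hu⟩ ⟨F.place v, place_mem_points hv⟩
      (fun h => hne' (congrArg Subtype.val h))
    have h1 : (visibilityGraph F.points).Adj ⟨F.place u, place_mem_points hu⟩
        ⟨F.place v, place_mem_points hv⟩ ↔ ∀ r ∈ F.stripPoints, ¬ Sbtw ℝ u r v := by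
      constructor
      · intro h r hr hs
        exact h.2 (place_mem_points hr) ((hF.sbtw_place_iff hu hr hv hne).2 hs)
      · intro h
        refine ⟨fun h => hne' (congrArg Subtype.val h), ?_⟩
        rintro z (rfl | ⟨r, hr, rfl⟩)
        · exact hF.not_sbtw_place_apex hu hv hne
        · exact fun hs => h r hr ((hF.sbtw_place_iff hu hr hv hne).1 hs)
    rw [← h1, key, pull_eq φ hu, pull_eq φ hv]
    constructor
    · intro h
      refine ⟨fun r hr => ?_, h ⟨_, rfl⟩⟩
      rw [pull_eq φ hr]
      exact h ⟨_, rfl⟩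
    · rintro ⟨h, h'⟩ z ⟨⟨w, hw⟩, rfl⟩
      rcases hw with rfl | ⟨r, hr, rfl⟩
      · exact h'
      · have := h r hr
        rwa [pull_eq φ hr] at this
  apex_sees_iff v hv := by
    have hne' : F.apex ≠ F.place v := hF.apex_ne_place hv
    have key := hφ.2 ⟨F.apex, apex_mem_points⟩ ⟨F.place v, place_mem_points hv⟩
      (fun h => hne' (congrArg Subtype.val h))
    have h1 : (visibilityGraph F.points).Adj ⟨F.apex, apex_mem_points⟩
        ⟨F.place v, place_mem_points hv⟩ ↔ ∀ r ∈ F.stripPoints, r.2 = v.2 → v.1 ≤ r.1 := by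
      constructor
      · intro h r hr hs
        by_contra hlt
        exact h.2 (place_mem_points hr) ((hF.sbtw_apex_iff hr hv).2 ⟨hs, not_le.1 hlt⟩)
      · intro h
        refine ⟨fun h => hne' (congrArg Subtype.val h), ?_⟩
        rintro z (rfl | ⟨r, hr, rfl⟩)
        · exact fun hs => hs.2.1 rfl
        · exact fun hs => not_le.2 ((hF.sbtw_apex_iff hr hv).1 hs).2
            (h r hr ((hF.sbtw_apex_iff hr hv).1 hs).1)
    rw [← h1, key, pull_eq φ hv]
    constructor
    · intro h r hr
      rw [pull_eq φ hr]
      exact h ⟨_, rfl⟩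
    · rintro h z ⟨⟨w, hw⟩, rfl⟩
      rcases hw with rfl | ⟨r, hr, rfl⟩
      · exact fun hs => hs.2.1 rfl
      · have := h r hr
        rwa [pull_eq φ hr] at this

end FanData

/-! ### Betweenness from an endpoint, and orders determined by consecutive pairs -/

theorem sbtw_left_iff {o r v : Plane} :
    Sbtw ℝ o r v ↔ o ≠ v ∧ ∃ b : ℝ, 0 < b ∧ b < 1 ∧ r - o = b • (v - o) := by
  rw [sbtw_plane_iff]
  refine and_congr_right fun _ => ⟨?_, ?_⟩
  · rintro ⟨a, b, ha, hb, hab, h1, h2⟩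
    refine ⟨b, hb, by linarith, ?_⟩
    obtain rfl : a = 1 - b := by linarith
    ext
    · simp [h1]; ring
    · simp [h2]; ring
  · rintro ⟨b, hb, hb1, h⟩
    have h1 := congrArg Prod.fst h
    have h2 := congrArg Prod.snd h
    simp at h1 h2
    exact ⟨1 - b, b, by linarith, hb, by ring, by linarith, by linarith⟩

/-- Consecutive positions determine the order of finitely many points. -/
theorem lt_of_consecutive_iff {α : Type*} {A : Set α} (hA : A.Finite) {f g : α → ℝ}
    (hf : Set.InjOn f A) (hg : Set.InjOn g A)
    (hc : ∀ u ∈ A, ∀ v ∈ A, f u < f v →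
      ((∃ r ∈ A, f u < f r ∧ f r < f v) ↔
        ∃ r ∈ A, (g u < g r ∧ g r < g v) ∨ (g v < g r ∧ g r < g u)))
    {m : α} (hm : m ∈ A) (hfm : ∀ a ∈ A, f m ≤ f a) (hgm : ∀ a ∈ A, g m ≤ g a) :
    ∀ u ∈ A, ∀ v ∈ A, f u < f v → g u < g v := by
  by_contra! hbad
  -- `u` below is the `f`-least point at which the order fails, so all earlier points compare
  -- correctly with every later one.
  let B := {u ∈ A | ∃ v ∈ A, f u < f v ∧ g v ≤ g u}
  obtain ⟨u, ⟨hu, v, hv, huv, hvu⟩, hmin⟩ := Set.exists_min_image B f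
    (hA.subset fun _ h => h.1) (by obtain ⟨u, hu, v, hv, h⟩ := hbad; exact ⟨u, hu, v, hv, h⟩)
  have good : ∀ a ∈ A, f a < f u → ∀ b ∈ A, f a < f b → g a < g b := by
    intro a ha hau b hb hab
    by_contra! hba
    exact absurd (hmin a ⟨ha, b, hb, hab, hba⟩) (not_le.2 hau)
  have hmu : f m < f u := by
    refine lt_of_le_of_ne (hfm u hu) fun h => ?_
    obtain rfl := hf hm hu h
    have := hg hm hv (le_antisymm (hgm v hv) hvu)
    subst this
    exact lt_irrefl _ huv
  obtain ⟨w, ⟨hw, hwu⟩, hwmax⟩ := Set.exists_max_image {r ∈ A | f r < f u} f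
    (hA.subset fun _ h => h.1) ⟨m, hm, hmu⟩
  have gwu := good w hw hwu u hu hwu
  -- `w` is the predecessor of `u` for `f`. Its successor `c` for `g` has to be `u`: otherwise `u`
  -- separates `w` from `c` for `f`, while nothing does so for `g`.
  obtain ⟨c, ⟨hcA, hcw⟩, hcmin⟩ := Set.exists_min_image {r ∈ A | g w < g r} g
    (hA.subset fun _ h => h.1) ⟨u, hu, gwu⟩
  have hcw' : f w < f c := by
    rcases lt_trichotomy (f w) (f c) with h | h | h
    · exact h
    · rw [hf hw hcA h] at hcw
      exact absurd hcw (lt_irrefl _)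
    · exact absurd (good c hcA (h.trans hwu) w hw h) (not_lt.2 hcw.le)
  have huc : f u ≤ f c := by
    by_contra! h
    exact absurd (hwmax c ⟨hcA, h⟩) (not_le.2 hcw')
  have hcu : c = u := by
    refine hf hcA hu (le_antisymm ?_ huc)
    by_contra! h
    obtain ⟨r, hr, h1 | h1⟩ := (hc w hw c hcA hcw').1 ⟨u, hu, hwu, h⟩
    · exact absurd (hcmin r ⟨hr, h1.1⟩) (not_le.2 h1.2)
    · exact absurd (h1.1.trans h1.2) (not_lt.2 hcw.le)
  subst hcu
  have gwv := good w hw hwu v hv (hwu.trans huv)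
  have := hg hv hu (le_antisymm hvu (hcmin v ⟨hv, gwv⟩))
  subst this
  exact lt_irrefl _ huv

/-! ### Offsets from the parallel columns -/

namespace FanData

variable {F : FanData}

/-- The horizontal offset from the line of the segments parallel to `s_1`, `s_2`, `s_3`. -/
noncomputable def offset (F : FanData) (q : Plane) : ℝ :=
  q.1 - (F.c + q.2 / F.H * (F.d - F.c))

theorem offset_colPoint {j : Fin 4} (hj : j ≠ 0) (y : ℝ) :
    F.offset (F.colPoint j y) = (j : ℕ) * F.δ := by
  simp only [offset, colPoint, stripPoint, colLow, colHigh, if_neg hj]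
  ring

theorem colPoint_lt_iff {j : Fin 4} (hj : j ≠ 0) {q : Plane} :
    (F.colPoint j q.2).1 < q.1 ↔ (j : ℕ) * F.δ < F.offset q := by
  rw [← offset_colPoint hj q.2]
  simp [offset]

theorem lt_colPoint_iff {j : Fin 4} (hj : j ≠ 0) {q : Plane} :
    q.1 < (F.colPoint j q.2).1 ↔ F.offset q < (j : ℕ) * F.δ := by
  rw [← offset_colPoint hj q.2]
  simp [offset]

namespace IsGeneralizedFan

variable (hF : F.IsGeneralizedFan)
include hF

theorem offset_comb {u v r : Plane} {a b : ℝ} (hab : a + b = 1) (h1 : r.1 = a * u.1 + b * v.1)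
    (h2 : r.2 = a * u.2 + b * v.2) : F.offset r = a * F.offset u + b * F.offset v := by
  have hH := hF.H_pos.ne'
  obtain rfl : a = 1 - b := by linarith
  simp only [offset, h1, h2]
  field_simp
  ring

/-- A point strictly between two of the columns. -/
theorem eq_colPoint_of_lt {q : Plane} (hq : q ∈ F.stripPoints) {i j : Fin 4}
    (h1 : (F.colPoint i q.2).1 < q.1) (h2 : q.1 < (F.colPoint j q.2).1) :
    ∃ m, i < m ∧ m < j ∧ q = F.colPoint m q.2 := by
  have hy := snd_mem_rows hq
  obtain ⟨m | t, hs, he⟩ := hF.exists_strand hq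
  · refine ⟨m, ?_, ?_, he⟩
    · by_contra! h
      rcases h.eq_or_lt with rfl | h
      · rw [pt_inl] at he; rw [← he] at h1; exact lt_irrefl _ h1
      · rw [pt_inl] at he
        have := hF.colPoint_lt h hy
        rw [← he] at this; linarith
    · by_contra! h
      rcases h.eq_or_lt with rfl | h
      · rw [pt_inl] at he; rw [← he] at h2; exact lt_irrefl _ h2
      · rw [pt_inl] at he
        have := hF.colPoint_lt h hy
        rw [← he] at this; linarith
  · rw [pt_inr] at he
    have := hF.colPoint_lt_segPoint j t hy
    rw [← he] at this; linarith

/-- `s_0` is the leftmost strand in every row, so the points visible from `p` are those of `s_0`. -/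
theorem isFirst_iff {v : Plane} (hv : v ∈ F.stripPoints) :
    (∀ r ∈ F.stripPoints, r.2 = v.2 → v.1 ≤ r.1) ↔ v = F.colPoint 0 v.2 := by
  have hy := snd_mem_rows hv
  constructor
  · intro h
    have h0 := h _ (colPoint_mem 0 hy) rfl
    obtain ⟨m | t, hs, he⟩ := hF.exists_strand hv
    · rcases (Fin.zero_le m).eq_or_lt with rfl | hm
      · exact he
      · have := hF.colPoint_lt hm hy
        rw [pt_inl] at he; rw [← he] at this; linarith
    · have := hF.colPoint_lt_segPoint 0 t hy
      rw [pt_inr] at he; rw [← he] at this; linarith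
  · intro h r hr hrv
    have e : v.1 = (F.colPoint 0 v.2).1 := congrArg Prod.fst h
    rw [e]
    obtain ⟨m | t, hs, he⟩ := hF.exists_strand hr
    · rw [pt_inl, hrv] at he
      rw [he]
      rcases (Fin.zero_le m).eq_or_lt with rfl | hm
      · exact le_rfl
      · exact (hF.colPoint_lt hm hy).le
    · rw [pt_inr, hrv] at he
      rw [he]
      exact (hF.colPoint_lt_segPoint 0 t hy).le

/-- Points on two consecutive columns see each other, except possibly on `s_0`. -/
theorem colPoint_sees {i j : Fin 4} (hi : i ≠ 0) (hij : (j : ℕ) = i + 1) {y z : ℝ} :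
    ∀ r ∈ F.stripPoints, ¬ Sbtw ℝ (F.colPoint i y) r (F.colPoint j z) := by
  intro r hr h
  obtain ⟨-, a, b, ha, hb, hab, h1, h2⟩ := sbtw_plane_iff.1 h
  have hj : j ≠ 0 := by rintro rfl; simp at hij
  have hlt : i < j := by rw [Fin.lt_def]; omega
  have e := hF.offset_comb hab h1 h2
  rw [offset_colPoint hi, offset_colPoint hj] at e
  have hδ := hF.δ_pos
  have hji : ((j : ℕ) : ℝ) = (i : ℕ) + 1 := by rw [hij]; push_cast; ring
  rw [hji] at e
  -- The offset is affine in the plane and constant on each of `s_1`, `s_2`, `s_3`, so a blocker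
  -- would be strictly between two neighbouring columns.
  obtain ⟨m, hm1, hm2, -⟩ := hF.eq_colPoint_of_lt hr (i := i) (j := j)
    ((colPoint_lt_iff hi).2 (by
      rw [e]; obtain rfl : a = 1 - b := by linarith
      nlinarith [mul_pos hb hδ]))
    ((lt_colPoint_iff hj).2 (by
      rw [e, hji]; obtain rfl : a = 1 - b := by linarith
      nlinarith [mul_pos ha hδ]))
  rw [Fin.lt_def] at hm1 hm2
  omega

/-- Points in the same row between which there are no others. -/
theorem sbtw_row_iff {u r v : Plane} (huv : u.2 = v.2) (hlt : u.1 < v.1) :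
    Sbtw ℝ u r v ↔ r.2 = u.2 ∧ u.1 < r.1 ∧ r.1 < v.1 := by
  rw [sbtw_plane_iff]
  constructor
  · rintro ⟨-, a, b, ha, hb, hab, h1, h2⟩
    obtain rfl : a = 1 - b := by linarith
    refine ⟨by rw [h2, huv]; ring, ?_, ?_⟩
    · nlinarith [mul_pos hb (sub_pos.2 hlt)]
    · nlinarith [mul_pos ha (sub_pos.2 hlt)]
  · rintro ⟨h0, h1, h2⟩
    have h3 : 0 < v.1 - u.1 := by linarith
    refine ⟨fun h => by rw [h] at hlt; exact lt_irrefl _ hlt, (v.1 - r.1) / (v.1 - u.1),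
      (r.1 - u.1) / (v.1 - u.1), div_pos (by linarith) h3, div_pos (by linarith) h3,
      by field_simp; ring, by field_simp; ring, ?_⟩
    rw [h0, ← huv]
    field_simp
    ring

theorem not_mem_between_of_sees {j : Fin 4} {y z : ℝ}
    (h : ∀ r ∈ F.stripPoints, ¬ Sbtw ℝ (F.colPoint j y) r (F.colPoint j z)) :
    ∀ x ∈ F.rows, ¬ (y < x ∧ x < z) ∧ ¬ (z < x ∧ x < y) := by
  refine fun x hx => ⟨fun hyz => ?_, fun hyz => ?_⟩
  · exact h _ (colPoint_mem j hx) (hF.sbtw_pt (.inl j) hyz.1 hyz.2)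
  · exact h _ (colPoint_mem j hx) (hF.sbtw_pt (.inl j) hyz.1 hyz.2).symm

/-- A point of `s_1` and a point of `s_3` in another row only block each other if the row halfway
between them is present. -/
theorem half_mem_of_blocked {y z : ℝ} {r : Plane} (hr : r ∈ F.stripPoints)
    (h : Sbtw ℝ (F.colPoint 1 y) r (F.colPoint 3 z)) : (y + z) / 2 ∈ F.rows := by
  obtain ⟨-, a, b, ha, hb, hab, h1, h2⟩ := sbtw_plane_iff.1 h
  have e := hF.offset_comb hab h1 h2
  rw [offset_colPoint (by decide), offset_colPoint (by decide)] at e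
  have hδ := hF.δ_pos
  obtain rfl : a = 1 - b := by linarith
  norm_num at e
  obtain ⟨m, hm1, hm2, hm⟩ := hF.eq_colPoint_of_lt hr (i := 1) (j := 3)
    ((colPoint_lt_iff (by decide)).2 (by
      rw [e]; norm_num; nlinarith [mul_pos hb hδ]))
    ((lt_colPoint_iff (by decide)).2 (by
      rw [e]; norm_num; nlinarith [mul_pos ha hδ]))
  obtain rfl : m = 2 := by rw [Fin.lt_def] at hm1 hm2; ext; simp at hm1 hm2 ⊢; omega
  rw [hm, offset_colPoint (by decide)] at e
  norm_num at e
  -- Only `s_2` lies in between, and equidistance of the columns places the blocker at the midpoint.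
  have hb2 : b = 1 / 2 := by
    have : F.δ * (2 * b - 1) = 0 := by linarith
    rcases mul_eq_zero.1 this with h | h
    · exact absurd h hδ.ne'
    · linarith
  have : r.2 = (y + z) / 2 := by
    rw [h2, hb2]; simp only [colPoint_snd]; ring
  rw [← this]
  exact snd_mem_rows hr

end IsGeneralizedFan

/-! ### Polar coordinates around the image of `p` -/

/-- The direction in which the image of `p` sees the image of the point of `s_0` at height `y`. -/
noncomputable def dir (F : FanData) (o : Plane) (ψ : Plane → Plane) (y : ℝ) : Plane :=
  ψ (F.colPoint 0 y) - o

/-- Polar coordinates around the image of `p`: the point `v` lies on the ray through the point of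
`s_0` at height `ρ v`, at relative distance `τ v`. -/
structure Polar (F : FanData) (o : Plane) (ψ : Plane → Plane) (ρ τ : Plane → ℝ) : Prop where
  mem : ∀ v ∈ F.stripPoints, ρ v ∈ F.rows
  one_le : ∀ v ∈ F.stripPoints, 1 ≤ τ v
  eq : ∀ v ∈ F.stripPoints, ψ v - o = τ v • F.dir o ψ (ρ v)

section

variable (hF : F.IsGeneralizedFan) {o : Plane} {ψ : Plane → Plane} (hP : F.Picture o ψ)
include hF hP

/-- Among the images on the segment from `o` to `ψ v`, the one nearest to `o` is visible from `o`,
hence belongs to `s_0`. -/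
theorem Picture.exists_polar : ∃ ρ τ : Plane → ℝ, F.Polar o ψ ρ τ := by
  have key : ∀ v ∈ F.stripPoints, ∃ y ∈ F.rows, ∃ t : ℝ, 1 ≤ t ∧ ψ v - o = t • F.dir o ψ y := by
    intro v hv
    obtain ⟨r, ⟨hr, s, hs0, hs1, hs⟩, hmin⟩ := Set.exists_min_image
      {r ∈ F.stripPoints | ∃ s : ℝ, 0 < s ∧ s ≤ 1 ∧ ψ r - o = s • (ψ v - o)}
      (fun r => ‖ψ r - o‖) (stripPoints_finite.subset fun _ h => h.1)
      ⟨v, hv, 1, one_pos, le_rfl, by simp⟩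
    have hfirst : ∀ r' ∈ F.stripPoints, ¬ Sbtw ℝ o (ψ r') (ψ r) := by
      intro r' hr' hb
      obtain ⟨-, b, hb0, hb1, hb⟩ := sbtw_left_iff.1 hb
      have h1 := hmin r' ⟨hr', b * s, by positivity, by nlinarith, by rw [hb, hs, smul_smul]⟩
      have h2 : 0 < ‖ψ r - o‖ := norm_pos_iff.2 (sub_ne_zero.2 (hP.ne_apex r hr))
      simp only [hb, norm_smul, Real.norm_eq_abs, abs_of_pos hb0] at h1
      nlinarith
    have h0 := (hF.isFirst_iff hr).1 ((hP.apex_sees_iff r hr).2 hfirst)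
    refine ⟨r.2, snd_mem_rows hr, s⁻¹, (one_le_inv₀ hs0).2 hs1, ?_⟩
    rw [dir, ← h0, hs, smul_smul, inv_mul_cancel₀ hs0.ne', one_smul]
  choose! ρ h1 τ h2 h3 using key
  exact ⟨ρ, τ, h1, h2, h3⟩

/-- Of two points of `s_0` on one ray from `o`, the farther would be hidden from `o`. -/
theorem Picture.dir_inj {y y' : ℝ} (hy : y ∈ F.rows) (hy' : y' ∈ F.rows) {c : ℝ} (hc : 0 < c)
    (h : F.dir o ψ y = c • F.dir o ψ y') : y = y' := by
  have aux : ∀ {y y' : ℝ}, y ∈ F.rows → y' ∈ F.rows → ∀ {c : ℝ}, 0 < c → c < 1 →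
      F.dir o ψ y = c • F.dir o ψ y' → False := by
    intro y y' hy hy' c hc hc1 h
    have h0 := (hP.apex_sees_iff _ (colPoint_mem 0 hy')).1
      ((hF.isFirst_iff (colPoint_mem 0 hy')).2 rfl)
    exact h0 _ (colPoint_mem 0 hy) (sbtw_left_iff.2
      ⟨(hP.ne_apex _ (colPoint_mem 0 hy')).symm, c, hc, hc1, h⟩)
  rcases lt_trichotomy c 1 with h1 | rfl | h1
  · exact (aux hy hy' hc h1 h).elim
  · rw [one_smul] at h
    have := hP.injOn (colPoint_mem 0 hy) (colPoint_mem 0 hy') (sub_left_injective h)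
    exact congrArg Prod.snd this
  · refine (aux hy' hy (inv_pos.2 hc) (inv_lt_one_of_one_lt₀ h1) ?_).elim
    rw [h, smul_smul, inv_mul_cancel₀ hc.ne', one_smul]

variable {ρ τ : Plane → ℝ} (hR : F.Polar o ψ ρ τ)
include hR

omit hF hR in
theorem Picture.dir_ne {y : ℝ} (hy : y ∈ F.rows) : F.dir o ψ y ≠ 0 :=
  sub_ne_zero.2 (hP.ne_apex _ (colPoint_mem 0 hy))

theorem Polar.ρ_eq {v : Plane} (hv : v ∈ F.stripPoints) {y c : ℝ} (hy : y ∈ F.rows) (hc : 0 < c)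
    (h : ψ v - o = c • F.dir o ψ y) : ρ v = y ∧ τ v = c := by
  have hτ : 0 < τ v := one_pos.trans_le (hR.one_le v hv)
  have he : ρ v = y := by
    refine Picture.dir_inj hF hP (hR.mem v hv) hy (c := (τ v)⁻¹ * c) (by positivity) ?_
    rw [← smul_smul, ← h, hR.eq v hv, smul_smul, inv_mul_cancel₀ hτ.ne', one_smul]
  refine ⟨he, ?_⟩
  rw [hR.eq v hv, he] at h
  exact smul_left_injective ℝ (hP.dir_ne hy) h

theorem Polar.colPoint_zero {y : ℝ} (hy : y ∈ F.rows) :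
    ρ (F.colPoint 0 y) = y ∧ τ (F.colPoint 0 y) = 1 :=
  hR.ρ_eq hF hP (colPoint_mem 0 hy) hy one_pos (by rw [one_smul]; rfl)

omit hF in
theorem Polar.ext {u v : Plane} (hu : u ∈ F.stripPoints) (hv : v ∈ F.stripPoints)
    (hρ : ρ u = ρ v) (hτ : τ u = τ v) : u = v := by
  refine hP.injOn hu hv (sub_left_injective (b := o) ?_)
  change ψ u - o = ψ v - o
  rw [hR.eq u hu, hR.eq v hv, hρ, hτ]

theorem Polar.one_lt {v : Plane} (hv : v ∈ F.stripPoints) (h : v ≠ F.colPoint 0 v.2) :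
    1 < τ v := by
  refine lt_of_le_of_ne (hR.one_le v hv) fun h1 => h ?_
  have hy := hR.mem v hv
  have h0 := hR.colPoint_zero hF hP hy
  have := hR.ext hP hv (colPoint_mem 0 hy) h0.1.symm (h1.symm.trans h0.2.symm)
  have h2 : v.2 = ρ v := congrArg Prod.snd this
  rw [h2]; exact this

omit hF in
theorem Polar.sbtw {u r v : Plane} (hu : u ∈ F.stripPoints) (hr : r ∈ F.stripPoints)
    (hv : v ∈ F.stripPoints) (h1 : ρ u = ρ r) (h2 : ρ r = ρ v) (h3 : τ u < τ r) (h4 : τ r < τ v) :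
    Sbtw ℝ (ψ u) (ψ r) (ψ v) := by
  have eu := hR.eq u hu
  have er := hR.eq r hr
  have ev := hR.eq v hv
  rw [h1] at eu
  rw [← h2] at ev
  set d := F.dir o ψ (ρ r)
  have h5 : 0 < τ v - τ u := by linarith
  rw [sbtw_plane_iff]
  refine ⟨fun h => ?_, (τ v - τ r) / (τ v - τ u), (τ r - τ u) / (τ v - τ u),
    div_pos (by linarith) h5, div_pos (by linarith) h5, by field_simp; ring, ?_, ?_⟩
  · have := hP.injOn hu hv h
    rw [this] at h3; linarith
  · have a1 := congrArg Prod.fst eu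
    have a2 := congrArg Prod.fst er
    have a3 := congrArg Prod.fst ev
    simp at a1 a2 a3
    rw [show (ψ u).1 = τ u * d.1 + o.1 by linarith, show (ψ r).1 = τ r * d.1 + o.1 by linarith,
      show (ψ v).1 = τ v * d.1 + o.1 by linarith]
    field_simp
    ring
  · have a1 := congrArg Prod.snd eu
    have a2 := congrArg Prod.snd er
    have a3 := congrArg Prod.snd ev
    simp at a1 a2 a3
    rw [show (ψ u).2 = τ u * d.2 + o.2 by linarith, show (ψ r).2 = τ r * d.2 + o.2 by linarith,
      show (ψ v).2 = τ v * d.2 + o.2 by linarith]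
    field_simp
    ring

/-- The combination of directions that expresses a blocker. -/
theorem Polar.eq_comb_of_sbtw {u v p : Plane} (hu : u ∈ F.stripPoints) (hv : v ∈ F.stripPoints)
    (h : Sbtw ℝ (ψ u) p (ψ v)) : ∃ a b : ℝ, 0 < a ∧ 0 < b ∧ a + b = 1 ∧
      p - o = (a * τ u) • F.dir o ψ (ρ u) + (b * τ v) • F.dir o ψ (ρ v) := by
  obtain ⟨-, a, b, ha, hb, hab, h1, h2⟩ := sbtw_plane_iff.1 h
  refine ⟨a, b, ha, hb, hab, ?_⟩
  rw [← smul_smul, ← smul_smul, ← hR.eq u hu, ← hR.eq v hv]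
  obtain rfl : a = 1 - b := by linarith
  ext
  · simp [h1]; ring
  · simp [h2]; ring

theorem Polar.not_sbtw_apex_of_ray {u v : Plane} (hu : u ∈ F.stripPoints) (hv : v ∈ F.stripPoints)
    (huv : ρ u = ρ v) : ¬ Sbtw ℝ (ψ u) o (ψ v) := by
  intro h
  obtain ⟨a, b, ha, hb, -, h⟩ := hR.eq_comb_of_sbtw hF hP hu hv h
  have h1 := hR.one_le u hu
  have h2 := hR.one_le v hv
  rw [huv, ← add_smul, sub_self] at h
  rcases smul_eq_zero.1 h.symm with h | h
  · have : 0 < a * τ u + b * τ v := by positivity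
    linarith
  · exact hP.dir_ne (hR.mem v hv) h

theorem Polar.of_sbtw_of_ray {u r v : Plane} (hu : u ∈ F.stripPoints) (hr : r ∈ F.stripPoints)
    (hv : v ∈ F.stripPoints) (huv : ρ u = ρ v) (h : Sbtw ℝ (ψ u) (ψ r) (ψ v)) :
    ρ r = ρ u ∧ ((τ u < τ r ∧ τ r < τ v) ∨ (τ v < τ r ∧ τ r < τ u)) := by
  have hne : u ≠ v := fun e => by subst e; exact h.left_ne_right rfl
  obtain ⟨a, b, ha, hb, hab, h⟩ := hR.eq_comb_of_sbtw hF hP hu hv h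
  have h1 := hR.one_le u hu
  have h2 := hR.one_le v hv
  rw [← huv, ← add_smul] at h
  obtain ⟨e1, e2⟩ := hR.ρ_eq hF hP hr (hR.mem u hu) (by positivity) h
  refine ⟨e1, ?_⟩
  obtain rfl : a = 1 - b := by linarith
  rcases lt_trichotomy (τ u) (τ v) with h3 | h3 | h3
  · left; constructor <;> rw [e2] <;> nlinarith
  · exact absurd (hR.ext hP hu hv huv h3) hne
  · right; constructor <;> rw [e2] <;> nlinarith

/-- A point that is not the second one on its ray keeps its row. -/
theorem Polar.snd_eq_of_lt {v v' : Plane} (hv : v ∈ F.stripPoints) (hv' : v' ∈ F.stripPoints)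
    (h0 : v' ≠ F.colPoint 0 v'.2) (hρ : ρ v' = ρ v) (hτ : τ v' < τ v) :
    v.2 = ρ v ∧ v ≠ F.colPoint 1 (ρ v) := by
  have hy := hR.mem v hv
  have hq := hR.colPoint_zero hF hP hy
  have h1 := hR.one_lt hF hP hv' h0
  have hb : Sbtw ℝ (ψ (F.colPoint 0 (ρ v))) (ψ v') (ψ v) :=
    hR.sbtw hP (colPoint_mem 0 hy) hv' hv (by rw [hq.1, hρ]) hρ (by rw [hq.2]; exact h1) hτ
  have hne : F.colPoint 0 (ρ v) ≠ v := by
    rintro h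
    rw [← h, hq.2] at hτ; linarith
  -- `v'` hides `v` from the point of `s_0` on their common ray, so something hides it in the fan
  -- too. For a `v` from another row this contradicts `sees₀`; for the point of `s_1` in the same
  -- row it contradicts adjacency of the two columns.
  have hs : ¬ ∀ r ∈ F.stripPoints, ¬ Sbtw ℝ (F.colPoint 0 (ρ v)) r v := fun h =>
    ((hP.sees_iff _ (colPoint_mem 0 hy) v hv hne).1 h).1 v' hv' hb
  constructor
  · by_contra h
    refine hs fun r hr => hF.sees₀ _ hy v hv h ?_ hr
    rintro z hz rfl
    rw [(hR.colPoint_zero hF hP hz).1] at h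
    exact h rfl
  · intro h
    refine hs fun r hr hbt => ?_
    generalize ρ v = y at h hy hbt
    rw [h, hF.sbtw_row_iff (u := F.colPoint 0 y) (v := F.colPoint 1 y) rfl
      (hF.colPoint_lt (by decide) hy)] at hbt
    obtain ⟨e1, e2, e3⟩ := hbt
    simp only [colPoint_snd] at e1
    rw [← e1] at e2 e3
    obtain ⟨m, hm1, hm2, -⟩ := hF.eq_colPoint_of_lt hr e2 e3
    rw [Fin.lt_def] at hm1 hm2
    simp at hm1 hm2
    omega

/-- All points except those of `s_1` keep their rows, and are not the second ones on their rays;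
the second point on each ray belongs to `s_1`. -/
theorem Polar.rows_preserved :
    (∀ v ∈ F.stripPoints, v ≠ F.colPoint 1 v.2 → ρ v = v.2) ∧
    ∃ f : ℝ → ℝ, ∀ y ∈ F.rows, f y ∈ F.rows ∧ ρ (F.colPoint 1 (f y)) = y ∧
      ∀ v ∈ F.stripPoints, ρ v = y → v ≠ F.colPoint 0 y → v ≠ F.colPoint 1 (f y) →
        τ (F.colPoint 1 (f y)) < τ v := by
  classical
  set W : Set Plane := {v ∈ F.stripPoints | v ≠ F.colPoint 0 v.2} with hW
  -- `P v` says that `v` is not the nearest point of `W` on its ray. The map `g` fixes such points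
  -- and sends the nearest point of `W` on a ray to the point of `s_1` in the row that names the
  -- ray.
  let P : Plane → Prop := fun v => ∃ v' ∈ W, ρ v' = ρ v ∧ τ v' < τ v
  let g : Plane → Plane := fun v => if P v then v else F.colPoint 1 (ρ v)
  have h10 : ∀ {y}, y ∈ F.rows → F.colPoint 1 y ∈ W := fun {y} hy =>
    ⟨colPoint_mem 1 hy, fun h => by
      have := hF.colPoint_lt (show (0 : Fin 4) < 1 by decide) hy
      rw [h] at this; exact lt_irrefl _ this⟩
  have hWfin : W.Finite := stripPoints_finite.subset fun _ h => h.1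
  have hPv : ∀ {v}, v ∈ W → P v → v.2 = ρ v ∧ v ≠ F.colPoint 1 (ρ v) := by
    rintro v hv ⟨v', hv', h1, h2⟩
    exact hR.snd_eq_of_lt hF hP hv.1 hv'.1 hv'.2 h1 h2
  have hmaps : ∀ v ∈ W, g v ∈ W := by
    intro v hv
    by_cases h : P v
    · simpa only [g, if_pos h] using hv
    · simp only [g, if_neg h]
      exact h10 (hR.mem v hv.1)
  have hinj : ∀ u ∈ W, ∀ v ∈ W, g u = g v → u = v := by
    intro u hu v hv h
    by_cases h1 : P u <;> by_cases h2 : P v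
    · simpa only [g, if_pos h1, if_pos h2] using h
    · simp only [g, if_pos h1, if_neg h2] at h
      have e : u.2 = ρ v := congrArg Prod.snd h
      rw [(hPv hu h1).1] at e
      exact absurd (h.trans (by rw [e])) (hPv hu h1).2
    · simp only [g, if_neg h1, if_pos h2] at h
      have e : ρ u = v.2 := congrArg Prod.snd h
      rw [(hPv hv h2).1] at e
      exact absurd (h.symm.trans (by rw [e])) (hPv hv h2).2
    · simp only [g, if_neg h1, if_neg h2] at h
      have e : ρ u = ρ v := congrArg Prod.snd h
      refine hR.ext hP hu.1 hv.1 e (le_antisymm ?_ ?_)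
      · by_contra! hlt
        exact h1 ⟨v, hv, e.symm, hlt⟩
      · by_contra! hlt
        exact h2 ⟨u, hu, e, hlt⟩
  -- An injective self-map of the finite set `W` is onto. So each point of `W` off `s_1` is fixed
  -- and satisfies `P`, and each point of `s_1` is the image of a nearest point.
  have hsurj : ∀ w ∈ W, ∃ v ∈ W, w = g v := by
    intro w hw
    obtain ⟨a, ha, e⟩ := Set.surj_on_of_inj_on_of_ncard_le (s := W) (t := W) (fun v _ => g v)
      hmaps (fun u v hu hv h => hinj u hu v hv h) le_rfl hWfin w hw
    exact ⟨a, ha, e⟩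
  have hkeep : ∀ v ∈ W, v ≠ F.colPoint 1 v.2 → P v := by
    intro v hv h
    obtain ⟨w, hw, e⟩ := hsurj v hv
    by_cases h1 : P w
    · simp only [g, if_pos h1] at e
      rwa [e]
    · simp only [g, if_neg h1] at e
      have e2 : v.2 = ρ w := congrArg Prod.snd e
      rw [e2] at h
      exact absurd e h
  refine ⟨fun v hv h => ?_, ?_⟩
  · by_cases h0 : v = F.colPoint 0 v.2
    · have := (hR.colPoint_zero hF hP (snd_mem_rows hv)).1
      rwa [← h0] at this
    · exact (hPv ⟨hv, h0⟩ (hkeep v ⟨hv, h0⟩ h)).1.symm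
  · have : ∀ y ∈ F.rows, ∃ z, z ∈ F.rows ∧ ρ (F.colPoint 1 z) = y ∧
        ∀ v ∈ F.stripPoints, ρ v = y → v ≠ F.colPoint 0 y → v ≠ F.colPoint 1 z →
        τ (F.colPoint 1 z) < τ v := by
      intro y hy
      obtain ⟨w, hw, e⟩ := hsurj _ (h10 hy)
      have hnP : ¬ P w := by
        intro h
        simp only [g, if_pos h] at e
        have := (hPv hw h)
        rw [← this.1, ← e] at this
        exact this.2 rfl
      have e1 : y = ρ w := by
        simp only [g, if_neg hnP] at e
        exact congrArg Prod.snd e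
      have e2 : w = F.colPoint 1 w.2 := by
        by_contra h
        exact hnP (hkeep w hw h)
      refine ⟨w.2, snd_mem_rows hw.1, by rw [← e2, e1], fun v hv hvy hv0 hv1 => ?_⟩
      rw [← e2] at hv1 ⊢
      by_contra! hle
      have hvW : v ∈ W := by
        refine ⟨hv, fun h => hv0 ?_⟩
        have := (hR.colPoint_zero hF hP (snd_mem_rows hv)).1
        rw [← h, hvy] at this
        rw [this]; exact h
      refine hnP ⟨v, hvW, hvy.trans e1, lt_of_le_of_ne hle fun h => hv1 ?_⟩
      exact hR.ext hP hv hw.1 (hvy.trans e1) h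
    choose! f hf using this
    exact ⟨f, hf⟩

end

end FanData

/-! ### Cones and the angular order of the rays -/

/-- The cross product of plane vectors. -/
def cross (u v : Plane) : ℝ := u.1 * v.2 - u.2 * v.1

/-- `d` lies in the open cone spanned by the independent vectors `a` and `b`. -/
def InCone (d a b : Plane) : Prop :=
  0 < cross a d * cross a b ∧ 0 < cross d b * cross a b

/-- The three-term identity `hid` between cross products decides the signs: once `k` lies in the
cone, the sign of `cross z k` tells on which side of `k` the vector `z` falls. If `cross a b` is
negative, all signs are changed at once. -/
theorem inCone_split {a b k z : Plane} (hk : InCone k a b) (hz : cross z k ≠ 0) :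
    InCone z a b ↔ InCone z a k ∨ InCone z k b := by
  have aux : ∀ {A B p q s m : ℝ}, 0 < s → p * B = A * q + m * s → 0 < p * s → 0 < q * s → m ≠ 0 →
      ((0 < A * s ∧ 0 < B * s) ↔ (0 < A * p ∧ 0 < m * p) ∨ (0 < -m * q ∧ 0 < B * q)) := by
    intro A B p q s m hs h hp hq hm
    have hp := pos_of_mul_pos_left hp hs.le
    have hq := pos_of_mul_pos_left hq hs.le
    simp only [mul_pos_iff_of_pos_right hs, mul_pos_iff_of_pos_right hp,
      mul_pos_iff_of_pos_right hq, neg_pos]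
    constructor
    · rintro ⟨h1, h2⟩
      rcases lt_or_gt_of_ne hm with h3 | h3
      · exact .inr ⟨h3, h2⟩
      · exact .inl ⟨h1, h3⟩
    · rintro (⟨h1, h2⟩ | ⟨h1, h2⟩)
      · exact ⟨h1, pos_of_mul_pos_right (a := p) (by rw [h]; positivity) hp.le⟩
      · refine ⟨pos_of_mul_pos_left (b := q) ?_ hq.le, h2⟩
        have := mul_pos hp h2
        have := mul_pos (neg_pos.2 h1) hs
        linarith
  obtain ⟨h1, h2⟩ := hk
  have hid : cross a k * cross z b = cross a z * cross k b + cross z k * cross a b := by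
    simp only [cross]; ring
  have hkz : cross k z = - cross z k := by simp only [cross]; ring
  simp only [InCone, hkz]
  have hs : cross a b ≠ 0 := by rintro h; rw [h, mul_zero] at h1; exact lt_irrefl _ h1
  rcases lt_or_gt_of_ne hs with hs | hs
  · have := aux (A := - cross a z) (B := - cross z b) (p := - cross a k) (q := - cross k b)
      (s := - cross a b) (m := - cross z k) (neg_pos.2 hs) (by linarith) (by rwa [neg_mul_neg])
      (by rwa [neg_mul_neg]) (neg_ne_zero.2 hz)
    simpa only [neg_mul_neg] using this
  · exact aux hs hid h1 h2 hz

/-- An injective map of `{0, …, m}` to itself that takes neighbours to neighbours is the identity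
or the reversal. -/
theorem eq_id_or_rev {m : ℕ} {g : ℕ → ℕ} (hm : ∀ i ≤ m, g i ≤ m)
    (hinj : ∀ i ≤ m, ∀ j ≤ m, g i = g j → i = j)
    (hstep : ∀ i < m, g (i + 1) = g i + 1 ∨ g i = g (i + 1) + 1) :
    (∀ i ≤ m, g i = i) ∨ ∀ i ≤ m, g i + i = m := by
  rcases Nat.eq_zero_or_pos m with rfl | h0
  · left; intro i hi
    have := hm i hi
    omega
  -- Injectivity forbids turning back, so the first step decides the direction.
  rcases hstep 0 h0 with h | h
  · left
    have key : ∀ i < m, g (i + 1) = g i + 1 := by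
      intro i
      induction i with
      | zero => exact fun _ => h
      | succ i ih =>
        intro hi
        rcases hstep (i + 1) hi with h1 | h1
        · exact h1
        · have := ih (by omega)
          have := hinj i (by omega) (i + 1 + 1) (by omega) (by omega)
          omega
    have key2 : ∀ i ≤ m, g i = g 0 + i := by
      intro i
      induction i with
      | zero => simp
      | succ i ih => intro hi; rw [key i hi, ih (by omega)]; ring
    intro i hi
    have := key2 m le_rfl
    have := hm m le_rfl
    rw [key2 i hi]; omega
  · right
    have key : ∀ i < m, g i = g (i + 1) + 1 := by
      intro i
      induction i with
      | zero => exact fun _ => h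
      | succ i ih =>
        intro hi
        rcases hstep (i + 1) hi with h1 | h1
        · have := ih (by omega)
          have := hinj i (by omega) (i + 1 + 1) (by omega) (by omega)
          omega
        · exact h1
    have key2 : ∀ i ≤ m, g i + i = g 0 := by
      intro i
      induction i with
      | zero => simp
      | succ i ih => intro hi; have := key i hi; have := ih (by omega); omega
    intro i hi
    have := key2 m le_rfl
    have := hm 0 (Nat.zero_le _)
    have := key2 i hi
    omega

namespace FanData

variable {F : FanData}

section

variable (hF : F.IsGeneralizedFan) {o : Plane} {ψ : Plane → Plane} (hP : F.Picture o ψ)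
  {ρ τ : Plane → ℝ} (hR : F.Polar o ψ ρ τ)
include hF hP hR

theorem Polar.ρ_colPoint {j : Fin 4} (hj : j ≠ 1) {y : ℝ} (hy : y ∈ F.rows) :
    ρ (F.colPoint j y) = y := by
  refine (hR.rows_preserved hF hP).1 _ (colPoint_mem j hy) fun h => ?_
  rcases lt_or_gt_of_ne hj with h1 | h1
  · have := hF.colPoint_lt h1 hy
    rw [h] at this; exact lt_irrefl _ this
  · have := hF.colPoint_lt h1 hy
    rw [h] at this; exact lt_irrefl _ this

/-- No two directions are parallel. -/
theorem Polar.cross_ne {y y' : ℝ} (hy : y ∈ F.rows) (hy' : y' ∈ F.rows) (hne : y ≠ y') :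
    cross (F.dir o ψ y) (F.dir o ψ y') ≠ 0 := by
  intro h
  have hd := hP.dir_ne hy
  have hd' := hP.dir_ne hy'
  obtain ⟨c, hc⟩ : ∃ c : ℝ, F.dir o ψ y = c • F.dir o ψ y' := by
    simp only [cross] at h
    set u := F.dir o ψ y
    set v := F.dir o ψ y'
    have hv : v.1 ^ 2 + v.2 ^ 2 ≠ 0 := by
      intro h0
      refine hd' ?_
      ext
      · change v.1 = 0; nlinarith
      · change v.2 = 0; nlinarith
    refine ⟨(u.1 * v.1 + u.2 * v.2) / (v.1 ^ 2 + v.2 ^ 2), ?_⟩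
    ext
    · simp only [Prod.smul_fst, smul_eq_mul]
      field_simp
      linear_combination v.2 * h
    · simp only [Prod.smul_snd, smul_eq_mul]
      field_simp
      linear_combination -v.1 * h
  rcases lt_trichotomy c 0 with h1 | rfl | h1
  -- Opposite directions: `o` would separate a point of `s_0` from a point of `s_2`, although
  -- `sees₀` lets them see each other. The column `s_2` serves because it is already known to keep
  -- its rows.
  · have hx := colPoint_mem (F := F) 2 hy'
    have hq := colPoint_mem (F := F) 0 hy
    have hxρ := hR.ρ_colPoint hF hP (j := 2) (by decide) hy'
    have h2 := hR.one_le _ hx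
    have h3 := hR.eq _ hx
    rw [hxρ] at h3
    have hqx : F.colPoint 0 y ≠ F.colPoint 2 y' := fun e => hne (congrArg Prod.snd e)
    have hsee := (hP.sees_iff _ hq _ hx hqx).1 fun r hr => by
      refine hF.sees₀ y hy _ hx (Ne.symm hne) (fun z hz e => ?_) hr
      have : y' = z := congrArg Prod.snd e
      subst this
      have := hF.colPoint_lt (show (0 : Fin 4) < 2 by decide) hz
      rw [e] at this; exact lt_irrefl _ this
    refine hsee.2 ?_
    set t := τ (F.colPoint 2 y')
    have ht : 0 < t - c := by linarith
    rw [sbtw_plane_iff]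
    refine ⟨fun e => hqx (hP.injOn hq hx e), t / (t - c), -c / (t - c), by positivity,
      div_pos (by linarith) ht, by field_simp; ring, ?_, ?_⟩
    · have e1 := congrArg Prod.fst hc
      have e2 := congrArg Prod.fst h3
      rw [dir] at e1
      simp only [Prod.fst_sub, Prod.smul_fst, smul_eq_mul] at e1 e2
      field_simp
      linear_combination c * e2 - t * e1
    · have e1 := congrArg Prod.snd hc
      have e2 := congrArg Prod.snd h3
      rw [dir] at e1
      simp only [Prod.snd_sub, Prod.smul_snd, smul_eq_mul] at e1 e2
      field_simp
      linear_combination c * e2 - t * e1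
  · rw [zero_smul] at hc; exact hd hc
  · exact hne (Picture.dir_inj hF hP hy hy' h1 hc)

/-- Points on two rays see each other if there is no ray in the cone between. -/
theorem Polar.sees_of_cone_empty {u v : Plane} (hu : u ∈ F.stripPoints) (hv : v ∈ F.stripPoints)
    (hne : ρ u ≠ ρ v)
    (h : ∀ z ∈ F.rows, ¬ InCone (F.dir o ψ z) (F.dir o ψ (ρ u)) (F.dir o ψ (ρ v))) :
    ∀ r ∈ F.stripPoints, ¬ Sbtw ℝ u r v := by
  have hs := hR.cross_ne hF hP (hR.mem u hu) (hR.mem v hv) hne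
  have h1 := hR.one_le u hu
  have h2 := hR.one_le v hv
  refine (hP.sees_iff u hu v hv fun e => hne (by rw [e])).2 ⟨fun r hr hb => ?_, fun hb => ?_⟩
  · obtain ⟨a, b, ha, hb, -, e⟩ := hR.eq_comb_of_sbtw hF hP hu hv hb
    have h3 := one_pos.trans_le (hR.one_le r hr)
    rw [hR.eq r hr] at e
    refine h _ (hR.mem r hr) ?_
    have e1 := congrArg Prod.fst e
    have e2 := congrArg Prod.snd e
    simp only [Prod.fst_add, Prod.snd_add, Prod.smul_fst, Prod.smul_snd, smul_eq_mul] at e1 e2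
    set d1 := F.dir o ψ (ρ u)
    set d2 := F.dir o ψ (ρ v)
    set d := F.dir o ψ (ρ r)
    have hs2 : 0 < cross d1 d2 * cross d1 d2 := mul_self_pos.2 hs
    have c1 : τ r * (cross d1 d * cross d1 d2) = b * τ v * (cross d1 d2 * cross d1 d2) := by
      simp only [cross]
      linear_combination (d1.1 * d2.2 - d1.2 * d2.1) * (d1.1 * e2 - d1.2 * e1)
    have c2 : τ r * (cross d d2 * cross d1 d2) = a * τ u * (cross d1 d2 * cross d1 d2) := by
      simp only [cross]
      linear_combination (d1.1 * d2.2 - d1.2 * d2.1) * (d2.2 * e1 - d2.1 * e2)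
    exact ⟨pos_of_mul_pos_right (by rw [c1]; positivity) h3.le,
      pos_of_mul_pos_right (by rw [c2]; positivity) h3.le⟩
  · obtain ⟨a, b, ha, hb, -, e⟩ := hR.eq_comb_of_sbtw hF hP hu hv hb
    have e1 := congrArg Prod.fst e
    have e2 := congrArg Prod.snd e
    simp only [sub_self, Prod.fst_zero, Prod.snd_zero, Prod.fst_add, Prod.snd_add, Prod.smul_fst,
      Prod.smul_snd, smul_eq_mul] at e1 e2
    set d1 := F.dir o ψ (ρ u)
    set d2 := F.dir o ψ (ρ v)
    have c1 : b * τ v * cross d1 d2 = 0 := by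
      simp only [cross]
      linear_combination d1.2 * e1 - d1.1 * e2
    have : b * τ v ≠ 0 := by positivity
    exact hs ((mul_eq_zero.1 c1).resolve_left this)

/-- The rays appear around the image of `p` in the order of the rows. -/
theorem Polar.inCone_iff {y y' : ℝ} (hy : y ∈ F.rows) (hy' : y' ∈ F.rows) (hne : y ≠ y') :
    ∀ z ∈ F.rows, InCone (F.dir o ψ z) (F.dir o ψ y) (F.dir o ψ y') ↔
      (y < z ∧ z < y') ∨ (y' < z ∧ z < y) := by
  -- Induction on the number of rays in the cone. If it is empty, the two points of `s_0` see each
  -- other, so no row lies between theirs; a ray `k` inside splits it into two cones with fewer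
  -- rays.
  induction hN : {z ∈ F.rows | InCone (F.dir o ψ z) (F.dir o ψ y) (F.dir o ψ y')}.ncard
    using Nat.strong_induction_on generalizing y y' with
  | _ N ih =>
  by_cases hex : ∃ k ∈ F.rows, InCone (F.dir o ψ k) (F.dir o ψ y) (F.dir o ψ y')
  · obtain ⟨k, hk, hkc⟩ := hex
    have hky : y ≠ k := by
      rintro rfl
      have := hkc.1
      simp [cross, mul_comm] at this
    have hky' : k ≠ y' := by
      rintro rfl
      have := hkc.2
      simp [cross, mul_comm] at this
    have hsplit : ∀ z ∈ F.rows, z ≠ k → (InCone (F.dir o ψ z) (F.dir o ψ y) (F.dir o ψ y') ↔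
        InCone (F.dir o ψ z) (F.dir o ψ y) (F.dir o ψ k) ∨
        InCone (F.dir o ψ z) (F.dir o ψ k) (F.dir o ψ y')) := fun z hz hzk =>
      inCone_split hkc (hR.cross_ne hF hP hz hk hzk)
    have hfin : {z ∈ F.rows | InCone (F.dir o ψ z) (F.dir o ψ y) (F.dir o ψ y')}.Finite :=
      rows_finite.subset fun _ h => h.1
    have hk1 : ¬ InCone (F.dir o ψ k) (F.dir o ψ y) (F.dir o ψ k) := fun h => by
      have := h.2
      simp [cross, mul_comm] at this
    have hk2 : ¬ InCone (F.dir o ψ k) (F.dir o ψ k) (F.dir o ψ y') := fun h => by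
      have := h.1
      simp [cross, mul_comm] at this
    have i1 := ih _ (by
      rw [← hN]
      refine Set.ncard_lt_ncard ⟨fun z hz => ⟨hz.1, ?_⟩, fun hsub => ?_⟩ hfin
      · exact (hsplit z hz.1 fun e => hk1 (e ▸ hz.2)).2 (.inl hz.2)
      · exact hk1 (hsub ⟨hk, hkc⟩).2) hy hk hky rfl
    have i2 := ih _ (by
      rw [← hN]
      refine Set.ncard_lt_ncard ⟨fun z hz => ⟨hz.1, ?_⟩, fun hsub => ?_⟩ hfin
      · exact (hsplit z hz.1 fun e => hk2 (e ▸ hz.2)).2 (.inr hz.2)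
      · exact hk2 (hsub ⟨hk, hkc⟩).2) hk hy' hky' rfl
    have j1 : ¬ InCone (F.dir o ψ y') (F.dir o ψ y) (F.dir o ψ k) := fun h => by
      have h1 := (hsplit y' hy' hky'.symm).2 (.inl h)
      have := h1.2
      simp [cross, mul_comm] at this
    have j2 : ¬ InCone (F.dir o ψ y) (F.dir o ψ k) (F.dir o ψ y') := fun h => by
      have h1 := (hsplit y hy hky).2 (.inr h)
      have := h1.1
      simp [cross, mul_comm] at this
    rw [i1 y' hy'] at j1
    rw [i2 y hy] at j2
    -- By the smaller cases `y'` is not between `y` and `k`, nor `y` between `k` and `y'`, so `k` is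
    -- the middle one.
    have hbetween : (y < k ∧ k < y') ∨ (y' < k ∧ k < y) := by
      rcases lt_or_gt_of_ne hne with h1 | h1 <;> rcases lt_or_gt_of_ne hky with h2 | h2 <;>
        rcases lt_or_gt_of_ne hky' with h3 | h3 <;> simp_all
    intro z hz
    by_cases hzk : z = k
    · subst hzk
      exact ⟨fun _ => hbetween, fun _ => hkc⟩
    · rw [hsplit z hz hzk, i1 z hz, i2 z hz]
      rcases hbetween with ⟨h1, h2⟩ | ⟨h1, h2⟩ <;> rcases lt_or_gt_of_ne hzk with h3 | h3
      · constructor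
        · rintro ((⟨h, h'⟩ | ⟨h, h'⟩) | (⟨h, h'⟩ | ⟨h, h'⟩)) <;>
            (left; constructor <;> order)
        · rintro (⟨h, h'⟩ | ⟨h, h'⟩) <;>
            (left; left; constructor <;> order)
      · constructor
        · rintro ((⟨h, h'⟩ | ⟨h, h'⟩) | (⟨h, h'⟩ | ⟨h, h'⟩)) <;>
            (left; constructor <;> order)
        · rintro (⟨h, h'⟩ | ⟨h, h'⟩) <;>
            (right; left; constructor <;> order)
      · constructor
        · rintro ((⟨h, h'⟩ | ⟨h, h'⟩) | (⟨h, h'⟩ | ⟨h, h'⟩)) <;>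
            (right; constructor <;> order)
        · rintro (⟨h, h'⟩ | ⟨h, h'⟩) <;>
            (right; right; constructor <;> order)
      · constructor
        · rintro ((⟨h, h'⟩ | ⟨h, h'⟩) | (⟨h, h'⟩ | ⟨h, h'⟩)) <;>
            (right; constructor <;> order)
        · rintro (⟨h, h'⟩ | ⟨h, h'⟩) <;>
            (left; right; constructor <;> order)
  · push Not at hex
    intro z hz
    have h0 := hR.colPoint_zero hF hP hy
    have h0' := hR.colPoint_zero hF hP hy'
    have := hF.not_mem_between_of_sees (hR.sees_of_cone_empty hF hP (colPoint_mem 0 hy)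
      (colPoint_mem 0 hy') (by rw [h0.1, h0'.1]; exact hne) (by rw [h0.1, h0'.1]; exact hex)) z hz
    exact ⟨fun h => absurd h (hex z hz), fun h => absurd h (not_or.2 this)⟩

/-- The directions turn in one sense as the rows go up, and the total turn is less than a half-turn;
this is what allows `o` to be sent to infinity in `Picture.exists_drawing`. -/
theorem Polar.cross_pos {y y' : ℝ} (hy : y ∈ F.rows) (hy' : y' ∈ F.rows) (hlt : y < y') :
    0 < cross (F.dir o ψ 0) (F.dir o ψ F.H) * cross (F.dir o ψ y) (F.dir o ψ y') := by
  have hH := hF.H_pos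
  have h1 : ∀ {y}, y ∈ F.rows → 0 < y →
      0 < cross (F.dir o ψ 0) (F.dir o ψ F.H) * cross (F.dir o ψ 0) (F.dir o ψ y) := by
    intro y hy h0
    have hs := hR.cross_ne hF hP zero_mem_rows top_mem_rows hH.ne
    rcases (hF.rows_mem_Icc hy).2.eq_or_lt with rfl | h
    · exact mul_self_pos.2 hs
    · rw [mul_comm]
      exact ((hR.inCone_iff hF hP zero_mem_rows top_mem_rows hH.ne y hy).2 (.inl ⟨h0, h⟩)).1
  have h0' := (hF.rows_mem_Icc hy).1.trans_lt hlt
  have h2 := h1 hy' h0'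
  rcases (hF.rows_mem_Icc hy).1.eq_or_lt with rfl | h0
  · exact h2
  · have h3 := ((hR.inCone_iff hF hP zero_mem_rows hy' h0'.ne y hy).2 (.inl ⟨h0, hlt⟩)).2
    have h4 := mul_pos h2 h3
    have h5 : 0 < cross (F.dir o ψ 0) (F.dir o ψ y') * cross (F.dir o ψ 0) (F.dir o ψ y') :=
      mul_self_pos.2 (hR.cross_ne hF hP zero_mem_rows hy' h0'.ne)
    refine pos_of_mul_pos_right (a := cross (F.dir o ψ 0) (F.dir o ψ y') *
      cross (F.dir o ψ 0) (F.dir o ψ y')) ?_ h5.le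
    linarith

end

end FanData

/-! ### Every point keeps its row; drawings with horizontal rows -/

theorem collinear_of_linear {S : Set Plane} {a b c : ℝ} (hab : a ≠ 0 ∨ b ≠ 0)
    (h : ∀ p ∈ S, a * p.1 + b * p.2 = c) : Collinear ℝ S := by
  have hs : a ^ 2 + b ^ 2 ≠ 0 := by
    intro h0
    rcases hab with h1 | h1 <;> exact h1 (by nlinarith)
  rw [collinear_iff_exists_forall_eq_smul_vadd]
  refine ⟨(a * c / (a ^ 2 + b ^ 2), b * c / (a ^ 2 + b ^ 2)), (-b, a), fun p hp => ?_⟩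
  refine ⟨(a * p.2 - b * p.1) / (a ^ 2 + b ^ 2), ?_⟩
  have := h p hp
  ext
  · simp only [vadd_eq_add, Prod.fst_add, Prod.smul_fst, smul_eq_mul]
    field_simp
    linear_combination a * this
  · simp only [vadd_eq_add, Prod.snd_add, Prod.smul_snd, smul_eq_mul]
    field_simp
    linear_combination b * this

namespace FanData

variable {F : FanData}

/-- A drawing of the fan in which the rows are horizontal: the row at height `y` moves to height
`Y y`, and the point `v` to horizontal position `X v`. -/
structure Drawing (F : FanData) (X : Plane → ℝ) (Y : ℝ → ℝ) : Prop where
  strictMono : StrictMonoOn Y F.rows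
  lt : ∀ u ∈ F.stripPoints, ∀ v ∈ F.stripPoints, u.2 = v.2 → u.1 < v.1 → X u < X v
  blocked : ∀ u ∈ F.stripPoints, ∀ v ∈ F.stripPoints, u.2 < v.2 →
    (∃ r ∈ F.stripPoints, Sbtw ℝ u r v) → ∃ r ∈ F.stripPoints, u.2 < r.2 ∧ r.2 < v.2 ∧
      X r * (Y v.2 - Y u.2) = X u * (Y v.2 - Y r.2) + X v * (Y r.2 - Y u.2)

section

variable (hF : F.IsGeneralizedFan) {o : Plane} {ψ : Plane → Plane} (hP : F.Picture o ψ)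
  {ρ τ : Plane → ℝ} (hR : F.Polar o ψ ρ τ)
include hF hP hR

/-- If the second point on a ray comes from another row, then the row halfway is present. -/
theorem Polar.half_mem {y z : ℝ} (hy : y ∈ F.rows) (hz : z ∈ F.rows) (hzy : z ≠ y)
    (hρ : ρ (F.colPoint 1 z) = y)
    (hτ : ∀ v ∈ F.stripPoints, ρ v = y → v ≠ F.colPoint 0 y → v ≠ F.colPoint 1 z →
        τ (F.colPoint 1 z) < τ v) : (z + y) / 2 ∈ F.rows := by
  have h2 := colPoint_mem (F := F) 2 hy
  have h3 := colPoint_mem (F := F) 3 hy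
  have hu := colPoint_mem (F := F) 1 hz
  have r2 := hR.ρ_colPoint hF hP (j := 2) (by decide) hy
  have r3 := hR.ρ_colPoint hF hP (j := 3) (by decide) hy
  have n2 : F.colPoint 1 z ≠ F.colPoint 2 y := fun e => hzy (congrArg Prod.snd e)
  have n3 : F.colPoint 1 z ≠ F.colPoint 3 y := fun e => hzy (congrArg Prod.snd e)
  have hne : ∀ {i j : Fin 4}, i < j → F.colPoint j y ≠ F.colPoint i y := fun hij e => by
    have := hF.colPoint_lt hij hy
    rw [e] at this; exact lt_irrefl _ this
  have t2 := hτ _ h2 r2 (hne (by decide)) n2.symm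
  have t3 := hτ _ h3 r3 (hne (by decide)) n3.symm
  -- The point of `s_3` cannot come before that of `s_2`, since points of `s_1` and `s_2` always see
  -- each other.
  have t23 : τ (F.colPoint 2 y) < τ (F.colPoint 3 y) := by
    refine lt_of_le_of_ne ?_ fun e =>
      (hne (i := 2) (j := 3) (by decide)) (hR.ext hP h3 h2 (r3.trans r2.symm) e.symm)
    by_contra! hlt
    refine ((hP.sees_iff _ hu _ h2 n2).1 (hF.colPoint_sees (by decide) (by decide))).1 _ h3
      (hR.sbtw hP hu h3 h2 (hρ.trans r3.symm) (r3.trans r2.symm) t3 hlt)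
  have hb : Sbtw ℝ (ψ (F.colPoint 1 z)) (ψ (F.colPoint 2 y)) (ψ (F.colPoint 3 y)) :=
    hR.sbtw hP hu h2 h3 (hρ.trans r2.symm) (r2.trans r3.symm) t2 t23
  by_contra hcon
  exact ((hP.sees_iff _ hu _ h3 n3).1 fun r hr h => hcon (hF.half_mem_of_blocked hr h)).1 _ h2 hb

/-- Every point keeps its row. -/
theorem Polar.ρ_eq_snd {v : Plane} (hv : v ∈ F.stripPoints) : ρ v = v.2 := by
  obtain ⟨hkeep, f, hf⟩ := hR.rows_preserved hF hP
  suffices hid : ∀ y ∈ F.rows, f y = y by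
    by_cases h : v = F.colPoint 1 v.2
    · have := (hf _ (snd_mem_rows hv)).2.1
      rwa [hid _ (snd_mem_rows hv), ← h] at this
    · exact hkeep v hv h
  have hfinj : ∀ y ∈ F.rows, ∀ y' ∈ F.rows, f y = f y' → y = y' := fun y hy y' hy' h => by
    rw [← (hf y hy).2.1, ← (hf y' hy').2.1, h]
  set S := (rows_finite (F := F)).toFinset with hS
  have hmem : ∀ {y}, y ∈ S ↔ y ∈ F.rows := by simp [hS]
  obtain ⟨m, hm⟩ : ∃ m, S.card = m + 1 := Nat.exists_eq_succ_of_ne_zero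
    (Finset.card_ne_zero_of_mem (hmem.2 zero_mem_rows))
  let e : Fin (m + 1) ↪o ℝ := S.orderEmbOfFin hm
  have heS : ∀ i, e i ∈ F.rows := fun i => hmem.1 (S.orderEmbOfFin_mem hm i)
  have hrange : ∀ y ∈ F.rows, ∃ i, e i = y := fun y hy => by
    have : y ∈ Set.range (S.orderEmbOfFin hm) := by
      rw [Finset.range_orderEmbOfFin]; exact hmem.2 hy
    exact this
  have hex : ∀ i : ℕ, ∃ j : ℕ, ∀ h : i < m + 1, ∃ h' : j < m + 1, f (e ⟨i, h⟩) = e ⟨j, h'⟩ := by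
    intro i
    by_cases h : i < m + 1
    · obtain ⟨j, hj⟩ := hrange _ (hf _ (heS ⟨i, h⟩)).1
      exact ⟨j, fun _ => ⟨j.2, hj.symm⟩⟩
    · exact ⟨0, fun h' => absurd h' h⟩
  choose g hg using hex
  -- The cone between neighbouring rays is empty, so the points of `s_1` on them see each other and
  -- come from neighbouring rows. Here `g` is `f` read on the indices of the rows.
  have hstep : ∀ i < m, g (i + 1) = g i + 1 ∨ g i = g (i + 1) + 1 := by
    intro i hi
    obtain ⟨b1, h1⟩ := hg i (by omega)
    obtain ⟨b2, h2⟩ := hg (i + 1) (by omega)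
    set y := e ⟨i, by omega⟩ with hy
    set y' := e ⟨i + 1, by omega⟩ with hy'
    have hyy' : y < y' := e.strictMono (by simp [Fin.lt_def])
    have hyr : y ∈ F.rows := heS _
    have hyr' : y' ∈ F.rows := heS _
    have hempty : ∀ z ∈ F.rows, ¬ InCone (F.dir o ψ z) (F.dir o ψ y) (F.dir o ψ y') := by
      intro z hz hc
      obtain ⟨l, rfl⟩ := hrange z hz
      rcases (hR.inCone_iff hF hP hyr hyr' hyy'.ne _ hz).1 hc with h | h
      · have ha := e.lt_iff_lt.1 h.1
        have hb := e.lt_iff_lt.1 h.2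
        rw [Fin.lt_def] at ha hb
        simp at ha hb
        omega
      · exact absurd (h.1.trans h.2) (not_lt.2 hyy'.le)
    have hsee := hF.not_mem_between_of_sees (hR.sees_of_cone_empty hF hP
      (colPoint_mem 1 (hf y hyr).1) (colPoint_mem 1 (hf y' hyr').1)
      (by rw [(hf y hyr).2.1, (hf y' hyr').2.1]; exact hyy'.ne)
      (by rw [(hf y hyr).2.1, (hf y' hyr').2.1]; exact hempty))
    rw [h1, h2] at hsee
    have hne : g i ≠ g (i + 1) := fun h => by
      refine hyy'.ne (hfinj y hyr y' hyr' ?_)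
      rw [h1, h2]; simp [h]
    rcases lt_or_gt_of_ne hne with h | h
    · left
      by_contra hcon
      refine (hsee (e ⟨g i + 1, by omega⟩) (heS _)).1 ⟨?_, ?_⟩ <;>
        rw [e.lt_iff_lt, Fin.lt_def] <;> simp
      omega
    · right
      by_contra hcon
      refine (hsee (e ⟨g (i + 1) + 1, by omega⟩) (heS _)).2 ⟨?_, ?_⟩ <;>
        rw [e.lt_iff_lt, Fin.lt_def] <;> simp
      omega
  have hhalf : ∀ y ∈ F.rows, f y ≠ y → (f y + y) / 2 ∈ F.rows := fun y hy h =>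
    hR.half_mem hF hP hy (hf y hy).1 h (hf y hy).2.1 (hf y hy).2.2
  rcases eq_id_or_rev (m := m) (g := g) (fun i hi => by
      have := (hg i (by omega)).1; omega) (fun i hi j hj h => by
      obtain ⟨b1, h1⟩ := hg i (by omega)
      obtain ⟨b2, h2⟩ := hg j (by omega)
      have := hfinj _ (heS ⟨i, by omega⟩) _ (heS ⟨j, by omega⟩) (by rw [h1, h2]; simp [h])
      simpa using e.injective this) hstep with h | h
  · intro y hy
    obtain ⟨i, rfl⟩ := hrange y hy
    obtain ⟨b, hb⟩ := hg i i.2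
    have := h i (by omega)
    simp only [this] at hb
    exact hb
  · exfalso
    -- There are `m + 1` rows. For even `m` the reversal sends `0` to `F.H`, and the row at `F.H /
    -- 2` is excluded by `half`; for odd `m` it swaps the two middle rows, between which there is no
    -- row.
    rcases Nat.even_or_odd m with hev | ⟨c, hc⟩
    · have hfirst : e ⟨0, by omega⟩ = 0 := by
        obtain ⟨i, hi⟩ := hrange 0 zero_mem_rows
        refine le_antisymm ?_ (hF.rows_mem_Icc (heS _)).1
        rw [← hi]
        exact e.monotone (Fin.zero_le _)
      have hlast : e ⟨m, by omega⟩ = F.H := by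
        obtain ⟨i, hi⟩ := hrange F.H top_mem_rows
        refine le_antisymm (hF.rows_mem_Icc (heS _)).2 ?_
        rw [← hi]
        exact e.monotone (Fin.le_last _)
      obtain ⟨b, hb⟩ := hg 0 (by omega)
      have h0 := h 0 (by omega)
      simp only [add_zero] at h0
      simp only [h0] at hb
      rw [hfirst, hlast] at hb
      have := hhalf 0 zero_mem_rows (by rw [hb]; exact hF.H_pos.ne')
      rw [hb, add_zero] at this
      refine hF.half.elim (fun hE => ?_) fun hn => hn this
      rw [Set.ncard_eq_toFinset_card _ rows_finite, ← hS, hm] at hE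
      exact (Nat.even_add_one.1 hE) hev
    · obtain ⟨b, hb⟩ := hg c (by omega)
      have h0 := h c (by omega)
      have h1 : g c = c + 1 := by omega
      simp only [h1] at hb
      have hlt : e ⟨c, by omega⟩ < e ⟨c + 1, by omega⟩ := e.strictMono (by simp [Fin.lt_def])
      have hmid := hhalf _ (heS ⟨c, by omega⟩) (by rw [hb]; exact hlt.ne')
      rw [hb] at hmid
      obtain ⟨l, hl⟩ := hrange _ hmid
      have ha : e ⟨c, by omega⟩ < e l := by rw [hl]; linarith
      have hb : e l < e ⟨c + 1, by omega⟩ := by rw [hl]; linarith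
      rw [e.lt_iff_lt, Fin.lt_def] at ha hb
      simp at ha hb
      omega

/-- The points on a ray keep their order. -/
theorem Polar.τ_lt {u v : Plane} (hu : u ∈ F.stripPoints) (hv : v ∈ F.stripPoints)
    (huv : u.2 = v.2) (hlt : u.1 < v.1) : τ u < τ v := by
  have hρ : ∀ {w}, w ∈ F.stripPoints → w.2 = u.2 → ρ w = u.2 := fun hw h =>
    (hR.ρ_eq_snd hF hP hw).trans h
  have hy := snd_mem_rows hu
  have h0 := hR.colPoint_zero hF hP hy
  -- In a row of the fan and on a ray of the picture alike, blocked means having a point in between;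
  -- the two orders share their least point, the one on `s_0`.
  refine lt_of_consecutive_iff (A := {w ∈ F.stripPoints | w.2 = u.2}) (f := Prod.fst) (g := τ)
    (stripPoints_finite.subset fun _ h => h.1) ?_ ?_ ?_ (m := F.colPoint 0 u.2)
    ⟨colPoint_mem 0 hy, rfl⟩ ?_ ?_ u ⟨hu, rfl⟩ v ⟨hv, huv.symm⟩ hlt
  · rintro a ⟨-, ha⟩ b ⟨-, hb⟩ h
    exact Prod.ext h (ha.trans hb.symm)
  · rintro a ⟨ha, ha'⟩ b ⟨hb, hb'⟩ h
    exact hR.ext hP ha hb ((hρ ha ha').trans (hρ hb hb').symm) h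
  · rintro a ⟨ha, ha'⟩ b ⟨hb, hb'⟩ hab
    have hne : a ≠ b := fun e => by rw [e] at hab; exact lt_irrefl _ hab
    have hρab : ρ a = ρ b := (hρ ha ha').trans (hρ hb hb').symm
    constructor
    · rintro ⟨r, ⟨hr, hr'⟩, h1, h2⟩
      by_contra! hcon
      refine ((hP.sees_iff a ha b hb hne).2 ⟨fun w hw hs => ?_,
        hR.not_sbtw_apex_of_ray hF hP ha hb hρab⟩) r hr
        ((hF.sbtw_row_iff (ha'.trans hb'.symm) hab).2 ⟨hr'.trans ha'.symm, h1, h2⟩)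
      obtain ⟨e1, e2⟩ := hR.of_sbtw_of_ray hF hP ha hw hb hρab hs
      rw [hR.ρ_eq_snd hF hP hw, hρ ha ha'] at e1
      have := hcon w ⟨hw, e1⟩
      rcases e2 with e2 | e2
      · exact absurd (this.1 e2.1) (not_le.2 e2.2)
      · exact absurd (this.2 e2.1) (not_le.2 e2.2)
    · rintro ⟨r, ⟨hr, hr'⟩, h⟩
      by_contra! hcon
      have hsee := ((hP.sees_iff a ha b hb hne).1 fun w hw hs => by
        obtain ⟨e1, e2, e3⟩ := (hF.sbtw_row_iff (ha'.trans hb'.symm) hab).1 hs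
        exact absurd (hcon w ⟨hw, e1.trans ha'⟩ e2) (not_le.2 e3)).1 r hr
      have hra : ρ a = ρ r := (hρ ha ha').trans (hρ hr hr').symm
      rcases h with h | h
      · exact hsee (hR.sbtw hP ha hr hb hra (hra.symm.trans hρab) h.1 h.2)
      · exact hsee (hR.sbtw hP hb hr ha (hρab.symm.trans hra) hra.symm h.1 h.2).symm
  · rintro a ⟨ha, ha'⟩
    have := (hF.isFirst_iff (colPoint_mem 0 hy)).2 rfl a ha ha'
    exact this
  · rintro a ⟨ha, ha'⟩
    rw [h0.2]
    exact hR.one_le a ha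

end

/-- Every picture of a generalized fan is, up to a projective transformation, a drawing with
horizontal rows. -/
theorem Picture.exists_drawing (hF : F.IsGeneralizedFan) {o : Plane} {ψ : Plane → Plane}
    (hP : F.Picture o ψ) :
    (∀ v ∈ F.stripPoints, ∃ t : ℝ, ψ v = t • F.dir o ψ v.2 + o) ∧
    ∃ X Y, F.Drawing X Y ∧ ∀ S ⊆ F.stripPoints,
      (∃ α β : ℝ, ∀ q ∈ S, X q = α + β * Y q.2) → Collinear ℝ (ψ '' S) := by
  obtain ⟨ρ, τ, hR⟩ := hP.exists_polar hF
  have hpol : ∀ v ∈ F.stripPoints, ψ v - o = τ v • F.dir o ψ v.2 := fun v hv => by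
    rw [hR.eq v hv, hR.ρ_eq_snd hF hP hv]
  refine ⟨fun v hv => ⟨τ v, by rw [← hpol v hv, sub_add_cancel]⟩, ?_⟩
  set d0 := F.dir o ψ 0 with hd0
  set dH := F.dir o ψ F.H with hdH
  set κ := cross d0 dH with hκ
  -- The map `(-1 / L, C / L)` in coordinates centred at `o` is projective and sends `o` to
  -- infinity, while `L` is positive on all rays. `C / L` depends only on the ray, and the minus
  -- sign makes the other coordinate increase with the distance from `o`.
  let C : Plane → ℝ := fun w => κ * cross d0 w
  let L : Plane → ℝ := fun w => κ * (cross d0 w + cross w dH)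
  have hC : ∀ {a b : ℝ} {u v w : Plane}, w = a • u + b • v → C w = a * C u + b * C v := by
    rintro a b u v w rfl
    simp only [C, cross, Prod.fst_add, Prod.snd_add, Prod.smul_fst, Prod.smul_snd, smul_eq_mul]
    ring
  have hL : ∀ {a b : ℝ} {u v w : Plane}, w = a • u + b • v → L w = a * L u + b * L v := by
    rintro a b u v w rfl
    simp only [L, cross, Prod.fst_add, Prod.snd_add, Prod.smul_fst, Prod.smul_snd, smul_eq_mul]
    ring
  have hLpos : ∀ y ∈ F.rows, 0 < L (F.dir o ψ y) := by
    intro y hy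
    have hH := hF.H_pos
    simp only [L, mul_add]
    rcases (hF.rows_mem_Icc hy).1.eq_or_lt with rfl | h0
    · have h1 := hR.cross_pos hF hP zero_mem_rows top_mem_rows hH
      have : cross d0 (F.dir o ψ 0) = 0 := by rw [← hd0]; simp [cross, mul_comm]
      rw [this, mul_zero, zero_add]
      exact h1
    · have h1 := hR.cross_pos hF hP zero_mem_rows hy h0
      rcases (hF.rows_mem_Icc hy).2.eq_or_lt with rfl | h2
      · have : cross (F.dir o ψ F.H) dH = 0 := by rw [← hdH]; simp [cross, mul_comm]
        rw [this, mul_zero, add_zero]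
        exact h1
      · exact add_pos h1 (hR.cross_pos hF hP hy top_mem_rows h2)
  have hτ : ∀ v ∈ F.stripPoints, 0 < τ v := fun v hv => one_pos.trans_le (hR.one_le v hv)
  have hCτ : ∀ v ∈ F.stripPoints, C (ψ v - o) = τ v * C (F.dir o ψ v.2) := fun v hv => by
    have := hC (a := τ v) (b := 0) (v := 0) (show ψ v - o = τ v • F.dir o ψ v.2 + (0 : ℝ) • 0 by
      rw [hpol v hv]; simp)
    simpa using this
  have hLτ : ∀ v ∈ F.stripPoints, L (ψ v - o) = τ v * L (F.dir o ψ v.2) := fun v hv => by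
    have := hL (a := τ v) (b := 0) (v := 0) (show ψ v - o = τ v • F.dir o ψ v.2 + (0 : ℝ) • 0 by
      rw [hpol v hv]; simp)
    simpa using this
  have hLv : ∀ v ∈ F.stripPoints, 0 < L (ψ v - o) := fun v hv => by
    rw [hLτ v hv]
    exact mul_pos (hτ v hv) (hLpos _ (snd_mem_rows hv))
  let Y : ℝ → ℝ := fun y => C (F.dir o ψ y) / L (F.dir o ψ y)
  have hYv : ∀ v ∈ F.stripPoints, Y v.2 = C (ψ v - o) / L (ψ v - o) := fun v hv => by
    rw [hCτ v hv, hLτ v hv, mul_div_mul_left _ _ (hτ v hv).ne']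
  have hmono : StrictMonoOn Y F.rows := by
    intro y hy y' hy' hlt
    have h1 := hR.cross_pos hF hP hy hy' hlt
    have h2 := hR.cross_pos hF hP zero_mem_rows top_mem_rows hF.H_pos
    rw [← hd0, ← hdH, ← hκ] at h1 h2
    simp only [Y]
    rw [div_lt_div_iff₀ (hLpos y hy) (hLpos y' hy')]
    have : C (F.dir o ψ y') * L (F.dir o ψ y) - C (F.dir o ψ y) * L (F.dir o ψ y') =
        (κ * cross (F.dir o ψ y) (F.dir o ψ y')) * (κ * κ) := by
      simp only [C, L, hκ, cross]; ring
    have := mul_pos h1 h2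
    linarith
  refine ⟨fun v => -1 / L (ψ v - o), Y, ⟨hmono, ?_, ?_⟩, ?_⟩
  · intro u hu v hv huv hlt
    have h1 := hR.τ_lt hF hP hu hv huv hlt
    change -1 / L (ψ u - o) < -1 / L (ψ v - o)
    rw [neg_div, neg_div, neg_lt_neg_iff]
    refine one_div_lt_one_div_of_lt (hLv u hu) ?_
    rw [hLτ u hu, hLτ v hv, huv]
    exact mul_lt_mul_of_pos_right h1 (hLpos _ (snd_mem_rows hv))
  · rintro u hu v hv huv ⟨r0, hr0, hb0⟩
    have hne : u ≠ v := fun e => by rw [e] at huv; exact lt_irrefl _ huv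
    have hρ : ρ u ≠ ρ v := by rw [hR.ρ_eq_snd hF hP hu, hR.ρ_eq_snd hF hP hv]; exact huv.ne
    have ho : ¬ Sbtw ℝ (ψ u) o (ψ v) := by
      intro h
      obtain ⟨a, b, ha, hb, -, e⟩ := hR.eq_comb_of_sbtw hF hP hu hv h
      rw [← smul_smul, ← smul_smul, ← hR.eq u hu, ← hR.eq v hv, sub_self] at e
      have := hL e
      have h1 : L 0 = 0 := by simp [L, cross]
      have := mul_pos ha (hLv u hu)
      have := mul_pos hb (hLv v hv)
      linarith
    have hns : ¬ ∀ r ∈ F.stripPoints, ¬ Sbtw ℝ (ψ u) (ψ r) (ψ v) := fun h =>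
      (hP.sees_iff u hu v hv hne).2 ⟨h, ho⟩ r0 hr0 hb0
    push Not at hns
    obtain ⟨r, hr, hb⟩ := hns
    obtain ⟨a, b, ha, hb, hab, e⟩ := hR.eq_comb_of_sbtw hF hP hu hv hb
    rw [← smul_smul, ← smul_smul, ← hR.eq u hu, ← hR.eq v hv] at e
    have eC := hC e
    have eL := hL e
    have pu := hLv u hu
    have pv := hLv v hv
    have pr := hLv r hr
    have hYuv : Y u.2 < Y v.2 := hmono (snd_mem_rows hu) (snd_mem_rows hv) huv
    have key : Y r.2 * L (ψ r - o) = a * L (ψ u - o) * Y u.2 + b * L (ψ v - o) * Y v.2 := by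
      rw [hYv r hr, hYv u hu, hYv v hv]
      field_simp
      linarith
    have hau := mul_pos ha pu
    have hbv := mul_pos hb pv
    refine ⟨r, hr, ?_, ?_, ?_⟩
    · refine (hmono.lt_iff_lt (snd_mem_rows hu) (snd_mem_rows hr)).1 ?_
      refine lt_of_mul_lt_mul_right ?_ pr.le
      rw [key, eL]
      nlinarith
    · refine (hmono.lt_iff_lt (snd_mem_rows hr) (snd_mem_rows hv)).1 ?_
      refine lt_of_mul_lt_mul_right ?_ pr.le
      rw [key, eL]
      nlinarith
    · have e1 : Y r.2 = (a * L (ψ u - o) * Y u.2 + b * L (ψ v - o) * Y v.2) / L (ψ r - o) := by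
        rw [← key]; field_simp
      change -1 / L (ψ r - o) * _ = -1 / L (ψ u - o) * _ + -1 / L (ψ v - o) * _
      rw [e1]
      field_simp
      rw [eL]
      linear_combination L (ψ u - o) * L (ψ v - o) * (Y v.2 - Y u.2) * hab
  · rintro S hS ⟨α, β, h⟩
    -- The line `X = α + β * Y` pulls back to the line `α * L + β * C = -1`.
    have hlin : ∀ q ∈ S, α * L (ψ q - o) + β * C (ψ q - o) = -1 := by
      intro q hq
      have h1 := h q hq
      have h2 := hLv q (hS hq)
      rw [hYv q (hS hq)] at h1
      field_simp at h1
      linarith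
    rcases S.eq_empty_or_nonempty with rfl | ⟨q0, hq0⟩
    · simp [collinear_empty]
    · refine collinear_of_linear
        (a := α * κ * (dH.2 - d0.2) - β * κ * d0.2)
        (b := α * κ * (d0.1 - dH.1) + β * κ * d0.1)
        (c := -1 + (α * κ * (dH.2 - d0.2) - β * κ * d0.2) * o.1 +
          (α * κ * (d0.1 - dH.1) + β * κ * d0.1) * o.2) ?_ ?_
      · by_contra! hcon
        have := hlin q0 hq0
        simp only [L, C, cross, Prod.fst_sub, Prod.snd_sub] at this
        have h3 : (α * κ * (dH.2 - d0.2) - β * κ * d0.2) * ((ψ q0).1 - o.1) +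
          (α * κ * (d0.1 - dH.1) + β * κ * d0.1) * ((ψ q0).2 - o.2) = -1 := by
          linear_combination this
        rw [hcon.1, hcon.2] at h3
        norm_num at h3
      · rintro _ ⟨q, hq, rfl⟩
        have := hlin q hq
        simp only [L, C, cross, Prod.fst_sub, Prod.snd_sub] at this
        linear_combination this

end FanData

/-! ### Straightness from consecutive triples; crossings and their neighbouring rays -/

/-- If consecutive points of a finite set are aligned, then all of them are. -/
theorem exists_line_of_consecutive (Z : Finset ℝ) {X Y : ℝ → ℝ} (hY : StrictMonoOn Y Z)
    (h : ∀ a ∈ Z, ∀ b ∈ Z, ∀ c ∈ Z, a < b → b < c →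
      (∀ z ∈ Z, ¬ (a < z ∧ z < b) ∧ ¬ (b < z ∧ z < c)) →
      X b * (Y c - Y a) = X a * (Y c - Y b) + X c * (Y b - Y a)) :
    ∃ α β : ℝ, ∀ z ∈ Z, X z = α + β * Y z := by
  induction Z using Finset.induction_on_max with
  | empty => exact ⟨0, 0, by simp⟩
  | insert c s hmax ih =>
    obtain ⟨α, β, hs⟩ := ih (hY.mono (by simp)) fun a ha b hb d hd hab hbd hcon =>
      h a (by simp [ha]) b (by simp [hb]) d (by simp [hd]) hab hbd fun z hz => by
        rcases Finset.mem_insert.1 hz with rfl | hz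
        · have h1 := hmax b hb
          have h2 := hmax d hd
          exact ⟨fun h => by linarith [h.2], fun h => by linarith [h.2]⟩
        · exact hcon z hz
    rcases s.eq_empty_or_nonempty with rfl | hne
    · exact ⟨X c, 0, by simp⟩
    set b := s.max' hne
    have hb : b ∈ s := s.max'_mem hne
    have hbc := hmax b hb
    rcases (s.erase b).eq_empty_or_nonempty with he | hne'
    · have hYbc : Y b < Y c := hY (by simp [hb]) (by simp) hbc
      have hd : Y c - Y b ≠ 0 := by linarith
      refine ⟨X b - (X c - X b) / (Y c - Y b) * Y b, (X c - X b) / (Y c - Y b), fun z hz => ?_⟩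
      rcases Finset.mem_insert.1 hz with rfl | hz
      · field_simp; ring
      · have : z = b := by
          by_contra hzb
          have : z ∈ s.erase b := Finset.mem_erase.2 ⟨hzb, hz⟩
          rw [he] at this; simp at this
        subst this
        ring
    · set a := (s.erase b).max' hne'
      have ha' : a ∈ s.erase b := Finset.max'_mem _ hne'
      have ha : a ∈ s := (Finset.mem_erase.1 ha').2
      have hab : a < b := lt_of_le_of_ne (s.le_max' a ha) (Finset.mem_erase.1 ha').1
      have key := h a (by simp [ha]) b (by simp [hb]) c (by simp) hab hbc fun z hz => by
        rcases Finset.mem_insert.1 hz with rfl | hz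
        · exact ⟨fun h => by linarith [h.2], fun h => by linarith [h.2]⟩
        · refine ⟨fun h => ?_, fun h => ?_⟩
          · have := (s.erase b).le_max' z (Finset.mem_erase.2 ⟨h.2.ne, hz⟩)
            exact absurd h.1 (not_lt.2 this)
          · exact absurd h.1 (not_lt.2 (s.le_max' z hz))
      refine ⟨α, β, fun z hz => ?_⟩
      rcases Finset.mem_insert.1 hz with rfl | hz
      · rw [hs a ha, hs b hb] at key
        have hYab : Y a < Y b := hY (by simp [ha]) (by simp [hb]) hab
        have hd : Y b - Y a ≠ 0 := by linarith
        apply mul_right_cancel₀ hd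
        linear_combination -key
      · exact hs z hz

namespace FanData

variable {F : FanData}

/-- The three points are aligned in the drawing. -/
def Aligned (X : Plane → ℝ) (Y : ℝ → ℝ) (u r v : Plane) : Prop :=
  X r * (Y v.2 - Y u.2) = X u * (Y v.2 - Y r.2) + X v * (Y r.2 - Y u.2)

theorem Aligned.symm {X : Plane → ℝ} {Y : ℝ → ℝ} {u r v : Plane} (h : Aligned X Y u r v) :
    Aligned X Y v r u := by
  unfold Aligned at *
  linear_combination -h

namespace IsGeneralizedFan

variable (hF : F.IsGeneralizedFan)
include hF

theorem ends_lt_of_lt {j j' : Fin 4} (h : j < j') :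
    F.strandLow (.inl j) < F.strandLow (.inl j') ∧
      F.strandHigh (.inl j) < F.strandHigh (.inl j') :=
  ⟨hF.colLow_lt h, hF.colHigh_lt h⟩

theorem ends_lt_seg (j : Fin 4) (t : Fin F.n) :
    F.strandLow (.inl j) < F.strandLow (.inr t) ∧
      F.strandHigh (.inl j) < F.strandHigh (.inr t) := by
  have h3 : F.strandLow (.inl 3) < F.strandLow (.inr t) ∧
      F.strandHigh (.inl 3) < F.strandHigh (.inr t) := by
    constructor
    · simpa [strandLow, colLow] using (hF.left t).1
    · simpa [strandHigh, colHigh] using (hF.left t).2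
  rcases (show j ≤ 3 from Fin.le_last j).eq_or_lt with rfl | h
  · exact h3
  · exact ⟨(hF.ends_lt_of_lt h).1.trans h3.1, (hF.ends_lt_of_lt h).2.trans h3.2⟩

/-- Two strands in different order at two heights cross in between. -/
theorem exists_crossing {s s' : F.Strand} {y z : ℝ} (hy : 0 ≤ y ∧ y ≤ F.H)
    (hz : 0 ≤ z ∧ z ≤ F.H) (h1 : (F.pt s y).1 < (F.pt s' y).1)
    (h2 : (F.pt s' z).1 < (F.pt s z).1) :
    ∃ x ∈ F.crossings, (y < x ∧ x < z) ∨ (z < x ∧ x < y) := by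
  have hH := hF.H_pos.ne'
  have hyz : y ≠ z := by rintro rfl; exact lt_asymm h1 h2
  have hcol : ∀ {s s' : F.Strand}, (F.strandLow s < F.strandLow s' ∧
      F.strandHigh s < F.strandHigh s') → ∀ {z}, (0 ≤ z ∧ z ≤ F.H) →
      (F.pt s' z).1 < (F.pt s z).1 → False := fun h _ hz h' =>
    lt_asymm h' (hF.pt_lt_of_ends_lt h.1 h.2 hz)
  rcases s with j | t <;> rcases s' with j' | t'
  · rcases lt_trichotomy j j' with h | rfl | h
    · exact (hcol (hF.ends_lt_of_lt h) hz h2).elim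
    · exact (lt_irrefl _ h1).elim
    · exact (hcol (hF.ends_lt_of_lt h) hy h1).elim
  · exact (hcol (hF.ends_lt_seg j t') hz h2).elim
  · exact (hcol (hF.ends_lt_seg j' t) hy h1).elim
  · set p := (F.pt (.inr t') y).1 - (F.pt (.inr t) y).1 with hp
    set q := (F.pt (.inr t) z).1 - (F.pt (.inr t') z).1 with hq
    have hp0 : 0 < p := by linarith
    have hq0 : 0 < q := by linarith
    have hpq : p + q ≠ 0 := by positivity
    -- The zero of the affine difference of the two strands, which is `p` at `y` and `-q` at `z`.
    set x := (q * y + p * z) / (p + q) with hx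
    have hx' : x * (p + q) = q * y + p * z := by rw [hx]; field_simp
    have hb : (y < x ∧ x < z) ∨ (z < x ∧ x < y) := by
      rcases lt_or_gt_of_ne hyz with h | h
      · left; constructor <;> nlinarith
      · right; constructor <;> nlinarith
    refine ⟨x, ⟨?_, ?_, t, t', ?_, ?_⟩, hb⟩
    · rcases hb with hb | hb <;> linarith
    · rcases hb with hb | hb <;> linarith
    · rintro rfl; exact lt_irrefl _ h1
    · ext
      · change (F.pt (.inr t) x).1 = (F.pt (.inr t') x).1
        have e : ((F.pt (.inr t) x).1 - (F.pt (.inr t') x).1) * (p + q) = 0 := by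
          have e1 : ((F.pt (.inr t) x).1 - (F.pt (.inr t') x).1) * (p + q) =
              q * -p + p * q := by
            rw [hp, hq]
            rw [hp, hq] at hx'
            simp only [pt_fst] at hx' ⊢
            field_simp at hx' ⊢
            linear_combination (F.strandHigh (.inr t) - F.strandLow (.inr t) -
              (F.strandHigh (.inr t') - F.strandLow (.inr t'))) * hx'
          rw [e1]; ring
        have := (mul_eq_zero.1 e).resolve_right hpq
        linarith
      · rfl

/-- The rows just below and just above a crossing that lies on no ray. -/
theorem rows_around_crossing {y A B : ℝ} (hy : y ∈ F.crossings) (hA : A ∈ F.longRows)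
    (hB : B ∈ F.longRows) (hAy : A < y) (hyB : y < B)
    (hcon : ∀ z ∈ F.longRows, ¬ (A < z ∧ z < B)) :
    ∃ β : Fin (F.k + 1), A = F.base β.castSucc + (5 * F.n : ℤ) * F.ε β.castSucc ∧
      B = F.base β.succ + (1 : ℤ) * F.ε β.succ := by
  have hn := hF.n_pos_of_crossing hy
  obtain ⟨β, hβ1, hβ2⟩ := hF.crossings_zone y hy
  have hTmem : F.base β.castSucc + (5 * F.n : ℤ) * F.ε β.castSucc ∈ F.bundle β.castSucc :=
    ⟨5 * F.n, by omega, le_rfl, by push_cast; ring⟩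
  have hT'mem : F.base β.succ + (1 : ℤ) * F.ε β.succ ∈ F.bundle β.succ :=
    ⟨1, le_rfl, by omega, rfl⟩
  have hmax : ∀ z ∈ F.bundle β.castSucc, z ≤ F.base β.castSucc +
      (5 * F.n : ℤ) * F.ε β.castSucc := by
    rintro z ⟨i, h1, h2, rfl⟩
    have : (i : ℝ) ≤ ((5 * F.n : ℤ) : ℝ) := by exact_mod_cast h2
    have := mul_le_mul_of_nonneg_right this (hF.ε_pos β.castSucc).le
    linarith
  have hmin : ∀ z ∈ F.bundle β.succ, F.base β.succ + (1 : ℤ) * F.ε β.succ ≤ z := by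
    rintro z ⟨i, h1, h2, rfl⟩
    have : ((1 : ℤ) : ℝ) ≤ i := by exact_mod_cast h1
    have := mul_le_mul_of_nonneg_right this (hF.ε_pos β.succ).le
    linarith
  set T := F.base β.castSucc + (5 * F.n : ℤ) * F.ε β.castSucc
  set T' := F.base β.succ + (1 : ℤ) * F.ε β.succ
  have hTy := hβ1 T hTmem
  have hyT' := hβ2 T' hT'mem
  have hTA : T ≤ A := by
    by_contra! h
    exact hcon T (bundle_subset_longRows _ hTmem) ⟨h, by linarith⟩
  have hBT : B ≤ T' := by
    by_contra! h
    exact hcon T' (bundle_subset_longRows _ hT'mem) ⟨by linarith, h⟩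
  have hT0 := hF.inside _ T (.inl hTmem)
  have hT'0 := hF.inside _ T' (.inl hT'mem)
  have hlong : ∀ z ∈ F.longRows, T ≤ z → z ≤ T' → (∀ w ∈ F.singles, w ∈ F.zone β → z ≠ w) →
      z = T ∨ z = T' := by
    intro z hz h1 h2 hs
    rcases hz with (hz | hz) | hz
    · rcases hz with rfl | rfl <;> linarith
    · obtain ⟨γ, hγ⟩ := Set.mem_iUnion.1 hz
      rcases lt_trichotomy γ β.castSucc with h | rfl | h
      · have := hF.ordered _ _ h z (.inl hγ) T (.inl hTmem)
        linarith
      · exact .inl (le_antisymm (hmax z hγ) h1)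
      · have h' : β.succ ≤ γ := by
          rw [Fin.lt_def] at h; rw [Fin.le_def]; simpa using h
        rcases h'.eq_or_lt with rfl | h'
        · exact .inr (le_antisymm h2 (hmin z hγ))
        · have := hF.ordered _ _ h' T' (.inl hT'mem) z (.inl hγ)
          linarith
    · by_contra! hne
      refine hs z hz ⟨fun w hw => ?_, fun w hw => ?_⟩ rfl
      · exact (hmax w hw).trans_lt (lt_of_le_of_ne h1 hne.1.symm)
      · exact (lt_of_le_of_ne h2 hne.2).trans_le (hmin w hw)
  -- A single ray in this zone would force one through the crossing itself, against `hcon`.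
  have hsing : ∀ w ∈ F.singles, w ∈ F.zone β → False := fun w hw hwz =>
    hcon y (.inr (hF.singles_all β ⟨w, hw, hwz⟩ y hy ⟨hβ1, hβ2⟩)) ⟨hAy, hyB⟩
  refine ⟨β, ?_, ?_⟩
  · rcases hlong A hA hTA (by linarith) fun w hw hwz _ => hsing w hw hwz with h | h
    · exact h
    · linarith
  · rcases hlong B hB (by linarith) hBT fun w hw hwz _ => hsing w hw hwz with h | h
    · linarith
    · exact h

end IsGeneralizedFan

/-! ### Blockers in a drawing -/

namespace Drawing

variable (hF : F.IsGeneralizedFan) {X : Plane → ℝ} {Y : ℝ → ℝ} (hD : F.Drawing X Y)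
include hF hD

theorem lt_iff {u v : Plane} (hu : u ∈ F.stripPoints) (hv : v ∈ F.stripPoints) (h : u.2 = v.2) :
    X u < X v ↔ u.1 < v.1 := by
  refine ⟨fun hlt => ?_, hD.lt u hu v hv h⟩
  by_contra! hle
  rcases hle.eq_or_lt with e | h'
  · rw [Prod.ext e.symm h] at hlt; exact lt_irrefl _ hlt
  · exact lt_asymm hlt (hD.lt v hv u hu h.symm h')

theorem le_iff {u v : Plane} (hu : u ∈ F.stripPoints) (hv : v ∈ F.stripPoints) (h : u.2 = v.2) :
    X u ≤ X v ↔ u.1 ≤ v.1 := by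
  rw [← not_lt, ← not_lt, hD.lt_iff hF hv hu h.symm]

/-- A pair of points on a strand with a point of the strand between them is blocked in every
drawing. -/
theorem exists_blocker {u v r : Plane} (hu : u ∈ F.stripPoints) (hv : v ∈ F.stripPoints)
    (huv : u.2 ≠ v.2) (hr : r ∈ F.stripPoints) (h : Sbtw ℝ u r v) :
    ∃ r ∈ F.stripPoints, ((u.2 < r.2 ∧ r.2 < v.2) ∨ (v.2 < r.2 ∧ r.2 < u.2)) ∧
      Aligned X Y u r v := by
  rcases lt_or_gt_of_ne huv with h1 | h1
  · obtain ⟨w, hw, h2, h3, h4⟩ := hD.blocked u hu v hv h1 ⟨r, hr, h⟩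
    exact ⟨w, hw, .inl ⟨h2, h3⟩, h4⟩
  · obtain ⟨w, hw, h2, h3, h4⟩ := hD.blocked v hv u hu h1 ⟨r, hr, h.symm⟩
    exact ⟨w, hw, .inr ⟨h2, h3⟩, Aligned.symm h4⟩

theorem Y_lt {y z : ℝ} (hy : y ∈ F.rows) (hz : z ∈ F.rows) (h : y < z) : Y y < Y z :=
  hD.strictMono hy hz h

/-- If the blockers of the pairs on a family of strands belong to the family, then each strand
remains straight. -/
theorem aligned_of_blockers (K : Set F.Strand) {A B C : ℝ} (hAB : A < B) (hBC : B < C)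
    (hdom : ∀ s ∈ K, A ∈ F.dom s ∧ B ∈ F.dom s ∧ C ∈ F.dom s)
    (hblk : ∀ s ∈ K, ∃ s' ∈ K, Aligned X Y (F.pt s A) (F.pt s' B) (F.pt s C))
    (hord : ∀ s ∈ K, ∀ s' ∈ K, (F.pt s B).1 < (F.pt s' B).1 →
      (F.pt s A).1 ≤ (F.pt s' A).1 ∧ (F.pt s C).1 ≤ (F.pt s' C).1) :
    ∀ s ∈ K, Aligned X Y (F.pt s A) (F.pt s B) (F.pt s C) := by
  choose! w hwK hw using hblk
  -- The blocker of a strand farther right is farther right. Strictness holds because two strands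
  -- that agree at `A` and at `C` also agree at `B`, so one of the two outer inequalities is strict.
  have hmono : ∀ s ∈ K, ∀ s' ∈ K, (F.pt s B).1 < (F.pt s' B).1 →
      (F.pt (w s) B).1 < (F.pt (w s') B).1 := by
    intro s hs s' hs' h
    obtain ⟨d1, d2, d3⟩ := hdom s hs
    obtain ⟨d1', d2', d3'⟩ := hdom s' hs'
    have e2 := (hdom _ (hwK s hs)).2.1
    have e2' := (hdom _ (hwK s' hs')).2.1
    obtain ⟨h1, h2⟩ := hord s hs s' hs' h
    refine (hD.lt_iff hF (pt_mem e2) (pt_mem e2') rfl).1 ?_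
    have hYAB := hD.Y_lt hF (dom_subset_rows _ d1) (dom_subset_rows _ d2) hAB
    have hYBC := hD.Y_lt hF (dom_subset_rows _ d2) (dom_subset_rows _ d3) hBC
    have k1 := hw s hs
    have k2 := hw s' hs'
    simp only [Aligned, pt_snd] at k1 k2
    have g1 := (hD.le_iff hF (pt_mem d1) (pt_mem d1') rfl).2 h1
    have g2 := (hD.le_iff hF (pt_mem d3) (pt_mem d3') rfl).2 h2
    have hstrict : X (F.pt s A) < X (F.pt s' A) ∨ X (F.pt s C) < X (F.pt s' C) := by
      by_contra! hcon
      have e1 := (hD.le_iff hF (pt_mem d1') (pt_mem d1) rfl).1 hcon.1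
      have e3 := (hD.le_iff hF (pt_mem d3') (pt_mem d3) rfl).1 hcon.2
      have p1 := le_antisymm h1 e1
      have p3 := le_antisymm h2 e3
      have hH := hF.H_pos
      have : ((F.pt s B).1 - (F.pt s' B).1) * (C - A) =
          ((F.pt s A).1 - (F.pt s' A).1) * (C - B) + ((F.pt s C).1 - (F.pt s' C).1) * (B - A) := by
        simp only [pt_fst]
        field_simp
        ring
      rw [p1, p3] at this
      nlinarith
    rcases hstrict with h3 | h3 <;> nlinarith
  -- A strictly monotone self-map of a finite chain is the identity. Positions are compared rather
  -- than strands, as several strands may share a point.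
  have hfix : ∀ s ∈ K, (F.pt (w s) B).1 = (F.pt s B).1 := by
    intro s hs
    by_contra hne
    rcases lt_or_gt_of_ne hne with h | h
    · obtain ⟨m, ⟨hm, hm'⟩, hmin⟩ := Set.exists_min_image
        {s ∈ K | (F.pt (w s) B).1 < (F.pt s B).1} (fun s => (F.pt s B).1) (Set.toFinite _)
        ⟨s, hs, h⟩
      exact absurd (hmin (w m) ⟨hwK m hm, hmono _ (hwK m hm) _ hm hm'⟩) (not_le.2 hm')
    · obtain ⟨m, ⟨hm, hm'⟩, hmax⟩ := Set.exists_max_image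
        {s ∈ K | (F.pt s B).1 < (F.pt (w s) B).1} (fun s => (F.pt s B).1) (Set.toFinite _)
        ⟨s, hs, h⟩
      exact absurd (hmax (w m) ⟨hwK m hm, hmono _ hm _ (hwK m hm) hm'⟩) (not_le.2 hm')
  intro s hs
  have := hw s hs
  rwa [show F.pt (w s) B = F.pt s B from Prod.ext (hfix s hs) rfl] at this

/-- A point of a row without segments of `S` lies on a column. -/
theorem exists_col {r : Plane} (hr : r ∈ F.stripPoints)
    (h : r.2 ∉ F.longRows ∨ X r ≤ X (F.colPoint 3 r.2)) : ∃ j, r = F.colPoint j r.2 := by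
  obtain ⟨j | t, hs, he⟩ := hF.exists_strand hr
  · exact ⟨j, he⟩
  · exfalso
    rcases h with h | h
    · exact h hs
    · have hy := longRows_subset_rows hs
      have := (hD.le_iff hF hr (colPoint_mem 3 hy) rfl).1 h
      rw [pt_inr] at he
      have h2 := hF.colPoint_lt_segPoint 3 t hy
      rw [← he] at h2
      linarith

/-- Blockers lie strictly between the rows of the pair, where `B` is the only row. -/
theorem exists_blocker_consecutive {A B C : ℝ} (hAB : A < B) (hBC : B < C)
    (hcon : ∀ z ∈ F.rows, ¬ (A < z ∧ z < B) ∧ ¬ (B < z ∧ z < C)) {s : F.Strand}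
    (hsA : A ∈ F.dom s) (hsB : B ∈ F.dom s) (hsC : C ∈ F.dom s) :
    ∃ r ∈ F.stripPoints, r.2 = B ∧ Aligned X Y (F.pt s A) r (F.pt s C) := by
  obtain ⟨r, hr, h1, h2⟩ := hD.exists_blocker hF (pt_mem hsA) (pt_mem hsC)
    (by simp only [pt_snd]; linarith) (pt_mem hsB) (hF.sbtw_pt s hAB hBC)
  refine ⟨r, hr, ?_, h2⟩
  simp only [pt_snd] at h1
  have h3 := hcon _ (snd_mem_rows hr)
  rcases h1 with h1 | h1
  · by_contra hne
    rcases lt_or_gt_of_ne hne with h | h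
    · exact h3.1 ⟨h1.1, h⟩
    · exact h3.2 ⟨h, h1.2⟩
  · linarith

/-- Columns are straight where their blockers are on columns. -/
theorem col_aligned_of_blockers {A B C : ℝ} (hA : A ∈ F.rows) (hB : B ∈ F.rows) (hC : C ∈ F.rows)
    (hAB : A < B) (hBC : B < C)
    (h : ∀ j, ∃ j', Aligned X Y (F.colPoint j A) (F.colPoint j' B) (F.colPoint j C)) :
    ∀ j, Aligned X Y (F.colPoint j A) (F.colPoint j B) (F.colPoint j C) := by
  intro j
  refine hD.aligned_of_blockers hF (Set.range Sum.inl) hAB hBC ?_ ?_ ?_ (.inl j) ⟨j, rfl⟩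
  · rintro _ ⟨j, rfl⟩; exact ⟨hA, hB, hC⟩
  · rintro _ ⟨j, rfl⟩
    obtain ⟨j', hj'⟩ := h j
    exact ⟨.inl j', ⟨j', rfl⟩, hj'⟩
  · rintro _ ⟨j, rfl⟩ _ ⟨j', rfl⟩ hlt
    have hjj' : j < j' := by
      by_contra! hle
      rcases hle.eq_or_lt with rfl | h1
      · exact lt_irrefl _ hlt
      · exact lt_asymm hlt (hF.colPoint_lt h1 hB)
    exact ⟨(hF.colPoint_lt hjj' hA).le, (hF.colPoint_lt hjj' hC).le⟩

/-- An extension segment carries points of the four columns only, so these contain their own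
blockers. -/
theorem col_aligned_of_short {A B C : ℝ} (hA : A ∈ F.rows) (hB : B ∈ F.shortRows) (hC : C ∈ F.rows)
    (hAB : A < B) (hBC : B < C)
    (hcon : ∀ z ∈ F.rows, ¬ (A < z ∧ z < B) ∧ ¬ (B < z ∧ z < C)) (j : Fin 4) :
    Aligned X Y (F.colPoint j A) (F.colPoint j B) (F.colPoint j C) := by
  have hB' := shortRows_subset_rows hB
  refine hD.col_aligned_of_blockers hF hA hB' hC hAB hBC (fun j => ?_) j
  obtain ⟨r, hr, hrB, hal⟩ := hD.exists_blocker_consecutive hF hAB hBC hcon (s := .inl j)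
    hA hB' hC
  obtain ⟨j', hj'⟩ := hD.exists_col hF hr (.inl fun h => hF.disjoint_long_short h (hrB ▸ hB))
  rw [hj', hrB] at hal
  exact ⟨j', hal⟩

/-- If many rows without segments of `S` follow row `B`, on which the line of `s_3` is known, then
the point of `s_3` on the row on the other side of `B` is not to the right of this line. -/
theorem col_three_le_of_run {A B : ℝ} (hA : A ∈ F.rows) (hB : B ∈ F.rows) {R : Finset ℝ}
    (hR : ∀ z ∈ R, z ∈ F.shortRows) (hAB : A ≠ B)
    (hside : ∀ z ∈ R, (A < B ∧ B < z) ∨ (z < B ∧ B < A))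
    (hbetween : ∀ z ∈ R, ∀ x ∈ F.rows, (A < x ∧ x < z) ∨ (z < x ∧ x < A) → x = B ∨ x ∈ R)
    (hcard : F.n + 4 < R.card) {α β : ℝ}
    (hline : ∀ z ∈ R, X (F.colPoint 3 z) = α + β * Y z) :
    X (F.colPoint 3 A) ≤ α + β * Y A := by
  by_contra! hgt
  -- The deviation from the line is an affine function, positive at `A` and zero at `z`, hence
  -- positive at a blocker. In a row of `R` no point lies to the right of the line, so the blocker
  -- is in row `B`.
  have key : ∀ z ∈ R, ∃ s : F.Strand, (X (F.pt s B) - (α + β * Y B)) * (Y z - Y A) =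
      (X (F.colPoint 3 A) - (α + β * Y A)) * (Y z - Y B) := by
    intro z hz
    have hzr := shortRows_subset_rows (hR z hz)
    have hbt : Sbtw ℝ (F.colPoint 3 A) (F.colPoint 3 B) (F.colPoint 3 z) := by
      rcases hside z hz with h | h
      · exact hF.sbtw_pt (.inl 3) h.1 h.2
      · exact (hF.sbtw_pt (.inl 3) h.1 h.2).symm
    obtain ⟨r, hr, h1, h2⟩ := hD.exists_blocker hF (colPoint_mem 3 hA) (colPoint_mem 3 hzr)
      (by simp only [colPoint_snd]; rcases hside z hz with h | h <;> intro e <;> linarith)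
      (colPoint_mem 3 hB) hbt
    simp only [colPoint_snd] at h1
    have hrr := snd_mem_rows hr
    simp only [Aligned, colPoint_snd, hline z hz] at h2
    have h3 : (X r - (α + β * Y r.2)) * (Y z - Y A) =
        (X (F.colPoint 3 A) - (α + β * Y A)) * (Y z - Y r.2) := by linear_combination h2
    have hfpos : 0 < X r - (α + β * Y r.2) := by
      rcases h1 with h | h
      · have y1 := hD.Y_lt hF hA hrr h.1
        have y2 := hD.Y_lt hF hrr hzr h.2
        refine pos_of_mul_pos_left (b := Y z - Y A) ?_ (by linarith)
        rw [h3]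
        exact mul_pos (by linarith) (by linarith)
      · have y1 := hD.Y_lt hF hrr hA h.2
        have y2 := hD.Y_lt hF hzr hrr h.1
        refine pos_of_mul_pos_left (b := Y A - Y z) ?_ (by linarith)
        have : (X r - (α + β * Y r.2)) * (Y A - Y z) =
          (X (F.colPoint 3 A) - (α + β * Y A)) * (Y r.2 - Y z) := by linear_combination -h3
        rw [this]
        exact mul_pos (by linarith) (by linarith)
    rcases hbetween z hz _ hrr h1 with h | h
    · obtain ⟨s, hs, he⟩ := hF.exists_strand hr
      rw [h] at he h3
      rw [he] at h3
      exact ⟨s, h3⟩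
    · exfalso
      obtain ⟨j, hj⟩ := hD.exists_col hF hr (.inl fun h' => hF.disjoint_long_short h' (hR _ h))
      have : X r ≤ X (F.colPoint 3 r.2) := by
        refine (hD.le_iff hF hr (colPoint_mem 3 hrr) rfl).2 ?_
        have e : r.1 = (F.colPoint j r.2).1 := congrArg Prod.fst hj
        rw [e]
        rcases (show j ≤ 3 from Fin.le_last j).eq_or_lt with rfl | h'
        · exact le_rfl
        · exact (hF.colPoint_lt h' hrr).le
      rw [hline _ h] at this
      linarith
  choose! w hw using key
  -- There are only `n + 4` strands, so two rows share a blocker. The line from the point at `A`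
  -- through this blocker would meet the line of `s_3` twice.
  obtain ⟨z, hz, z', hz', hne, he⟩ := Finset.exists_ne_map_eq_of_card_lt_of_maps_to
    (s := R) (t := Finset.univ) (f := w) (by
      rw [Finset.card_univ, Fintype.card_sum, Fintype.card_fin, Fintype.card_fin]; omega)
    (fun _ _ => Finset.mem_coe.2 (Finset.mem_univ _))
  have k1 := hw z hz
  have k2 := hw z' hz'
  rw [← he] at k2
  have hYne : Y z - Y z' ≠ 0 := by
    have h1 := shortRows_subset_rows (hR z hz)
    have h2 := shortRows_subset_rows (hR z' hz')
    rcases lt_or_gt_of_ne hne with h | h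
    · have := hD.Y_lt hF h1 h2 h; linarith
    · have := hD.Y_lt hF h2 h1 h; linarith
  have hYAB : Y A - Y B ≠ 0 := by
    rcases lt_or_gt_of_ne hAB with h | h
    · have := hD.Y_lt hF hA hB h; linarith
    · have := hD.Y_lt hF hB hA h; linarith
  have e1 : X (F.pt (w z) B) - (α + β * Y B) = X (F.colPoint 3 A) - (α + β * Y A) := by
    apply mul_right_cancel₀ hYne
    linear_combination k1 - k2
  rw [e1] at k1
  have : (X (F.colPoint 3 A) - (α + β * Y A)) * (Y A - Y B) = 0 := by linear_combination -k1
  rcases mul_eq_zero.1 this with h | h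
  · linarith
  · exact hYAB h

end Drawing

/-! ### Runs of extension segments -/

namespace IsGeneralizedFan

variable (hF : F.IsGeneralizedFan)
include hF

theorem height_lt_iff (β : Fin (F.k + 2)) {i j : ℤ} :
    F.base β + i * F.ε β < F.base β + j * F.ε β ↔ i < j := by
  rw [add_lt_add_iff_left, mul_lt_mul_iff_left₀ (hF.ε_pos β)]
  exact Int.cast_lt

theorem height_le_iff (β : Fin (F.k + 2)) {i j : ℤ} :
    F.base β + i * F.ε β ≤ F.base β + j * F.ε β ↔ i ≤ j := by
  rw [← not_lt, hF.height_lt_iff, not_lt]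

/-- For `n ≥ 1` already `25 n` exceeds `n + 4`; the fourth power is needed only in `no_three_pairs`.
-/
theorem card_of_progression (hn : 0 < F.n) (β : Fin (F.k + 2)) (m : ℤ) {R : Finset ℝ}
    (h : ∀ i : ℤ, m < i → i ≤ m + (5 * F.n) ^ 4 → F.base β + i * F.ε β ∈ R) :
    F.n + 4 < R.card := by
  have h1 : (Finset.Ioc m (m + (5 * F.n) ^ 4)).card ≤ R.card := by
    refine Finset.card_le_card_of_injOn (fun i : ℤ => F.base β + i * F.ε β) (fun i hi => ?_) ?_
    · have := Finset.mem_Ioc.1 hi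
      exact h i this.1 this.2
    · intro i _ j _ hij
      exact le_antisymm ((hF.height_le_iff β).1 hij.le) ((hF.height_le_iff β).1 hij.ge)
  rw [Int.card_Ioc] at h1
  have h2 : (m + (5 * (F.n : ℤ)) ^ 4 - m).toNat = (5 * F.n) ^ 4 := by
    rw [add_sub_cancel_left]
    have : ((5 * F.n : ℕ) : ℤ) ^ 4 = (((5 * F.n) ^ 4 : ℕ) : ℤ) := by push_cast; ring
    rw [show (5 * (F.n : ℤ)) = ((5 * F.n : ℕ) : ℤ) by push_cast; ring, this, Int.toNat_natCast]
  rw [h2] at h1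
  have h3 : 5 * F.n ≤ (5 * F.n) ^ 4 := Nat.le_self_pow (by norm_num) _
  have h4 : 5 * F.n * 5 ≤ (5 * F.n) ^ 4 := by
    calc 5 * F.n * 5 ≤ 5 * F.n * (5 * F.n) ^ 3 := by
          refine Nat.mul_le_mul_left _ ?_
          calc 5 ≤ 5 * F.n := by omega
            _ ≤ (5 * F.n) ^ 3 := Nat.le_self_pow (by norm_num) _
      _ = (5 * F.n) ^ 4 := by ring
  omega

/-- `R` collects all rows above `B` up to the end of the block of extension segments containing `C`:
the upper extension of the bundle of `B`, or the lower extension of a bundle above `B`. No ray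
interrupts it. -/
theorem exists_run_above {B C : ℝ} (hB : B ∈ F.longRows) (hC : C ∈ F.shortRows) (hBC : B < C)
    (hcon : ∀ z ∈ F.rows, ¬ (B < z ∧ z < C)) :
    ∃ R : Finset ℝ, C ∈ R ∧ (∀ z ∈ R, z ∈ F.shortRows ∧ B < z) ∧
      (∀ z ∈ R, ∀ x ∈ F.rows, B < x → x < z → x ∈ R) ∧ F.n + 4 < R.card := by
  obtain ⟨γ, hγ⟩ := Set.mem_iUnion.1 hC
  have hn := hF.n_pos_of_mem (.inr hγ)
  have hR : ∀ T, C ≤ T → (∀ z ∈ F.longRows, B < z → z ≤ T → False) →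
      ∃ R : Finset ℝ, C ∈ R ∧ (∀ z ∈ R, z ∈ F.shortRows ∧ B < z) ∧
      (∀ z ∈ R, ∀ x ∈ F.rows, B < x → x < z → x ∈ R) ∧ ∀ z ∈ F.rows, B < z → z ≤ T → z ∈ R := by
    intro T hCT hT
    classical
    have hmem : ∀ {z}, z ∈ (rows_finite (F := F)).toFinset.filter (fun z => B < z ∧ z ≤ T) ↔
        z ∈ F.rows ∧ B < z ∧ z ≤ T := by simp
    refine ⟨rows_finite.toFinset.filter fun z => B < z ∧ z ≤ T, hmem.2
      ⟨shortRows_subset_rows hC, hBC, hCT⟩, fun z hz => ?_, fun z hz x hx h1 h2 => ?_,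
      fun z hz h1 h2 => hmem.2 ⟨hz, h1, h2⟩⟩
    · obtain ⟨h1, h2, h3⟩ := hmem.1 hz
      rcases h1 with h1 | h1
      · exact (hT z h1 h2 h3).elim
      · exact ⟨h1, h2⟩
    · obtain ⟨-, -, h3⟩ := hmem.1 hz
      exact hmem.2 ⟨hx, h1, h2.le.trans h3⟩
  have hN : (0 : ℤ) < (5 * F.n) ^ 4 := by positivity
  have hγ0 := hγ
  obtain ⟨i, hi | hi, rfl⟩ := hγ0
  · have hprev : F.base γ + ((i - 1 : ℤ) : ℝ) * F.ε γ ∈ F.extended γ := by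
      by_cases h : i - 1 ≤ 5 * F.n
      · exact .inl ⟨i - 1, by omega, h, rfl⟩
      · exact .inr ⟨i - 1, .inl ⟨hi.1, by omega, by omega⟩, rfl⟩
    have hprevrow : F.base γ + ((i - 1 : ℤ) : ℝ) * F.ε γ ∈ F.rows := hprev.elim
      (fun h => longRows_subset_rows (bundle_subset_longRows _ h))
      fun h => shortRows_subset_rows (extension_subset_shortRows _ h)
    have hle : F.base γ + ((i - 1 : ℤ) : ℝ) * F.ε γ ≤ B := by
      by_contra! h
      exact hcon _ hprevrow ⟨h, (hF.height_lt_iff γ).2 (by omega)⟩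
    have hBγ : B ∈ F.bundle γ := by
      rcases hF.longRows_trichotomy hB γ with h | h | h
      · exact h
      · exact absurd (h _ (.inr hγ)) (not_lt.2 hBC.le)
      · exact absurd (h _ hprev) (not_lt.2 hle)
    obtain ⟨j, hj1, hj2, rfl⟩ := hBγ
    have hT : F.base γ + ((5 * F.n + (5 * F.n) ^ 4 : ℤ) : ℝ) * F.ε γ ∈ F.extended γ :=
      .inr ⟨_, .inl ⟨hi.1, by omega, le_rfl⟩, rfl⟩
    obtain ⟨R, h1, h2, h3, h4⟩ := hR _ ((hF.height_le_iff γ).2 hi.2.2) fun z hz hBz hzT => by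
      rcases hF.longRows_trichotomy hz γ with ⟨l, hl1, hl2, rfl⟩ | h | h
      · exact hcon _ (longRows_subset_rows hz) ⟨hBz, (hF.height_lt_iff γ).2 (by omega)⟩
      · exact absurd (h _ hT) (not_lt.2 hzT)
      · exact absurd (h _ (.inl ⟨j, hj1, hj2, rfl⟩)) (not_lt.2 hBz.le)
    refine ⟨R, h1, h2, h3, hF.card_of_progression hn γ (5 * F.n) fun l hl1 hl2 => ?_⟩
    exact h4 _ (shortRows_subset_rows (extension_subset_shortRows _
      ⟨l, .inl ⟨hi.1, hl1, hl2⟩, rfl⟩)) ((hF.height_lt_iff γ).2 (by omega))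
      ((hF.height_le_iff γ).2 hl2)
  · have hBγ : ∀ w ∈ F.extended γ, B < w := by
      rcases hF.longRows_trichotomy hB γ with ⟨j, hj1, hj2, rfl⟩ | h | h
      · have := (hF.height_lt_iff γ).1 hBC
        omega
      · exact absurd (h _ (.inr hγ)) (not_lt.2 hBC.le)
      · exact h
    have hT : F.base γ + ((0 : ℤ) : ℝ) * F.ε γ ∈ F.extended γ :=
      .inr ⟨0, .inr ⟨hi.1, by omega, le_rfl⟩, rfl⟩
    obtain ⟨R, h1, h2, h3, h4⟩ := hR _ ((hF.height_le_iff γ).2 hi.2.2) fun z hz hBz hzT => by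
      rcases hF.longRows_trichotomy hz γ with ⟨l, hl1, hl2, rfl⟩ | h | h
      · have := (hF.height_le_iff γ).1 hzT
        omega
      · exact absurd (h _ hT) (not_lt.2 hzT)
      · exact hcon _ (longRows_subset_rows hz) ⟨hBz, h _ (.inr hγ)⟩
    refine ⟨R, h1, h2, h3, hF.card_of_progression hn γ (-(5 * F.n) ^ 4) fun l hl1 hl2 => ?_⟩
    have hmem : F.base γ + (l : ℝ) * F.ε γ ∈ F.extension γ :=
      ⟨l, .inr ⟨hi.1, hl1, by omega⟩, rfl⟩
    exact h4 _ (shortRows_subset_rows (extension_subset_shortRows _ hmem)) (hBγ _ (.inr hmem))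
      ((hF.height_le_iff γ).2 (by omega))

/-- The mirror image of `exists_run_above`. -/
theorem exists_run_below {A B : ℝ} (hB : B ∈ F.longRows) (hA : A ∈ F.shortRows) (hAB : A < B)
    (hcon : ∀ z ∈ F.rows, ¬ (A < z ∧ z < B)) :
    ∃ R : Finset ℝ, A ∈ R ∧ (∀ z ∈ R, z ∈ F.shortRows ∧ z < B) ∧
      (∀ z ∈ R, ∀ x ∈ F.rows, x < B → z < x → x ∈ R) ∧ F.n + 4 < R.card := by
  obtain ⟨γ, hγ⟩ := Set.mem_iUnion.1 hA
  have hn := hF.n_pos_of_mem (.inr hγ)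
  have hR : ∀ T, T ≤ A → (∀ z ∈ F.longRows, z < B → T ≤ z → False) →
      ∃ R : Finset ℝ, A ∈ R ∧ (∀ z ∈ R, z ∈ F.shortRows ∧ z < B) ∧
      (∀ z ∈ R, ∀ x ∈ F.rows, x < B → z < x → x ∈ R) ∧ ∀ z ∈ F.rows, z < B → T ≤ z → z ∈ R := by
    intro T hTA hT
    classical
    have hmem : ∀ {z}, z ∈ (rows_finite (F := F)).toFinset.filter (fun z => z < B ∧ T ≤ z) ↔
        z ∈ F.rows ∧ z < B ∧ T ≤ z := by simp
    refine ⟨rows_finite.toFinset.filter fun z => z < B ∧ T ≤ z, hmem.2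
      ⟨shortRows_subset_rows hA, hAB, hTA⟩, fun z hz => ?_, fun z hz x hx h1 h2 => ?_,
      fun z hz h1 h2 => hmem.2 ⟨hz, h1, h2⟩⟩
    · obtain ⟨h1, h2, h3⟩ := hmem.1 hz
      rcases h1 with h1 | h1
      · exact (hT z h1 h2 h3).elim
      · exact ⟨h1, h2⟩
    · obtain ⟨-, -, h3⟩ := hmem.1 hz
      exact hmem.2 ⟨hx, h1, h3.trans h2.le⟩
  have hN : (0 : ℤ) < (5 * F.n) ^ 4 := by positivity
  have hγ0 := hγ
  obtain ⟨i, hi | hi, rfl⟩ := hγ0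
  · have hBγ : ∀ w ∈ F.extended γ, w < B := by
      rcases hF.longRows_trichotomy hB γ with ⟨j, hj1, hj2, rfl⟩ | h | h
      · have := (hF.height_lt_iff γ).1 hAB
        omega
      · exact h
      · exact absurd (h _ (.inr hγ)) (not_lt.2 hAB.le)
    have hT : F.base γ + ((5 * F.n + 1 : ℤ) : ℝ) * F.ε γ ∈ F.extended γ :=
      .inr ⟨_, .inl ⟨hi.1, by omega, by omega⟩, rfl⟩
    obtain ⟨R, h1, h2, h3, h4⟩ := hR (F.base γ + ((5 * F.n + 1 : ℤ) : ℝ) * F.ε γ)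
        ((hF.height_le_iff γ).2 (by omega)) fun z hz hzB hTz => by
      rcases hF.longRows_trichotomy hz γ with ⟨l, hl1, hl2, rfl⟩ | h | h
      · have := (hF.height_le_iff γ).1 hTz
        omega
      · exact hcon _ (longRows_subset_rows hz) ⟨h _ (.inr hγ), hzB⟩
      · exact absurd (h _ hT) (not_lt.2 hTz)
    refine ⟨R, h1, h2, h3, hF.card_of_progression hn γ (5 * F.n) fun l hl1 hl2 => ?_⟩
    have hmem : F.base γ + (l : ℝ) * F.ε γ ∈ F.extension γ :=
      ⟨l, .inl ⟨hi.1, hl1, hl2⟩, rfl⟩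
    exact h4 _ (shortRows_subset_rows (extension_subset_shortRows _ hmem)) (hBγ _ (.inr hmem))
      ((hF.height_le_iff γ).2 (by omega))
  · have hnext : F.base γ + ((i + 1 : ℤ) : ℝ) * F.ε γ ∈ F.extended γ := by
      by_cases h : i + 1 ≤ 0
      · exact .inr ⟨i + 1, .inr ⟨hi.1, by omega, by omega⟩, rfl⟩
      · exact .inl ⟨i + 1, by omega, by omega, rfl⟩
    have hnextrow : F.base γ + ((i + 1 : ℤ) : ℝ) * F.ε γ ∈ F.rows := hnext.elim
      (fun h => longRows_subset_rows (bundle_subset_longRows _ h))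
      fun h => shortRows_subset_rows (extension_subset_shortRows _ h)
    have hle : B ≤ F.base γ + ((i + 1 : ℤ) : ℝ) * F.ε γ := by
      by_contra! h
      exact hcon _ hnextrow ⟨(hF.height_lt_iff γ).2 (by omega), h⟩
    have hBγ : B ∈ F.bundle γ := by
      rcases hF.longRows_trichotomy hB γ with h | h | h
      · exact h
      · exact absurd (h _ hnext) (not_lt.2 hle)
      · exact absurd (h _ (.inr hγ)) (not_lt.2 hAB.le)
    obtain ⟨j, hj1, hj2, rfl⟩ := hBγ
    have hT : F.base γ + ((-(5 * F.n) ^ 4 + 1 : ℤ) : ℝ) * F.ε γ ∈ F.extended γ :=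
      .inr ⟨_, .inr ⟨hi.1, by omega, by omega⟩, rfl⟩
    obtain ⟨R, h1, h2, h3, h4⟩ := hR (F.base γ + ((-(5 * F.n) ^ 4 + 1 : ℤ) : ℝ) * F.ε γ)
        ((hF.height_le_iff γ).2 (by omega)) fun z hz hzB hTz => by
      rcases hF.longRows_trichotomy hz γ with ⟨l, hl1, hl2, rfl⟩ | h | h
      · exact hcon _ (longRows_subset_rows hz) ⟨(hF.height_lt_iff γ).2 (by omega), hzB⟩
      · exact absurd (h _ (.inl ⟨j, hj1, hj2, rfl⟩)) (not_lt.2 hzB.le)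
      · exact absurd (h _ hT) (not_lt.2 hTz)
    refine ⟨R, h1, h2, h3, hF.card_of_progression hn γ (-(5 * F.n) ^ 4) fun l hl1 hl2 => ?_⟩
    have hmem : F.base γ + (l : ℝ) * F.ε γ ∈ F.extension γ :=
      ⟨l, .inr ⟨hi.1, hl1, by omega⟩, rfl⟩
    exact h4 _ (shortRows_subset_rows (extension_subset_shortRows _ hmem))
      ((hF.height_lt_iff γ).2 (by omega)) ((hF.height_le_iff γ).2 (by omega))

/-- Between consecutive rows that both meet the segments of `S` there is no crossing. -/
theorem not_crossing_of_consecutive {A B y : ℝ} (hA : A ∈ F.longRows) (hB : B ∈ F.longRows)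
    (hcon : ∀ z ∈ F.rows, ¬ (A < z ∧ z < B)) (hAy : A < y) (hyB : y < B) : y ∉ F.crossings := by
  intro hy
  have hn := hF.n_pos_of_crossing hy
  obtain ⟨β, rfl, rfl⟩ := hF.rows_around_crossing hy hA hB hAy hyB fun z hz =>
    hcon z (longRows_subset_rows hz)
  have hN : (0 : ℤ) < (5 * F.n) ^ 4 := by positivity
  -- The lower of the two bundles around a crossing is not the last one, so an extension segment
  -- follows its top ray.
  have hmem : F.base β.castSucc + ((5 * F.n + 1 : ℤ) : ℝ) * F.ε β.castSucc ∈
      F.extension β.castSucc :=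
    ⟨_, .inl ⟨(Fin.castSucc_lt_last β).ne, by omega, by omega⟩, rfl⟩
  refine hcon _ (shortRows_subset_rows (extension_subset_shortRows _ hmem))
    ⟨(hF.height_lt_iff _).2 (by omega), ?_⟩
  exact hF.ordered _ _ (Fin.castSucc_lt_succ) _ (.inr hmem) _
    (.inl ⟨1, le_rfl, by omega, rfl⟩)

/-- The order of the strands is weakly preserved where there is no crossing. -/
theorem pt_le_of_no_crossing {s s' : F.Strand} {y z : ℝ} (hy : y ∈ F.rows) (hz : z ∈ F.rows)
    (h : ∀ x ∈ F.crossings, ¬ (y < x ∧ x < z) ∧ ¬ (z < x ∧ x < y))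
    (hlt : (F.pt s y).1 < (F.pt s' y).1) : (F.pt s z).1 ≤ (F.pt s' z).1 := by
  by_contra! hgt
  obtain ⟨x, hx, hx'⟩ := hF.exists_crossing (hF.rows_mem_Icc hy) (hF.rows_mem_Icc hz) hlt hgt
  exact hx'.elim (h x hx).1 (h x hx).2

end IsGeneralizedFan

/-! ### Straightness of the columns -/

namespace Drawing

variable (hF : F.IsGeneralizedFan) {X : Plane → ℝ} {Y : ℝ → ℝ} (hD : F.Drawing X Y)
include hF hD

/-- A bend could occur only at an interior row of the run, so only these have to be extension
segments; an end row may be a ray. -/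
theorem exists_line_of_run {R : Finset ℝ} (hR : ∀ z ∈ R, z ∈ F.rows)
    (hshort : ∀ a ∈ R, ∀ b ∈ R, ∀ c ∈ R, a < b → b < c → b ∈ F.shortRows)
    (hconv : ∀ a ∈ R, ∀ c ∈ R, ∀ x ∈ F.rows, a < x → x < c → x ∈ R) :
    ∃ α β : ℝ, ∀ z ∈ R, X (F.colPoint 3 z) = α + β * Y z := by
  refine exists_line_of_consecutive R (X := fun z => X (F.colPoint 3 z))
    (hD.strictMono.mono fun z hz => hR z hz) fun a ha b hb c hc hab hbc hcon => ?_
  refine hD.col_aligned_of_short hF (hR a ha) (hshort a ha b hb c hc hab hbc) (hR c hc) hab hbc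
    (fun z hz => ⟨fun h => ?_, fun h => ?_⟩) 3
  · exact (hcon z (hconv a ha b hb z hz h.1 h.2)).1 h
  · exact (hcon z (hconv b hb c hc z hz h.1 h.2)).2 h

/-- If `s_3` bends at most to the left at row `B`, all columns are straight there. -/
theorem col_aligned_of_three {A B C : ℝ} (hA : A ∈ F.rows) (hB : B ∈ F.rows) (hC : C ∈ F.rows)
    (hAB : A < B) (hBC : B < C)
    (hcon : ∀ z ∈ F.rows, ¬ (A < z ∧ z < B) ∧ ¬ (B < z ∧ z < C)) {α β : ℝ}
    (h1 : X (F.colPoint 3 A) ≤ α + β * Y A) (h2 : X (F.colPoint 3 B) = α + β * Y B)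
    (h3 : X (F.colPoint 3 C) ≤ α + β * Y C) (j : Fin 4) :
    Aligned X Y (F.colPoint j A) (F.colPoint j B) (F.colPoint j C) := by
  refine hD.col_aligned_of_blockers hF hA hB hC hAB hBC (fun j => ?_) j
  obtain ⟨r, hr, hrB, hal⟩ := hD.exists_blocker_consecutive hF hAB hBC hcon (s := .inl j)
    hA hB hC
  have hle : ∀ {y}, y ∈ F.rows → X (F.colPoint j y) ≤ X (F.colPoint 3 y) := fun {y} hy => by
    rcases (show j ≤ 3 from Fin.le_last j).eq_or_lt with rfl | h
    · exact le_rfl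
    · exact (hD.lt _ (colPoint_mem j hy) _ (colPoint_mem 3 hy) rfl (hF.colPoint_lt h hy)).le
  have y1 := hD.Y_lt hF hA hB hAB
  have y2 := hD.Y_lt hF hB hC hBC
  have k1 := (hle hA).trans h1
  have k3 := (hle hC).trans h3
  -- Both ends of the pair are on the line of `s_3` or to its left, so the blocker is not to the
  -- right of `s_3` in row `B` and belongs to a column.
  obtain ⟨j', hj'⟩ := hD.exists_col hF hr (.inr (by
    rw [hrB, h2]
    simp only [Aligned, pt_inl, colPoint_snd, hrB] at hal
    have e : (X r - (α + β * Y B)) * (Y C - Y A) =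
        (X (F.colPoint j A) - (α + β * Y A)) * (Y C - Y B) +
        (X (F.colPoint j C) - (α + β * Y C)) * (Y B - Y A) := by linear_combination hal
    by_contra! hgt
    have := mul_pos (sub_pos.2 hgt) (show 0 < Y C - Y A by linarith)
    have := mul_nonneg (sub_nonneg.2 k1) (show 0 ≤ Y C - Y B by linarith)
    have := mul_nonneg (sub_nonneg.2 k3) (show 0 ≤ Y B - Y A by linarith)
    nlinarith))
  rw [hj', hrB] at hal
  exact ⟨j', hal⟩

/-- The columns are straight at each row. -/
theorem col_aligned {A B C : ℝ} (hA : A ∈ F.rows) (hB : B ∈ F.rows) (hC : C ∈ F.rows)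
    (hAB : A < B) (hBC : B < C)
    (hcon : ∀ z ∈ F.rows, ¬ (A < z ∧ z < B) ∧ ¬ (B < z ∧ z < C)) (j : Fin 4) :
    Aligned X Y (F.colPoint j A) (F.colPoint j B) (F.colPoint j C) := by
  rcases hB with hBl | hBs
  swap
  · exact hD.col_aligned_of_short hF hA hBs hC hAB hBC hcon j
  have hB := longRows_subset_rows hBl
  rcases hC with hCl | hCs
  · rcases hA with hAl | hAs
    · have hdom : ∀ {y}, y ∈ F.longRows → ∀ s : F.Strand, y ∈ F.dom s := by
        rintro y hy (j | t)
        · exact longRows_subset_rows hy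
        · exact hy
      -- Three consecutive rows that are all rays: no crossing lies between neighbours, so all
      -- strands together keep their weak order.
      refine hD.aligned_of_blockers hF Set.univ hAB hBC
        (fun s _ => ⟨hdom hAl s, hdom hBl s, hdom hCl s⟩) (fun s _ => ?_)
        (fun s _ s' _ hlt => ⟨?_, ?_⟩) (.inl j) trivial
      · obtain ⟨r, hr, hrB, hal⟩ := hD.exists_blocker_consecutive hF hAB hBC hcon
          (hdom hAl s) (hdom hBl s) (hdom hCl s)
        obtain ⟨s', -, hs'⟩ := hF.exists_strand hr
        rw [hs', hrB] at hal
        exact ⟨s', trivial, hal⟩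
      · refine hF.pt_le_of_no_crossing hB (longRows_subset_rows hAl) (fun x hx =>
          ⟨fun h => by linarith [h.1, h.2], fun h => ?_⟩) hlt
        exact hF.not_crossing_of_consecutive hAl hBl (fun z hz => (hcon z hz).1) h.1 h.2 hx
      · refine hF.pt_le_of_no_crossing hB (longRows_subset_rows hCl) (fun x hx =>
          ⟨fun h => ?_, fun h => by linarith [h.1, h.2]⟩) hlt
        exact hF.not_crossing_of_consecutive hBl hCl (fun z hz => (hcon z hz).2) h.1 h.2 hx
    · have hA := shortRows_subset_rows hAs
      have hC := longRows_subset_rows hCl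
      -- `A` is an extension segment: `s_3` is straight along the run below, up to and including
      -- `B`, and `col_three_le_of_run` bounds it at `C`. The case of `C` is symmetric.
      obtain ⟨R, hAR, hR1, hR2, hcard⟩ := hF.exists_run_below hBl hAs hAB fun z hz => (hcon z hz).1
      obtain ⟨α, β, hline⟩ := hD.exists_line_of_run hF (R := insert B R) (fun z hz => by
          rcases Finset.mem_insert.1 hz with rfl | hz
          · exact hB
          · exact shortRows_subset_rows (hR1 z hz).1) (fun a ha b hb c hc hab hbc => by
          rcases Finset.mem_insert.1 hb with rfl | hb
          · rcases Finset.mem_insert.1 hc with rfl | hc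
            · exact absurd hbc (lt_irrefl _)
            · exact absurd hbc (not_lt.2 (hR1 c hc).2.le)
          · exact (hR1 b hb).1) (fun a ha c hc x hx hax hxc => by
          have hxB : x < B := by
            rcases Finset.mem_insert.1 hc with rfl | hc
            · exact hxc
            · exact hxc.trans (hR1 c hc).2
          rcases Finset.mem_insert.1 ha with rfl | ha
          · exact absurd hax (not_lt.2 hxB.le)
          · exact Finset.mem_insert_of_mem (hR2 a ha x hx hxB hax))
      refine hD.col_aligned_of_three hF hA hB hC hAB hBC hcon
        (hline A (Finset.mem_insert_of_mem hAR)).le (hline B (Finset.mem_insert_self _ _)) ?_ j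
      refine hD.col_three_le_of_run hF hC hB (fun z hz => (hR1 z hz).1) hBC.ne'
        (fun z hz => .inr ⟨(hR1 z hz).2, hBC⟩) (fun z hz x hx h => ?_) hcard
        (fun z hz => hline z (Finset.mem_insert_of_mem hz))
      have hzB := (hR1 z hz).2
      rcases h with h | h
      · linarith [h.1, h.2]
      · rcases lt_trichotomy x B with h' | h' | h'
        · exact .inr (hR2 z hz x hx h' h.1)
        · exact .inl h'
        · exact absurd ⟨h', h.2⟩ (hcon x hx).2
  · have hC := shortRows_subset_rows hCs
    obtain ⟨R, hCR, hR1, hR2, hcard⟩ := hF.exists_run_above hBl hCs hBC fun z hz => (hcon z hz).2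
    obtain ⟨α, β, hline⟩ := hD.exists_line_of_run hF (R := insert B R) (fun z hz => by
        rcases Finset.mem_insert.1 hz with rfl | hz
        · exact hB
        · exact shortRows_subset_rows (hR1 z hz).1) (fun a ha b hb c hc hab hbc => by
        rcases Finset.mem_insert.1 hb with rfl | hb
        · rcases Finset.mem_insert.1 ha with rfl | ha
          · exact absurd hab (lt_irrefl _)
          · exact absurd hab (not_lt.2 (hR1 a ha).2.le)
        · exact (hR1 b hb).1) (fun a ha c hc x hx hax hxc => by
        have hxB : B < x := by
          rcases Finset.mem_insert.1 ha with rfl | ha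
          · exact hax
          · exact (hR1 a ha).2.trans hax
        rcases Finset.mem_insert.1 hc with rfl | hc
        · exact absurd hxc (not_lt.2 hxB.le)
        · exact Finset.mem_insert_of_mem (hR2 c hc x hx hxB hxc))
    refine hD.col_aligned_of_three hF hA hB hC hAB hBC hcon ?_
      (hline B (Finset.mem_insert_self _ _)) (hline C (Finset.mem_insert_of_mem hCR)).le j
    refine hD.col_three_le_of_run hF hA hB (fun z hz => (hR1 z hz).1) hAB.ne
      (fun z hz => .inl ⟨hAB, (hR1 z hz).2⟩) (fun z hz x hx h => ?_) hcard
      (fun z hz => hline z (Finset.mem_insert_of_mem hz))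
    have hzB := (hR1 z hz).2
    rcases h with h | h
    · rcases lt_trichotomy x B with h' | h' | h'
      · exact absurd ⟨h.1, h'⟩ (hcon x hx).1
      · exact .inl h'
      · exact .inr (hR2 z hz x hx h' h.2)
    · linarith [h.1, h.2]

/-- The columns are straight. -/
theorem col_line (j : Fin 4) : ∃ α β : ℝ, ∀ y ∈ F.rows, X (F.colPoint j y) = α + β * Y y := by
  have hmem : ∀ {y}, y ∈ (rows_finite (F := F)).toFinset ↔ y ∈ F.rows := by simp
  obtain ⟨α, β, h⟩ := exists_line_of_consecutive (rows_finite (F := F)).toFinset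
    (X := fun z => X (F.colPoint j z)) (Y := Y) (hD.strictMono.mono fun z hz => by simpa using hz)
    fun a ha b hb c hc hab hbc hcon => hD.col_aligned hF (hmem.1 ha) (hmem.1 hb) (hmem.1 hc)
      hab hbc (fun z hz => hcon z (hmem.2 hz)) j
  exact ⟨α, β, fun y hy => h y (hmem.2 hy)⟩

end Drawing

end FanData

/-! ### The arithmetic obstruction -/

/-- Three pairs of small integers cannot be in perspective from a far point. -/
theorem no_three_pairs {M : ℤ} (hM : 5 ≤ M) {h l : ℝ} (hh : (M : ℝ) ^ 4 - 1 < h) (hl : l ≠ 0)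
    {μ k : ℝ} {j₁ j₂ j₃ g₁ g₂ g₃ : ℤ} (h12 : j₁ ≠ j₂) (h13 : j₁ ≠ j₃) (h23 : j₂ ≠ j₃)
    (hg₁ : 1 ≤ g₁) (hg₂ : 1 ≤ g₂) (hg₃ : 1 ≤ g₃) (hj₁ : g₁ < j₁) (hj₂ : g₂ < j₂) (hj₃ : g₃ < j₃)
    (hM₁ : j₁ ≤ M) (hM₂ : j₂ ≤ M) (hM₃ : j₃ ≤ M)
    (e₁ : μ * (h + j₁) - l * (h + g₁) + k * (h + g₁) * (h + j₁) = 0)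
    (e₂ : μ * (h + j₂) - l * (h + g₂) + k * (h + g₂) * (h + j₂) = 0)
    (e₃ : μ * (h + j₃) - l * (h + g₃) + k * (h + g₃) * (h + j₃) = 0) : False := by
  have hM5 : (5 : ℝ) ≤ M := by exact_mod_cast hM
  have hM3 : (125 : ℝ) ≤ (M : ℝ) ^ 3 := by
    have := pow_le_pow_left₀ (by norm_num) hM5 3
    linarith
  have hM4 : 5 * (M : ℝ) ^ 3 ≤ (M : ℝ) ^ 4 := by
    rw [pow_succ _ 3]; nlinarith
  have hM2 : (M : ℝ) ^ 2 ≤ (M : ℝ) ^ 3 := pow_le_pow_right₀ (by linarith) (by norm_num)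
  have hpos : ∀ {x : ℤ}, 1 ≤ x → 0 < h + x := fun {x} hx => by
    have : (1 : ℝ) ≤ x := by exact_mod_cast hx
    linarith
  have pg₁ := hpos hg₁
  have pg₂ := hpos hg₂
  have pg₃ := hpos hg₃
  have pj₁ := hpos (show 1 ≤ j₁ by omega)
  have pj₂ := hpos (show 1 ≤ j₂ by omega)
  have pj₃ := hpos (show 1 ≤ j₃ by omega)
  -- Elimination of `k`. Divided by `(h + g) * (h + j)`, each hypothesis puts `(1 / (h + g), 1 / (h
  -- + j))` on one fixed line.
  have E12 : μ * (g₂ - g₁) * (h + j₁) * (h + j₂) = l * (j₂ - j₁) * (h + g₁) * (h + g₂) := by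
    linear_combination e₁ * ((h + g₂) * (h + j₂)) - e₂ * ((h + g₁) * (h + j₁))
  have E13 : μ * (g₃ - g₁) * (h + j₁) * (h + j₃) = l * (j₃ - j₁) * (h + g₁) * (h + g₃) := by
    linear_combination e₁ * ((h + g₃) * (h + j₃)) - e₃ * ((h + g₁) * (h + j₁))
  have hμ : μ ≠ 0 := by
    rintro rfl
    have h0 : l * (j₂ - j₁) * (h + g₁) * (h + g₂) = 0 := by rw [← E12]; ring
    have : (j₂ : ℝ) - j₁ ≠ 0 := sub_ne_zero.2 (by exact_mod_cast h12.symm)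
    have : l * (j₂ - j₁) * (h + g₁) * (h + g₂) ≠ 0 := by positivity
    exact this h0
  -- Elimination of `μ` and `l` leaves a quadratic relation for `h` whose integer coefficients are
  -- bounded by powers of `M`.
  have key : ((j₂ - j₁) * (g₃ - g₁) : ℝ) * (h + g₂) * (h + j₃) =
      ((j₃ - j₁) * (g₂ - g₁) : ℝ) * (h + g₃) * (h + j₂) := by
    have hne : μ * l * (h + j₁) * (h + g₁) ≠ 0 := by positivity
    apply mul_left_cancel₀ hne
    linear_combination (μ * (g₃ - g₁) * (h + j₁) * (h + j₃)) * (-E12) +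
      (μ * (g₂ - g₁) * (h + j₁) * (h + j₂)) * E13
  have bd : ∀ {x y : ℤ}, 1 ≤ x → x ≤ M → 1 ≤ y → y ≤ M → |(x : ℝ) - y| ≤ M := by
    intro x y h1 h2 h3 h4
    have : |x - y| ≤ M := abs_le.2 ⟨by omega, by omega⟩
    exact_mod_cast this
  have bp : ∀ {x : ℤ}, 1 ≤ x → x ≤ M → |(x : ℝ)| ≤ M := by
    intro x h1 h2
    have : |x| ≤ M := abs_le.2 ⟨by omega, by omega⟩
    exact_mod_cast this
  have hM0 : (0 : ℝ) ≤ M := by linarith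
  set p : ℤ := (j₂ - j₁) * (g₃ - g₁) with hp
  set q : ℤ := (j₃ - j₁) * (g₂ - g₁) with hq
  have hp' : ((j₂ - j₁) * (g₃ - g₁) : ℝ) = p := by rw [hp]; push_cast; ring
  have hq' : ((j₃ - j₁) * (g₂ - g₁) : ℝ) = q := by rw [hq]; push_cast; ring
  have hpM : |(p : ℝ)| ≤ (M : ℝ) ^ 2 := by
    rw [← hp', abs_mul, sq]
    exact mul_le_mul (bd (by omega) hM₂ (by omega) hM₁) (bd hg₃ (by omega) hg₁ (by omega))
      (abs_nonneg _) hM0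
  have hqM : |(q : ℝ)| ≤ (M : ℝ) ^ 2 := by
    rw [← hq', abs_mul, sq]
    exact mul_le_mul (bd (by omega) hM₃ (by omega) hM₁) (bd hg₂ (by omega) hg₁ (by omega))
      (abs_nonneg _) hM0
  rw [hp', hq'] at key
  have hh0 : 0 < h := by linarith
  by_cases hpq : p = q
  · rw [hpq] at key
    have hq0 : (q : ℝ) ≠ 0 := by
      intro h0
      have h1 : (j₂ - j₁) * (g₃ - g₁) = 0 := by
        rw [← hp, hpq]; exact_mod_cast h0
      have h2 : (j₃ : ℤ) - j₁ ≠ 0 := by omega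
      have h3 : (j₂ : ℤ) - j₁ ≠ 0 := by omega
      have hg : g₃ = g₁ := by
        rcases mul_eq_zero.1 h1 with h | h
        · exact absurd h h3
        · omega
      rw [hg, sub_self, mul_zero, zero_mul, zero_mul] at E13
      have : (j₃ : ℝ) - j₁ ≠ 0 := by exact_mod_cast h2
      have : l * (j₃ - j₁) * (h + g₁) * (h + g₁) ≠ 0 := by positivity
      exact this E13.symm
    have k2 : (h + g₂) * (h + j₃) = (h + g₃) * (h + j₂) := by
      apply mul_left_cancel₀ hq0
      linear_combination key
    -- The leading terms have cancelled. The relation is linear in `h` with integer coefficients,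
    -- and `h` exceeds `2 * M ^ 2`, so both sides vanish.
    have k3 : h * ((g₂ + j₃ - g₃ - j₂ : ℤ) : ℝ) = ((g₃ * j₂ - g₂ * j₃ : ℤ) : ℝ) := by
      push_cast
      linear_combination k2
    have hc : g₂ + j₃ - g₃ - j₂ = 0 := by
      by_contra hne
      have h1 : (1 : ℝ) ≤ |((g₂ + j₃ - g₃ - j₂ : ℤ) : ℝ)| := by
        rw [← Int.cast_abs]; exact_mod_cast Int.one_le_abs hne
      have h2 : |((g₃ * j₂ - g₂ * j₃ : ℤ) : ℝ)| ≤ 2 * (M : ℝ) ^ 2 := by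
        push_cast
        refine (abs_sub _ _).trans ?_
        rw [abs_mul, abs_mul]
        have a1 := mul_le_mul (bp hg₃ (by omega)) (bp (x := j₂) (by omega) hM₂) (abs_nonneg _) hM0
        have a2 := mul_le_mul (bp hg₂ (by omega)) (bp (x := j₃) (by omega) hM₃) (abs_nonneg _) hM0
        rw [← sq] at a1 a2
        linarith
      rw [← k3, abs_mul, abs_of_pos hh0] at h2
      have := le_mul_of_one_le_right hh0.le h1
      linarith
    rw [hc, Int.cast_zero, mul_zero] at k3
    have k4 : g₃ * j₂ - g₂ * j₃ = 0 := by exact_mod_cast k3.symm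
    have k5 : (j₃ - j₂) * (g₂ - j₂) = 0 := by
      have : g₃ = g₂ + j₃ - j₂ := by omega
      rw [this] at k4
      linear_combination -k4
    rcases mul_eq_zero.1 k5 with h | h <;> omega
  · have h1 : (1 : ℝ) ≤ |((p : ℝ) - q)| := by
      have : (1 : ℤ) ≤ |p - q| := Int.one_le_abs (sub_ne_zero.2 hpq)
      exact_mod_cast this
    -- The leading coefficient is a nonzero integer, so the other terms must reach `h ^ 2`; they are
    -- at most `4 * M ^ 3 * h + 2 * M ^ 4`, too small for `h > M ^ 4 - 1`.
    have k2 : ((p : ℝ) - q) * h ^ 2 = h * (q * (g₃ + j₂) - p * (g₂ + j₃)) +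
        (q * (g₃ * j₂) - p * (g₂ * j₃)) := by linear_combination key
    have s1 : |(g₃ : ℝ) + j₂| ≤ 2 * M := by
      refine (abs_add_le _ _).trans ?_
      linarith [bp hg₃ (by omega), bp (x := j₂) (by omega) hM₂]
    have s2 : |(g₂ : ℝ) + j₃| ≤ 2 * M := by
      refine (abs_add_le _ _).trans ?_
      linarith [bp hg₂ (by omega), bp (x := j₃) (by omega) hM₃]
    have s3 : |(g₃ : ℝ) * j₂| ≤ (M : ℝ) ^ 2 := by
      rw [abs_mul, sq]
      exact mul_le_mul (bp hg₃ (by omega)) (bp (x := j₂) (by omega) hM₂) (abs_nonneg _) hM0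
    have s4 : |(g₂ : ℝ) * j₃| ≤ (M : ℝ) ^ 2 := by
      rw [abs_mul, sq]
      exact mul_le_mul (bp hg₂ (by omega)) (bp (x := j₃) (by omega) hM₃) (abs_nonneg _) hM0
    have c1 : |(q : ℝ) * (g₃ + j₂) - p * (g₂ + j₃)| ≤ 4 * (M : ℝ) ^ 3 := by
      refine (abs_sub _ _).trans ?_
      rw [abs_mul, abs_mul]
      have a1 := mul_le_mul hqM s1 (abs_nonneg _) (by positivity)
      have a2 := mul_le_mul hpM s2 (abs_nonneg _) (by positivity)
      have e : (M : ℝ) ^ 2 * (2 * M) = 2 * (M : ℝ) ^ 3 := by ring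
      rw [e] at a1 a2
      linarith
    have c2 : |(q : ℝ) * (g₃ * j₂) - p * (g₂ * j₃)| ≤ 2 * (M : ℝ) ^ 4 := by
      refine (abs_sub _ _).trans ?_
      rw [abs_mul (q : ℝ), abs_mul (p : ℝ)]
      have a1 := mul_le_mul hqM s3 (abs_nonneg _) (by positivity)
      have a2 := mul_le_mul hpM s4 (abs_nonneg _) (by positivity)
      have e : (M : ℝ) ^ 2 * (M : ℝ) ^ 2 = (M : ℝ) ^ 4 := by ring
      rw [e] at a1 a2
      linarith
    have k3 : h ^ 2 ≤ h * (4 * (M : ℝ) ^ 3) + 2 * (M : ℝ) ^ 4 := by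
      calc h ^ 2 ≤ |(p : ℝ) - q| * h ^ 2 := le_mul_of_one_le_left (by positivity) h1
        _ = |((p : ℝ) - q) * h ^ 2| := by rw [abs_mul, abs_of_nonneg (sq_nonneg h)]
        _ ≤ |h * ((q : ℝ) * (g₃ + j₂) - p * (g₂ + j₃))| +
            |(q : ℝ) * (g₃ * j₂) - p * (g₂ * j₃)| := by rw [k2]; exact abs_add_le _ _
        _ ≤ _ := by
          rw [abs_mul, abs_of_pos hh0]
          exact add_le_add (mul_le_mul_of_nonneg_left c1 hh0.le) c2
    have a1 : (M : ℝ) ^ 3 - 1 ≤ h - 4 * (M : ℝ) ^ 3 := by linarith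
    have a2 : ((M : ℝ) ^ 4 - 1) * ((M : ℝ) ^ 3 - 1) ≤ h * (h - 4 * (M : ℝ) ^ 3) :=
      mul_le_mul hh.le a1 (by linarith) hh0.le
    have a3 : 124 * ((M : ℝ) ^ 4 - 1) ≤ ((M : ℝ) ^ 4 - 1) * ((M : ℝ) ^ 3 - 1) := by
      rw [mul_comm]
      exact mul_le_mul_of_nonneg_left (by linarith) (by linarith)
    have a4 : h * (h - 4 * (M : ℝ) ^ 3) = h ^ 2 - h * (4 * (M : ℝ) ^ 3) := by ring
    linarith

/-! ### Normalized drawings and equidistant rows -/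

namespace FanData

variable {F : FanData}

theorem IsGeneralizedFan.extended_consecutive (hF : F.IsGeneralizedFan) {β : Fin (F.k + 2)} {i : ℤ}
    (h1 : F.base β + i * F.ε β ∈ F.extended β)
    (h2 : F.base β + ((i + 1 : ℤ) : ℝ) * F.ε β ∈ F.extended β) :
    ∀ z ∈ F.rows, ¬ (F.base β + i * F.ε β < z ∧ z < F.base β + ((i + 1 : ℤ) : ℝ) * F.ε β) := by
  rintro z (hz | hz) ⟨h3, h4⟩
  · rcases hF.longRows_trichotomy hz β with ⟨l, -, -, rfl⟩ | h | h
    · rw [hF.height_lt_iff] at h3 h4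
      omega
    · exact lt_asymm h4 (h _ h2)
    · exact lt_asymm h3 (h _ h1)
  · obtain ⟨γ, hγ⟩ := Set.mem_iUnion.1 hz
    rcases lt_trichotomy γ β with h | rfl | h
    · exact lt_asymm h3 (hF.ordered _ _ h z (.inr hγ) _ h1)
    · obtain ⟨l, -, rfl⟩ := hγ
      rw [hF.height_lt_iff] at h3 h4
      omega
    · exact lt_asymm h4 (hF.ordered _ _ h _ h2 z (.inr hγ))

theorem extended_subset_rows (β : Fin (F.k + 2)) : F.extended β ⊆ F.rows := fun _ h => h.elim
  (fun h => longRows_subset_rows (bundle_subset_longRows _ h))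
  fun h => shortRows_subset_rows (extension_subset_shortRows _ h)

namespace Drawing

section

variable (hF : F.IsGeneralizedFan) {X : Plane → ℝ} {Y : ℝ → ℝ} (hD : F.Drawing X Y)
include hF hD

/-- After a projective transformation `s_1` and `s_3` are vertical. -/
theorem exists_normalized : ∃ X' Y', F.Drawing X' Y' ∧
    (∀ y ∈ F.rows, X' (F.colPoint 1 y) = 0) ∧ (∀ y ∈ F.rows, X' (F.colPoint 3 y) = 2) ∧
    ∀ S ⊆ F.stripPoints, (∃ α β : ℝ, ∀ q ∈ S, X' q = α + β * Y' q.2) →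
      ∃ α β : ℝ, ∀ q ∈ S, X q = α + β * Y q.2 := by
  obtain ⟨α₁, β₁, h1⟩ := hD.col_line hF 1
  obtain ⟨α₃, β₃, h3⟩ := hD.col_line hF 3
  -- The distance from `s_1` to `s_3` within a row. Since it is affine in `Y`, dividing by it is a
  -- projective change of coordinates.
  let w : ℝ → ℝ := fun y => α₃ - α₁ + (β₃ - β₁) * Y y
  have hw : ∀ y ∈ F.rows, 0 < w y := fun y hy => by
    have := hD.lt _ (colPoint_mem 1 hy) _ (colPoint_mem 3 hy) rfl
      (hF.colPoint_lt (by decide) hy)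
    rw [h1 y hy, h3 y hy] at this
    simp only [w]; linarith
  have hw0 := hw 0 zero_mem_rows
  have hdiff : ∀ {y z}, y ∈ F.rows → z ∈ F.rows →
      (Y z - Y 0) / w z - (Y y - Y 0) / w y = (Y z - Y y) * w 0 / (w z * w y) := by
    intro y z hy hz
    have := (hw y hy).ne'
    have := (hw z hz).ne'
    field_simp
    simp only [w]
    ring
  refine ⟨fun v => 2 * (X v - (α₁ + β₁ * Y v.2)) / w v.2, fun y => (Y y - Y 0) / w y,
    ⟨?_, ?_, ?_⟩, ?_, ?_, ?_⟩
  · intro y hy z hz hlt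
    have hyw := hw y hy
    have hzw := hw z hz
    have := hD.Y_lt hF hy hz hlt
    have := hdiff hy hz
    have : 0 < (Y z - Y y) * w 0 / (w z * w y) :=
      div_pos (mul_pos (by linarith) hw0) (by positivity)
    change (Y y - Y 0) / w y < (Y z - Y 0) / w z
    linarith
  · intro u hu v hv huv hlt
    have := hD.lt u hu v hv huv hlt
    change 2 * (X u - (α₁ + β₁ * Y u.2)) / w u.2 < 2 * (X v - (α₁ + β₁ * Y v.2)) / w v.2
    rw [huv]
    exact div_lt_div_of_pos_right (by linarith) (hw _ (snd_mem_rows hv))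
  · intro u hu v hv huv hex
    obtain ⟨r, hr, hur, hrv, h⟩ := hD.blocked u hu v hv huv hex
    refine ⟨r, hr, hur, hrv, ?_⟩
    have wu := (hw _ (snd_mem_rows hu)).ne'
    have wv := (hw _ (snd_mem_rows hv)).ne'
    have wr := (hw _ (snd_mem_rows hr)).ne'
    change 2 * (X r - (α₁ + β₁ * Y r.2)) / w r.2 * ((Y v.2 - Y 0) / w v.2 - (Y u.2 - Y 0) / w u.2) =
      2 * (X u - (α₁ + β₁ * Y u.2)) / w u.2 * ((Y v.2 - Y 0) / w v.2 - (Y r.2 - Y 0) / w r.2) +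
      2 * (X v - (α₁ + β₁ * Y v.2)) / w v.2 * ((Y r.2 - Y 0) / w r.2 - (Y u.2 - Y 0) / w u.2)
    rw [hdiff (snd_mem_rows hu) (snd_mem_rows hv), hdiff (snd_mem_rows hr) (snd_mem_rows hv),
      hdiff (snd_mem_rows hu) (snd_mem_rows hr)]
    field_simp
    linear_combination h
  · intro y hy
    simp [h1 y hy]
  · intro y hy
    have := (hw y hy).ne'
    simp only [h3 y hy, colPoint_snd]
    rw [div_eq_iff this]
    simp only [w]; ring
  · rintro S hS ⟨α, β, h⟩
    refine ⟨α₁ + α / 2 * (α₃ - α₁) - β / 2 * Y 0, β₁ + α / 2 * (β₃ - β₁) + β / 2, fun q hq => ?_⟩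
    have wq := (hw _ (snd_mem_rows (hS hq))).ne'
    have := h q hq
    simp only at this
    field_simp at this
    simp only [w] at this
    linear_combination this / 2

variable (h1 : ∀ y ∈ F.rows, X (F.colPoint 1 y) = 0) (h3 : ∀ y ∈ F.rows, X (F.colPoint 3 y) = 2)
include h1 h3

/-- Equidistant consecutive rows remain equidistant. -/
theorem Y_midpoint {A B C : ℝ} (hA : A ∈ F.rows) (hB : B ∈ F.rows) (hC : C ∈ F.rows)
    (hAB : A < B) (hBC : B < C) (hmid : 2 * B = A + C)
    (hcon : ∀ z ∈ F.rows, ¬ (A < z ∧ z < B) ∧ ¬ (B < z ∧ z < C)) : 2 * Y B = Y A + Y C := by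
  have hH := hF.H_pos.ne'
  have y1 := hD.Y_lt hF hA hB hAB
  have y2 := hD.Y_lt hF hB hC hBC
  -- In the fan both diagonals between rows `A` and `C` meet row `B` on `s_2`. In the drawing their
  -- blockers lie strictly between `s_1` and `s_3`, hence are that same point of `s_2`; comparing
  -- the two alignments gives the midpoint.
  have key : ∀ {i j : Fin 4}, (i = 1 ∧ j = 3) ∨ (i = 3 ∧ j = 1) →
      Aligned X Y (F.colPoint i A) (F.colPoint 2 B) (F.colPoint j C) := by
    intro i j hij
    have hs : Sbtw ℝ (F.colPoint i A) (F.colPoint 2 B) (F.colPoint j C) := by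
      rw [sbtw_plane_iff]
      refine ⟨fun e => ?_, 1 / 2, 1 / 2, by norm_num, by norm_num, by norm_num, ?_, ?_⟩
      · have : A = C := congrArg Prod.snd e
        linarith
      · have hB' : B = (A + C) / 2 := by linarith
        rcases hij with ⟨rfl, rfl⟩ | ⟨rfl, rfl⟩ <;>
        · simp only [colPoint, stripPoint, colLow, colHigh, hB',
            if_neg (show (1 : Fin 4) ≠ 0 by decide), if_neg (show (2 : Fin 4) ≠ 0 by decide),
            if_neg (show (3 : Fin 4) ≠ 0 by decide)]
          norm_num
          field_simp
          ring
      · simp only [colPoint_snd]; linarith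
    obtain ⟨r, hr, hbt, hal⟩ := hD.exists_blocker hF (colPoint_mem i hA) (colPoint_mem j hC)
      (by simp only [colPoint_snd]; linarith) (colPoint_mem 2 hB) hs
    simp only [colPoint_snd] at hbt
    have hrr := snd_mem_rows hr
    have hrB : r.2 = B := by
      have h3 := hcon _ hrr
      rcases hbt with hbt | hbt
      · by_contra hne
        rcases lt_or_gt_of_ne hne with h | h
        · exact h3.1 ⟨hbt.1, h⟩
        · exact h3.2 ⟨h, hbt.2⟩
      · linarith
    have hX : 0 < X r ∧ X r < 2 := by
      simp only [Aligned, colPoint_snd, hrB] at hal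
      rcases hij with ⟨rfl, rfl⟩ | ⟨rfl, rfl⟩
      · rw [h1 A hA, h3 C hC] at hal
        constructor <;> nlinarith
      · rw [h3 A hA, h1 C hC] at hal
        constructor <;> nlinarith
    have g1 : (F.colPoint 1 r.2).1 < r.1 :=
      (hD.lt_iff hF (colPoint_mem 1 hrr) hr rfl).1 (by rw [h1 _ hrr]; exact hX.1)
    have g3 : r.1 < (F.colPoint 3 r.2).1 :=
      (hD.lt_iff hF hr (colPoint_mem 3 hrr) rfl).1 (by rw [h3 _ hrr]; exact hX.2)
    obtain ⟨m, hm1, hm2, hm⟩ := hF.eq_colPoint_of_lt hr g1 g3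
    obtain rfl : m = 2 := by rw [Fin.lt_def] at hm1 hm2; ext; simp at hm1 hm2 ⊢; omega
    rw [hm, hrB] at hal
    exact hal
  have k1 := key (i := 1) (j := 3) (.inl ⟨rfl, rfl⟩)
  have k2 := key (i := 3) (j := 1) (.inr ⟨rfl, rfl⟩)
  simp only [Aligned, colPoint_snd] at k1 k2
  rw [h1 A hA, h3 C hC] at k1
  rw [h3 A hA, h1 C hC] at k2
  linarith

/-- The rows of an extended bundle are equidistant. -/
theorem exists_progression {β : Fin (F.k + 2)} {a b : ℤ} (hab : a < b)
    (hmem : ∀ i, a ≤ i → i ≤ b → F.base β + i * F.ε β ∈ F.extended β) :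
    ∃ y₀ e : ℝ, 0 < e ∧ ∀ i : ℤ, a ≤ i → i ≤ b → Y (F.base β + i * F.ε β) = y₀ + i * e := by
  let g : ℤ → ℝ := fun i => Y (F.base β + i * F.ε β)
  have hrow : ∀ i, a ≤ i → i ≤ b → F.base β + i * F.ε β ∈ F.rows := fun i h1 h2 =>
    extended_subset_rows _ (hmem i h1 h2)
  have hstep : ∀ i, a ≤ i → i + 1 ≤ b → g (i + 1) - g i = g (a + 1) - g a := by
    intro i hi
    induction i, hi using Int.leInduction with
    | base => exact fun _ => rfl
    | succ i hi ih =>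
      intro hb
      rw [← ih (by omega)]
      have := hD.Y_midpoint hF h1 h3 (hrow i hi (by omega)) (hrow (i + 1) (by omega) (by omega))
        (hrow (i + 1 + 1) (by omega) hb) ((hF.height_lt_iff β).2 (by omega))
        ((hF.height_lt_iff β).2 (by omega)) (by push_cast; ring) fun z hz =>
        ⟨hF.extended_consecutive (hmem i hi (by omega)) (hmem (i + 1) (by omega) (by omega)) z hz,
          hF.extended_consecutive (hmem (i + 1) (by omega) (by omega))
            (hmem (i + 1 + 1) (by omega) hb) z hz⟩
      simp only [g]
      linarith
  refine ⟨g a - a * (g (a + 1) - g a), g (a + 1) - g a, ?_, ?_⟩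
  · have := hD.Y_lt hF (hrow a le_rfl hab.le) (hrow (a + 1) (by omega) (by omega))
      ((hF.height_lt_iff β).2 (by omega))
    simp only [g]; linarith
  · intro i hi
    change _ → g i = _
    induction i, hi using Int.leInduction with
    | base => intro _; ring
    | succ i hi ih =>
      intro hb
      have := hstep i hi hb
      have := ih (by omega)
      push_cast
      linarith

/-- Blockers of pairs on a segment of `S` belong to segments of `S`. -/
theorem exists_seg_blocker {t : Fin F.n} {y x z : ℝ} (hy : y ∈ F.longRows) (hx : x ∈ F.longRows)
    (hz : z ∈ F.longRows) (h : (y < x ∧ x < z) ∨ (z < x ∧ x < y)) :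
    ∃ t', ∃ x' ∈ F.longRows, ((y < x' ∧ x' < z) ∨ (z < x' ∧ x' < y)) ∧
      Aligned X Y (F.segPoint t y) (F.segPoint t' x') (F.segPoint t z) := by
  have hyr := longRows_subset_rows hy
  have hzr := longRows_subset_rows hz
  have hgt : ∀ {y}, y ∈ F.longRows → 2 < X (F.segPoint t y) := fun {y} hy => by
    have hyr := longRows_subset_rows hy
    have := hD.lt _ (colPoint_mem 3 hyr) _ (pt_mem (s := .inr t) hy) rfl
      (hF.colPoint_lt_segPoint 3 t hyr)
    rwa [h3 y hyr] at this
  have hbt : Sbtw ℝ (F.pt (.inr t) y) (F.pt (.inr t) x) (F.pt (.inr t) z) := by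
    rcases h with h | h
    · exact hF.sbtw_pt _ h.1 h.2
    · exact (hF.sbtw_pt _ h.1 h.2).symm
  obtain ⟨r, hr, hb, hal⟩ := hD.exists_blocker hF (pt_mem hy) (pt_mem hz)
    (by simp only [pt_snd]; rcases h with h | h <;> intro e <;> linarith) (pt_mem hx) hbt
  simp only [pt_snd] at hb
  have hrr := snd_mem_rows hr
  -- Both ends of the pair are to the right of `s_3`, which is now the line `X = 2`, so the blocker
  -- is too.
  have hXr : 2 < X r := by
    simp only [Aligned, pt_inr, segPoint_snd] at hal
    have a1 := hgt hy
    have a2 := hgt hz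
    rcases hb with h | h
    · have y1 := hD.Y_lt hF hyr hrr h.1
      have y2 := hD.Y_lt hF hrr hzr h.2
      nlinarith
    · have y1 := hD.Y_lt hF hzr hrr h.1
      have y2 := hD.Y_lt hF hrr hyr h.2
      nlinarith
  obtain ⟨j | t', hs, he⟩ := hF.exists_strand hr
  · exfalso
    have : X r ≤ X (F.colPoint 3 r.2) := by
      refine (hD.le_iff hF hr (colPoint_mem 3 hrr) rfl).2 ?_
      have e : r.1 = (F.colPoint j r.2).1 := congrArg Prod.fst he
      rw [e]
      rcases (show j ≤ 3 from Fin.le_last j).eq_or_lt with rfl | h'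
      · exact le_rfl
      · exact (hF.colPoint_lt h' hrr).le
    rw [h3 _ hrr] at this
    linarith
  · rw [he] at hal
    exact ⟨t', r.2, hs, hb, hal⟩

/-- By `exists_seg_blocker` the segments of `S` contain their own blockers. Consecutive means
consecutive among rays here, since extension segments do not meet `S`. -/
theorem seg_aligned_of_no_crossing {A B C : ℝ} (hA : A ∈ F.longRows) (hB : B ∈ F.longRows)
    (hC : C ∈ F.longRows) (hAB : A < B) (hBC : B < C)
    (hcon : ∀ z ∈ F.longRows, ¬ (A < z ∧ z < B) ∧ ¬ (B < z ∧ z < C))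
    (hcr : ∀ x ∈ F.crossings, ¬ (A < x ∧ x < B) ∧ ¬ (B < x ∧ x < C)) (t : Fin F.n) :
    Aligned X Y (F.segPoint t A) (F.segPoint t B) (F.segPoint t C) := by
  refine hD.aligned_of_blockers hF (Set.range Sum.inr) hAB hBC ?_ ?_ ?_ (.inr t) ⟨t, rfl⟩
  · rintro _ ⟨t, rfl⟩; exact ⟨hA, hB, hC⟩
  · rintro _ ⟨t, rfl⟩
    obtain ⟨t', x', hx', hbt, hal⟩ := hD.exists_seg_blocker hF h1 h3 (t := t) hA hB hC
      (.inl ⟨hAB, hBC⟩)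
    have hxB : x' = B := by
      have h3 := hcon _ hx'
      rcases hbt with hbt | hbt
      · by_contra hne
        rcases lt_or_gt_of_ne hne with h | h
        · exact h3.1 ⟨hbt.1, h⟩
        · exact h3.2 ⟨h, hbt.2⟩
      · linarith [hbt.1, hbt.2]
    rw [hxB] at hal
    exact ⟨.inr t', ⟨t', rfl⟩, hal⟩
  · rintro s - s' - hlt
    have hB' := longRows_subset_rows hB
    exact ⟨hF.pt_le_of_no_crossing hB' (longRows_subset_rows hA) (fun x hx =>
        ⟨fun h => by linarith [h.1, h.2], (hcr x hx).1⟩) hlt,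
      hF.pt_le_of_no_crossing hB' (longRows_subset_rows hC) (fun x hx =>
        ⟨(hcr x hx).2, fun h => by linarith [h.1, h.2]⟩) hlt⟩

/-- A segment of `S` stays on its line from a bundle to a far row beyond which there is no other
row. -/
theorem seg_on_line_of_far (hn : 0 < F.n) {A : ℝ} (hA : A ∈ F.longRows) {z : ℤ → ℝ}
    (hz : ∀ j : ℤ, 1 ≤ j → j ≤ 5 * F.n → z j ∈ F.longRows) {e h : ℝ} (he : e ≠ 0)
    (hh : (5 * F.n : ℝ) ^ 4 - 1 < h)
    (hY : ∀ j : ℤ, 1 ≤ j → j ≤ 5 * F.n → Y (z j) = Y A + e * (h + j))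
    (hbet : ∀ j : ℤ, 1 ≤ j → j ≤ 5 * F.n → ∀ x ∈ F.longRows,
      (A < x ∧ x < z j) ∨ (z j < x ∧ x < A) → ∃ g : ℤ, 1 ≤ g ∧ g < j ∧ x = z g)
    (hfirst : ∀ j : ℤ, 1 < j → j ≤ 5 * F.n → (A < z 1 ∧ z 1 < z j) ∨ (z j < z 1 ∧ z 1 < A))
    (hlines : ∀ t, ∃ α β : ℝ, ∀ j : ℤ, 1 ≤ j → j ≤ 5 * F.n → X (F.segPoint t (z j)) = α + β * Y (z j))
    (t : Fin F.n) {α β : ℝ}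
    (hline : ∀ j : ℤ, 1 ≤ j → j ≤ 5 * F.n → X (F.segPoint t (z j)) = α + β * Y (z j)) :
    X (F.segPoint t A) = α + β * Y A := by
  by_contra hne
  choose m b hmb using hlines
  have hl : α + β * Y A - X (F.segPoint t A) ≠ 0 := sub_ne_zero.2 (Ne.symm hne)
  -- For `j ≥ 2` the pair at `A` and `z j` is blocked at some `z g` with `g < j`, by a segment `t'`
  -- that follows its own line in the bundle. Heights measured from `A` in units of `e` give the
  -- relation of `no_three_pairs`, with `l` the nonzero deviation assumed at `A`.
  have key : ∀ j ∈ Finset.Icc (2 : ℤ) (5 * F.n), ∃ (t' : Fin F.n) (g : ℤ), 1 ≤ g ∧ g < j ∧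
      (m t' + b t' * Y A - X (F.segPoint t A)) * (h + j) -
        (α + β * Y A - X (F.segPoint t A)) * (h + g) + (b t' - β) * e * (h + g) * (h + j) = 0 := by
    intro j hj
    obtain ⟨hj1, hj2⟩ := Finset.mem_Icc.1 hj
    obtain ⟨t', x', hx', hbt, hal⟩ := hD.exists_seg_blocker hF h1 h3 (t := t) hA
      (hz 1 le_rfl (by omega)) (hz j (by omega) hj2) (hfirst j (by omega) hj2)
    obtain ⟨g, hg1, hg2, rfl⟩ := hbet j (by omega) hj2 x' hx' hbt
    refine ⟨t', g, hg1, hg2, ?_⟩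
    simp only [Aligned, segPoint_snd] at hal
    rw [hline j (by omega) hj2, hmb t' g hg1 (by omega), hY j (by omega) hj2,
      hY g hg1 (by omega)] at hal
    apply mul_left_cancel₀ he
    linear_combination hal
  have : Nonempty (Fin F.n) := ⟨t⟩
  choose! T g hg1 hg2 hg using key
  -- The `5 n - 1` indices exceed twice the number of segments, so one segment blocks three pairs.
  obtain ⟨t', -, ht'⟩ := Finset.exists_lt_card_fiber_of_mul_lt_card_of_maps_to
    (s := Finset.Icc (2 : ℤ) (5 * F.n)) (t := Finset.univ) (f := T) (n := 2)
    (fun _ _ => Finset.mem_univ _) (by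
      rw [Finset.card_univ, Fintype.card_fin, Int.card_Icc]
      omega)
  obtain ⟨j₁, j₂, j₃, hj₁, hj₂, hj₃, n12, n13, n23⟩ := Finset.two_lt_card_iff.1 ht'
  rw [Finset.mem_filter] at hj₁ hj₂ hj₃
  have b1 := Finset.mem_Icc.1 hj₁.1
  have b2 := Finset.mem_Icc.1 hj₂.1
  have b3 := Finset.mem_Icc.1 hj₃.1
  have e1 := hg _ hj₁.1
  have e2 := hg _ hj₂.1
  have e3 := hg _ hj₃.1
  rw [hj₁.2] at e1
  rw [hj₂.2] at e2
  rw [hj₃.2] at e3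
  exact no_three_pairs (M := 5 * F.n) (by omega) (by push_cast; exact hh) hl n12 n13 n23
    (hg1 _ hj₁.1) (hg1 _ hj₂.1) (hg1 _ hj₃.1) (hg2 _ hj₁.1) (hg2 _ hj₂.1) (hg2 _ hj₃.1)
    b1.2 b2.2 b3.2 e1 e2 e3

end

end Drawing

/-! ### Straightness of the segments of `S` -/

namespace IsGeneralizedFan

variable (hF : F.IsGeneralizedFan)
include hF

theorem height_eq_iff (β : Fin (F.k + 2)) {i j : ℤ} :
    F.base β + i * F.ε β = F.base β + j * F.ε β ↔ i = j := by
  rw [le_antisymm_iff, hF.height_le_iff, hF.height_le_iff, ← le_antisymm_iff]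

/-- Rays between two rays of a bundle belong to the bundle. -/
theorem mem_bundle_of_between {β : Fin (F.k + 2)} {y z x : ℝ} (hy : y ∈ F.bundle β)
    (hz : z ∈ F.bundle β) (hx : x ∈ F.longRows) (h1 : y ≤ x) (h2 : x ≤ z) : x ∈ F.bundle β := by
  rcases hF.longRows_trichotomy hx β with h | h | h
  · exact h
  · exact absurd (h z (.inl hz)) (not_lt.2 h2)
  · exact absurd (h y (.inl hy)) (not_lt.2 h1)

theorem no_crossing_of_bundle {β : Fin (F.k + 2)} {y z : ℝ} (hy : y ∈ F.bundle β)
    (hz : z ∈ F.bundle β) : ∀ x ∈ F.crossings, ¬ (y < x ∧ x < z) := by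
  rintro x hx ⟨h1, h2⟩
  obtain ⟨γ, hγ1, hγ2⟩ := hF.crossings_zone x hx
  have hn := hF.n_pos_of_crossing hx
  obtain ⟨w1, hw1⟩ := hF.bundle_nonempty hn γ.castSucc
  obtain ⟨w2, hw2⟩ := hF.bundle_nonempty hn γ.succ
  rcases le_or_gt β γ.castSucc with h | h
  · rcases h.eq_or_lt with rfl | h
    · exact lt_asymm h2 (hγ1 z hz)
    · exact lt_asymm h2 ((hF.ordered _ _ h z (.inl hz) w1 (.inl hw1)).trans (hγ1 w1 hw1))
  · have h' : γ.succ ≤ β := by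
      rw [Fin.lt_def] at h; rw [Fin.le_def]; simpa using h
    rcases h'.eq_or_lt with rfl | h
    · exact lt_asymm h1 (hγ2 y hy)
    · exact lt_asymm h1 ((hγ2 w2 hw2).trans (hF.ordered _ _ h w2 (.inl hw2) y (.inl hy)))

end IsGeneralizedFan

namespace Drawing

variable (hF : F.IsGeneralizedFan) {X : Plane → ℝ} {Y : ℝ → ℝ} (hD : F.Drawing X Y)
include hF hD
variable (h1 : ∀ y ∈ F.rows, X (F.colPoint 1 y) = 0) (h3 : ∀ y ∈ F.rows, X (F.colPoint 3 y) = 2)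
include h1 h3

/-- No crossing lies between two rays of one bundle, so the monotone blocker argument applies at
each interior ray. -/
theorem seg_line_of_bundle (γ : Fin (F.k + 2)) (t : Fin F.n) :
    ∃ α β : ℝ, ∀ y ∈ F.bundle γ, X (F.segPoint t y) = α + β * Y y := by
  have hmem : ∀ {y}, y ∈ (bundle_finite γ).toFinset ↔ y ∈ F.bundle γ := by simp
  obtain ⟨α, β, h⟩ := exists_line_of_consecutive (bundle_finite γ).toFinset
    (X := fun z => X (F.segPoint t z)) (Y := Y)
    (hD.strictMono.mono fun z hz =>
      longRows_subset_rows (bundle_subset_longRows γ (by simpa using hz)))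
    fun a ha b hb c hc hab hbc hcon => by
      rw [hmem] at ha hb hc
      exact hD.seg_aligned_of_no_crossing hF h1 h3 (bundle_subset_longRows γ ha)
        (bundle_subset_longRows γ hb) (bundle_subset_longRows γ hc) hab hbc
        (fun z hz => ⟨fun h => (hcon z (hmem.2
            (hF.mem_bundle_of_between ha hb hz h.1.le h.2.le))).1 h,
          fun h => (hcon z (hmem.2 (hF.mem_bundle_of_between hb hc hz h.1.le h.2.le))).2 h⟩)
        (fun x hx => ⟨hF.no_crossing_of_bundle ha hb x hx, hF.no_crossing_of_bundle hb hc x hx⟩) t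
  exact ⟨α, β, fun y hy => h y (hmem.2 hy)⟩

/-- A segment of `S` is not bent at the lowest ray of a bundle. -/
theorem seg_aligned_bottom (hn : 0 < F.n) {γ : Fin (F.k + 2)} (hγ : γ ≠ 0) {A : ℝ}
    (hA : A ∈ F.longRows) (hlow : ∀ y ∈ F.extended γ, A < y)
    (hcon : ∀ z ∈ F.longRows, ¬ (A < z ∧ z < F.base γ + (1 : ℤ) * F.ε γ)) (t : Fin F.n) :
    Aligned X Y (F.segPoint t A) (F.segPoint t (F.base γ + (1 : ℤ) * F.ε γ))
      (F.segPoint t (F.base γ + (2 : ℤ) * F.ε γ)) := by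
  have hN : (0 : ℤ) < (5 * F.n) ^ 4 := by positivity
  have hb : ∀ j : ℤ, 1 ≤ j → j ≤ 5 * F.n → F.base γ + j * F.ε γ ∈ F.bundle γ :=
    fun j h1 h2 => ⟨j, h1, h2, rfl⟩
  have hl := fun j h1 h2 => bundle_subset_longRows γ (hb j h1 h2)
  have hmem : ∀ i : ℤ, -(5 * F.n) ^ 4 + 1 ≤ i → i ≤ 5 * F.n →
      F.base γ + i * F.ε γ ∈ F.extended γ := fun i h1 h2 => by
    rcases le_or_gt 1 i with h | h
    · exact .inl (hb i h h2)
    · exact .inr ⟨i, .inr ⟨hγ, by omega, by omega⟩, rfl⟩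
  obtain ⟨y₀, e, he, hY⟩ := hD.exists_progression hF h1 h3 (β := γ)
    (a := -(5 * F.n) ^ 4 + 1) (b := 5 * F.n) (by omega) hmem
  have hlt := hD.Y_lt hF (longRows_subset_rows hA)
    (extended_subset_rows _ (hmem _ le_rfl (by omega))) (hlow _ (hmem _ le_rfl (by omega)))
  rw [hY _ le_rfl (by omega)] at hlt
  have hlines := fun t => hD.seg_line_of_bundle hF h1 h3 γ t
  choose m b hmb using hlines
  -- `h` is the height of index `0` above `A` in units of `e`. Since `A` is below the lowest
  -- extension segment, of index `-(5 n) ^ 4 + 1`, it exceeds `(5 n) ^ 4 - 1`.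
  have key := hD.seg_on_line_of_far hF h1 h3 hn hA (z := fun j => F.base γ + j * F.ε γ) hl he.ne'
    (h := (y₀ - Y A) / e) (by
      rw [lt_div_iff₀ he]
      push_cast at hlt
      linarith)
    (fun j h1 h2 => by
      rw [hY j (by omega) h2]
      field_simp
      ring)
    (fun j h1 h2 x hx h => by
      rcases h with h | h
      · have hx1 : F.base γ + (1 : ℤ) * F.ε γ ≤ x := by
          by_contra! h'
          exact hcon x hx ⟨h.1, h'⟩
        obtain ⟨g, hg1, hg2, rfl⟩ := hF.mem_bundle_of_between (hb 1 le_rfl (by omega))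
          (hb j h1 h2) hx hx1 h.2.le
        exact ⟨g, hg1, (hF.height_lt_iff γ).1 h.2, rfl⟩
      · have := hlow _ (.inl (hb j h1 h2))
        exact absurd (h.1.trans h.2) (lt_asymm this))
    (fun j h1 h2 => .inl ⟨hlow _ (.inl (hb 1 le_rfl (by omega))), (hF.height_lt_iff γ).2 h1⟩)
    (fun t => ⟨m t, b t, fun j h1 h2 => hmb t _ (hb j h1 h2)⟩) t
    (fun j h1 h2 => hmb t _ (hb j h1 h2))
  simp only [Aligned, segPoint_snd]
  rw [key, hmb t _ (hb 1 le_rfl (by omega)), hmb t _ (hb 2 (by omega) (by omega))]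
  ring

/-- A segment of `S` is not bent at the highest ray of a bundle. -/
theorem seg_aligned_top (hn : 0 < F.n) {γ : Fin (F.k + 2)} (hγ : γ ≠ Fin.last (F.k + 1)) {C : ℝ}
    (hC : C ∈ F.longRows) (hhigh : ∀ y ∈ F.extended γ, y < C)
    (hcon : ∀ z ∈ F.longRows, ¬ (F.base γ + (5 * F.n : ℤ) * F.ε γ < z ∧ z < C)) (t : Fin F.n) :
    Aligned X Y (F.segPoint t (F.base γ + (5 * F.n - 1 : ℤ) * F.ε γ))
      (F.segPoint t (F.base γ + (5 * F.n : ℤ) * F.ε γ)) (F.segPoint t C) := by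
  have hN : (0 : ℤ) < (5 * F.n) ^ 4 := by positivity
  have hb : ∀ j : ℤ, 1 ≤ j → j ≤ 5 * F.n → F.base γ + j * F.ε γ ∈ F.bundle γ :=
    fun j h1 h2 => ⟨j, h1, h2, rfl⟩
  have hmem : ∀ i : ℤ, 1 ≤ i → i ≤ 5 * F.n + (5 * F.n) ^ 4 →
      F.base γ + i * F.ε γ ∈ F.extended γ := fun i h1 h2 => by
    rcases le_or_gt i (5 * F.n) with h | h
    · exact .inl (hb i h1 h)
    · exact .inr ⟨i, .inl ⟨hγ, by omega, by omega⟩, rfl⟩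
  obtain ⟨y₀, e, he, hY⟩ := hD.exists_progression hF h1 h3 (β := γ)
    (a := 1) (b := 5 * F.n + (5 * F.n) ^ 4) (by omega) hmem
  have hlt := hD.Y_lt hF (extended_subset_rows _ (hmem _ (by omega) le_rfl))
    (longRows_subset_rows hC) (hhigh _ (hmem _ (by omega) le_rfl))
  rw [hY _ (by omega) le_rfl] at hlt
  choose m b hmb using fun t => hD.seg_line_of_bundle hF h1 h3 γ t
  -- The bundle is numbered downwards with step `-e`, so that `z 1` is its top ray. The bound on `h`
  -- comes from the highest extension segment, of index `5 n + (5 n) ^ 4`.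
  have key := hD.seg_on_line_of_far hF h1 h3 hn hC
    (z := fun j => F.base γ + ((5 * F.n + 1 - j : ℤ) : ℝ) * F.ε γ)
    (fun j h1 h2 => bundle_subset_longRows γ (hb _ (by omega) (by omega)))
    (neg_ne_zero.2 he.ne') (h := (Y C - y₀ - (5 * F.n + 1) * e) / e) (by
      rw [lt_div_iff₀ he]
      push_cast at hlt
      linarith)
    (fun j h1 h2 => by
      rw [hY _ (by omega) (by omega)]
      push_cast
      field_simp
      ring)
    (fun j h1 h2 x hx h => by
      rcases h with h | h
      · have := hhigh _ (.inl (hb (5 * F.n + 1 - j) (by omega) (by omega)))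
        exact absurd (h.1.trans h.2) (lt_asymm this)
      · have hx1 : x ≤ F.base γ + (5 * F.n : ℤ) * F.ε γ := by
          by_contra! h'
          exact hcon x hx ⟨h', h.2⟩
        obtain ⟨g, hg1, hg2, rfl⟩ := hF.mem_bundle_of_between
          (hb (5 * F.n + 1 - j) (by omega) (by omega))
          (hb (5 * F.n) (by omega) le_rfl) hx h.1.le hx1
        have := (hF.height_lt_iff γ).1 h.1
        refine ⟨5 * F.n + 1 - g, by omega, by omega, ?_⟩
        rw [hF.height_eq_iff]
        omega)
    (fun j h1 h2 => .inr ⟨(hF.height_lt_iff γ).2 (by omega),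
      hhigh _ (.inl (hb _ (by omega) (by omega)))⟩)
    (fun t => ⟨m t, b t, fun j h1 h2 => hmb t _ (hb _ (by omega) (by omega))⟩) t
    (fun j h1 h2 => hmb t _ (hb _ (by omega) (by omega)))
  have k1 := hmb t _ (hb (5 * F.n - 1) (by omega) (by omega))
  have k2 := hmb t _ (hb (5 * F.n) (by omega) (by omega))
  simp only [Aligned, segPoint_snd]
  rw [key, k1, k2]
  ring

/-- If a crossing is near `B`, then `B` is an end ray of its bundle: the neighbour across the
crossings is an end ray of another bundle, and the other neighbour belongs to the bundle of `B`. -/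
theorem seg_aligned {A B C : ℝ} (hA : A ∈ F.longRows) (hB : B ∈ F.longRows)
    (hC : C ∈ F.longRows) (hAB : A < B) (hBC : B < C)
    (hcon : ∀ z ∈ F.longRows, ¬ (A < z ∧ z < B) ∧ ¬ (B < z ∧ z < C)) (t : Fin F.n) :
    Aligned X Y (F.segPoint t A) (F.segPoint t B) (F.segPoint t C) := by
  have hn := t.pos
  have hb : ∀ {γ : Fin (F.k + 2)} (j : ℤ), 1 ≤ j → j ≤ 5 * F.n →
      F.base γ + j * F.ε γ ∈ F.bundle γ := fun j h1 h2 => ⟨j, h1, h2, rfl⟩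
  by_cases hcr : ∀ x ∈ F.crossings, ¬ (A < x ∧ x < B) ∧ ¬ (B < x ∧ x < C)
  · exact hD.seg_aligned_of_no_crossing hF h1 h3 hA hB hC hAB hBC hcon hcr t
  simp only [not_forall] at hcr
  obtain ⟨x, hx, hcr⟩ := hcr
  by_cases hAx : A < x ∧ x < B
  · obtain ⟨β, rfl, rfl⟩ := hF.rows_around_crossing hx hA hB hAx.1 hAx.2 fun z hz => (hcon z hz).1
    obtain rfl : C = F.base β.succ + (2 : ℤ) * F.ε β.succ := by
      refine le_antisymm ?_ ?_
      · by_contra! h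
        exact (hcon _ (bundle_subset_longRows β.succ (hb 2 (by omega) (by omega)))).2
          ⟨(hF.height_lt_iff _).2 (by omega), h⟩
      · by_contra! h
        exact hF.extended_consecutive (.inl (hb 1 (by omega) (by omega)))
          (.inl (hb (1 + 1) (by omega) (by omega))) _ (longRows_subset_rows hC) ⟨hBC, h⟩
    exact hD.seg_aligned_bottom hF h1 h3 hn (Fin.succ_ne_zero β) hA
      (fun y hy => hF.ordered _ _ (Fin.castSucc_lt_succ) _
        (.inl (hb (5 * F.n) (by omega) le_rfl)) y hy)
      (fun z hz => (hcon z hz).1) t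
  · have hBx : B < x ∧ x < C := not_not.1 fun h => hcr ⟨hAx, h⟩
    obtain ⟨β, rfl, rfl⟩ := hF.rows_around_crossing hx hB hC hBx.1 hBx.2 fun z hz => (hcon z hz).2
    obtain rfl : A = F.base β.castSucc + (5 * F.n - 1 : ℤ) * F.ε β.castSucc := by
      refine le_antisymm ?_ ?_
      · by_contra! h
        have := hF.extended_consecutive (β := β.castSucc) (i := 5 * F.n - 1)
          (.inl (hb _ (by omega) (by omega)))
          (.inl (hb _ (by omega) (by omega))) _ (longRows_subset_rows hA)
        rw [sub_add_cancel] at this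
        exact this ⟨h, hAB⟩
      · by_contra! h
        exact (hcon _ (bundle_subset_longRows β.castSucc
          (hb (5 * F.n - 1) (by omega) (by omega)))).1
          ⟨h, (hF.height_lt_iff _).2 (by omega)⟩
    exact hD.seg_aligned_top hF h1 h3 hn (Fin.castSucc_lt_last β).ne hC
      (fun y hy => hF.ordered _ _ (Fin.castSucc_lt_succ) y hy _
        (.inl (hb 1 (by omega) (by omega))))
      (fun z hz => (hcon z hz).2) t

theorem seg_line_of_normalized (t : Fin F.n) :
    ∃ α β : ℝ, ∀ y ∈ F.longRows, X (F.segPoint t y) = α + β * Y y := by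
  have hfin := (rows_finite (F := F)).subset longRows_subset_rows
  have hmem : ∀ {y}, y ∈ hfin.toFinset ↔ y ∈ F.longRows := by simp
  obtain ⟨α, β, h⟩ := exists_line_of_consecutive hfin.toFinset
    (X := fun z => X (F.segPoint t z)) (Y := Y)
    (hD.strictMono.mono fun z hz => longRows_subset_rows (hmem.1 hz))
    fun a ha b hb c hc hab hbc hcon => hD.seg_aligned hF h1 h3 (hmem.1 ha) (hmem.1 hb) (hmem.1 hc)
      hab hbc (fun z hz => hcon z (hmem.2 hz)) t
  exact ⟨α, β, fun y hy => h y (hmem.2 hy)⟩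

end Drawing

theorem Drawing.seg_line (hF : F.IsGeneralizedFan) {X : Plane → ℝ} {Y : ℝ → ℝ}
    (hD : F.Drawing X Y) (t : Fin F.n) :
    ∃ α β : ℝ, ∀ y ∈ F.longRows, X (F.segPoint t y) = α + β * Y y := by
  obtain ⟨X', Y', hD', h1, h3, hback⟩ := hD.exists_normalized hF
  obtain ⟨α, β, h⟩ := hD'.seg_line_of_normalized hF h1 h3 t
  obtain ⟨α, β, h⟩ := hback (F.segPoint t '' F.longRows)
    (by rintro _ ⟨y, hy, rfl⟩; exact pt_mem (s := .inr t) hy)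
    ⟨α, β, by rintro _ ⟨y, hy, rfl⟩; exact h y hy⟩
  exact ⟨α, β, fun y hy => h _ ⟨y, hy, rfl⟩⟩

/-! ### Return to the fan -/

namespace IsGeneralizedFan

variable (hF : F.IsGeneralizedFan)
include hF

theorem strand_ends_mem (s : F.Strand) : F.pt s 0 ∈ F.stripPoints ∧ F.pt s F.H ∈ F.stripPoints := by
  rcases s with j | t
  · exact ⟨pt_mem (s := .inl j) zero_mem_rows, pt_mem (s := .inl j) top_mem_rows⟩
  · exact ⟨pt_mem (s := .inr t) zero_mem_longRows, pt_mem (s := .inr t) top_mem_longRows⟩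

/-- For a segment of `S`: a point of the fan on it cannot come from a column, since columns are
strictly to the left of `S`, so it comes from a segment of `S` and its row is a ray. -/
theorem mem_dom_of_eq {s : F.Strand} {r : Plane} (hr : r ∈ F.stripPoints) (h : r = F.pt s r.2) :
    r.2 ∈ F.dom s := by
  rcases s with j | t
  · exact snd_mem_rows hr
  · obtain ⟨j | t', hs, he⟩ := hF.exists_strand hr
    · have := hF.colPoint_lt_segPoint j t (snd_mem_rows hr)
      rw [← pt_inl, ← pt_inr, ← he, ← h] at this
      exact absurd this (lt_irrefl _)
    · exact hs

/-- The points of the fan on a strand. -/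
theorem points_on_strand (s : F.Strand) {v : Plane} (hv : v ∈ F.points)
    (h : v ∈ segment ℝ (F.place (F.pt s 0)) (F.place (F.pt s F.H))) :
    ∃ y ∈ F.dom s, v = F.place (F.pt s y) := by
  have hH := hF.H_pos
  obtain ⟨m0, mH⟩ := hF.strand_ends_mem s
  have hne : F.pt s 0 ≠ F.pt s F.H := fun e => hH.ne (congrArg Prod.snd e)
  have hne' : F.place (F.pt s 0) ≠ F.place (F.pt s F.H) := fun e => hne (hF.place_injOn m0 mH e)
  rw [mem_segment_iff_wbtw] at h
  rcases eq_or_ne v (F.place (F.pt s 0)) with rfl | h0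
  · exact ⟨0, hF.mem_dom_of_eq m0 rfl, rfl⟩
  rcases eq_or_ne v (F.place (F.pt s F.H)) with rfl | hT
  · exact ⟨F.H, hF.mem_dom_of_eq mH rfl, rfl⟩
  have hb : Sbtw ℝ (F.place (F.pt s 0)) v (F.place (F.pt s F.H)) := ⟨h, h0, hT⟩
  rcases hv with rfl | ⟨r, hr, rfl⟩
  · exact absurd hb (hF.not_sbtw_place_apex m0 mH hne)
  · rw [hF.sbtw_place_iff m0 hr mH hne, sbtw_plane_iff] at hb
    obtain ⟨-, a, b, ha, hb, hab, e1, e2⟩ := hb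
    have hrs : r = F.pt s r.2 := by
      ext
      · simp only [pt_snd] at e2
        rw [e1, pt_fst, pt_fst, pt_fst, e2]
        obtain rfl : a = 1 - b := by linarith
        field_simp
        ring
      · rfl
    exact ⟨r.2, hF.mem_dom_of_eq hr hrs, by rw [← hrs]⟩

/-- The points of the fan on a line through `p`. -/
theorem points_on_line {c v : Plane} (hc : c ∈ F.stripPoints) (hv : v ∈ F.points) {τ : ℝ}
    (h : v = AffineMap.lineMap F.apex (F.place c) τ) :
    v = F.apex ∨ ∃ r ∈ F.stripPoints, r.2 = c.2 ∧ v = F.place r := by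
  rcases hv with rfl | ⟨r, hr, rfl⟩
  · exact .inl rfl
  · exact .inr ⟨r, hr, hF.snd_eq_of_lineMap hr hc h, rfl⟩

end IsGeneralizedFan

theorem Drawing.strand_line (hF : F.IsGeneralizedFan) {X : Plane → ℝ} {Y : ℝ → ℝ}
    (hD : F.Drawing X Y) (s : F.Strand) :
    ∃ α β : ℝ, ∀ y ∈ F.dom s, X (F.pt s y) = α + β * Y y := by
  rcases s with j | t
  · exact hD.col_line hF j
  · exact hD.seg_line hF t

section

variable (hF : F.IsGeneralizedFan) {φ : F.points → Plane}
  (hφ : IsRealization (visibilityGraph F.points) φ)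
include hF hφ

theorem collinear_strand (s : F.Strand) :
    Collinear ℝ (φ '' {v | (v : Plane) ∈ segment ℝ (F.place (F.pt s 0)) (F.place (F.pt s F.H))}) := by
  obtain ⟨-, X, Y, hD, hcol⟩ := (hF.picture hφ).exists_drawing hF
  obtain ⟨α, β, h⟩ := hD.strand_line hF s
  have hS : F.pt s '' F.dom s ⊆ F.stripPoints := by
    rintro _ ⟨y, hy, rfl⟩
    exact pt_mem hy
  refine (hcol _ hS ⟨α, β, ?_⟩).subset ?_
  · rintro _ ⟨y, hy, rfl⟩
    exact h y hy
  · rintro _ ⟨⟨v, hv⟩, hvs, rfl⟩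
    obtain ⟨y, hy, rfl⟩ := hF.points_on_strand s hv hvs
    exact ⟨_, ⟨y, hy, rfl⟩, pull_eq φ (pt_mem hy)⟩

/-- Rays and extension segments are treated alike: both lie on a line through `p`, and all points of
one row go to one ray from the image of `p`. -/
theorem collinear_of_subset_line {c : Plane} (hc : c ∈ F.stripPoints) {S : Set Plane}
    (hS : ∀ v ∈ S, ∃ τ : ℝ, v = AffineMap.lineMap F.apex (F.place c) τ) :
    Collinear ℝ (φ '' {v | (v : Plane) ∈ S}) := by
  obtain ⟨hline, -⟩ := (hF.picture hφ).exists_drawing hF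
  rw [collinear_iff_exists_forall_eq_smul_vadd]
  refine ⟨φ ⟨F.apex, apex_mem_points⟩,
    F.dir (φ ⟨F.apex, apex_mem_points⟩) (pull φ) c.2, ?_⟩
  rintro _ ⟨⟨v, hv⟩, hvS, rfl⟩
  obtain ⟨τ, hτ⟩ := hS v hvS
  rcases hF.points_on_line hc hv hτ with rfl | ⟨r, hr, hrc, rfl⟩
  · exact ⟨0, by simp⟩
  · obtain ⟨t, ht⟩ := hline r hr
    rw [pull_eq φ hr, hrc] at ht
    exact ⟨t, by rw [vadd_eq_add]; exact ht⟩

end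

end FanData

theorem mainTheorem5 (F : FanData) (hF : F.IsGeneralizedFan)
    (φ : F.points → Plane) (hφ : IsRealization (visibilityGraph F.points) φ) :
    (∀ s ∈ F.segments, Collinear ℝ (φ '' {v | (v : Plane) ∈ s})) ∧
    (∀ r ∈ F.rays, Collinear ℝ (φ '' {v | (v : Plane) ∈ r})) := by
  constructor
  · rintro s ((⟨t, rfl⟩ | ⟨j, rfl⟩) | ⟨y, hy, rfl⟩)
    · exact FanData.collinear_strand hF hφ (.inr t)
    · exact FanData.collinear_strand hF hφ (.inl j)
    · refine FanData.collinear_of_subset_line hF hφ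
        (FanData.colPoint_mem 3 (FanData.shortRows_subset_rows hy)) fun v hv => ?_
      rw [segment_eq_image_lineMap] at hv
      obtain ⟨τ, -, rfl⟩ := hv
      exact ⟨τ, rfl⟩
  · rintro r ⟨y, hy, rfl⟩
    refine FanData.collinear_of_subset_line hF hφ
      (FanData.colPoint_mem 0 (FanData.longRows_subset_rows hy)) ?_
    rintro _ ⟨τ, -, rfl⟩
    exact ⟨τ, rfl⟩
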